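/- Let $M$ be a $C^\infty$ manifold (Hausdorff, $\sigma$-compact, of dimension $m$), let $S\subset M$ be a closed (embedded) submanifold, and let $H$ be a Lie group which acts smoothly on $M$ and preserves $S$, i.e. $\ell_h S\subset S$ for every $h\in H$, where $\ell_h:M\to M$ is translation by $h$. Let $\mathcal E\to M$ be an $H$-equivariant smooth complex vector bundle of finite rank $r$: the action of $H$ lifts to a smooth action on the total space that is linear on fibres. Let $C^{-\infty}(M,\mathcal E)$ be the space of $\mathcal E$-valued distributions on $M$, i.e. the continuous dual of the space of compactly supported smooth $\mathcal E^*$-valued measures. The group $H$ acts on it by $\langle \ell_h\sigma,\varphi\rangle=\langle\sigma,h^*\varphi\rangle$, where $h^*\varphi$ is the pullback of the $\mathcal E^*$-valued measure $\varphi$ under $h$ (for a smooth section, $(\ell_h\sigma)(x)=h\cdot\sigma(h^{-1}x)$). Let $\mathcal I_S$ be the ideal sheaf of smooth complex functions vanishing on $S$. A smooth function vanishes to order $k$ on $S$ if it lies in $\mathcal I_S^{\,k}$, and a linear differential operator $D$ with smooth coefficients is tangential to $S$ if $D\,\mathcal I_S^{\,j}\subset\mathcal I_S^{\,j}$ for every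 $j\in\mathbb N$. A scalar distribution $\sigma$ vanishes to order $k\ge 0$ along $S$ if every $p\in S$ has an open neighbourhood $U_p$ on which $\sigma=\sum_{1\le j\le N} f_j D_j h_j$ as distributions, with finitely many $f_j\in C^\infty(U_p)$ vanishing to order $k$ on $S\cap U_p$, differential operators $D_j$ on $U_p$ tangential to $S\cap U_p$, and measurable locally bounded functions $h_j$ on $U_p$. An $\mathcal E$-valued distribution vanishes to order $k$ along $S$ if near each point of $S$ this holds for its $r$ scalar components with respect to a smooth local trivialization of $\mathcal E$. Let $dh$ be a smooth (complex) measure on $H$, i.e. a smooth function times Haar measure, let $\Omega\subset H$ be compact and measurable, let $k\ge 0$ be an integer, and let $\sigma\in C^{-\infty}(M,\mathcal E)$ vanish to order $k$ along $S$. Then for every compactly supported smooth $\mathcal E^*$-valued measure $\varphi$ the function $h\mapsto\langle\ell_h\sigma,\varphi\rangle$ is integrable over $\Omega$ with respect to $dh$, the formula $$\Bigl\langle \int_\Omega \ell_h\sigma\,dh,\ \varphi\Bigr\rangle=\int_\Omega\langle \ell_h\sigma,\varphi\rangle\,dh$$ defines an $\mathcal E$-valued distribution $\int_\Omega\ell_h\sigma\,dh\in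 C^{-\infty}(M,\mathcal E)$, and this distribution vanishes to order $k$ along $S$. -/

import Mathlib

open scoped Manifold ContDiff
open Bundle MeasureTheory Set

noncomputable section

namespace DistVanish

/-! ### Differential operators and ideals of functions on open subsets of `ℝᵐ` -/

section Euclidean

variable {m : ℕ}

/-- `MemIdealPow Z k W g`: the function `g` is smooth on the open set `W` and lies in the `k`-th
power of the ideal sheaf of `Z`: near every point of `W` it is a finite sum of products
`c * u₁ * ⋯ * u_k` of smooth complex functions whose factors `u₁, …, u_k` vanish on `Z`. -/
def MemIdealPow (Z : Set (EuclideanSpace ℝ (Fin m))) (k : ℕ)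
    (W : Set (EuclideanSpace ℝ (Fin m))) (g : EuclideanSpace ℝ (Fin m) → ℂ) : Prop :=
  ContDiffOn ℝ ∞ g W ∧
    ∀ p ∈ W, ∃ W' ⊆ W, IsOpen W' ∧ p ∈ W' ∧
      ∃ (N : ℕ) (c : Fin N → EuclideanSpace ℝ (Fin m) → ℂ)
        (u : Fin N → Fin k → EuclideanSpace ℝ (Fin m) → ℂ),
        (∀ a, ContDiffOn ℝ ∞ (c a) W') ∧
        (∀ a b, ContDiffOn ℝ ∞ (u a b) W' ∧ ∀ z ∈ W' ∩ Z, u a b z = 0) ∧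
        ∀ y ∈ W', g y = ∑ a, c a y * ∏ b, u a b y

/-- The iterated partial derivative `∂_{w 0} ⋯ ∂_{w (q-1)} g`. -/
def partialDeriv {q : ℕ} (w : Fin q → Fin m) (g : EuclideanSpace ℝ (Fin m) → ℂ)
    (y : EuclideanSpace ℝ (Fin m)) : ℂ :=
  iteratedFDeriv ℝ q g y (fun l => EuclideanSpace.single (w l) (1 : ℝ))

variable (m) in
/-- A linear differential expression `∑_{q ≤ d} ∑_w a_{q,w} ∂_w`, where `w` runs over the words of
length `q` in the coordinate directions. -/
structure DiffOp where
  /-- a bound for the order -/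
  order : ℕ
  /-- the coefficient functions -/
  coeff : (q : ℕ) → (Fin q → Fin m) → EuclideanSpace ℝ (Fin m) → ℂ

/-- The coefficients are smooth on `V`. -/
def DiffOp.SmoothOn (D : DiffOp m) (V : Set (EuclideanSpace ℝ (Fin m))) : Prop :=
  ∀ q w, ContDiffOn ℝ ∞ (D.coeff q w) V

/-- The operator applied to a smooth function. -/
def DiffOp.apply (D : DiffOp m) (g : EuclideanSpace ℝ (Fin m) → ℂ)
    (y : EuclideanSpace ℝ (Fin m)) : ℂ :=
  ∑ q ∈ Finset.range (D.order + 1), ∑ w : Fin q → Fin m, D.coeff q w y * partialDeriv w g y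

/-- The formal transpose `g ↦ ∑ (-1)^q ∂_w (a_{q,w} g)` with respect to Lebesgue measure. -/
def DiffOp.transpose (D : DiffOp m) (g : EuclideanSpace ℝ (Fin m) → ℂ)
    (y : EuclideanSpace ℝ (Fin m)) : ℂ :=
  ∑ q ∈ Finset.range (D.order + 1), ∑ w : Fin q → Fin m,
    (-1 : ℂ) ^ q * partialDeriv w (fun z => D.coeff q w z * g z) y

/-- `D` is tangential to `Z` on the open set `V`: as an operator on the sheaf of smooth functions
on `V` it preserves every power of the ideal sheaf of `Z`. -/
def DiffOp.TangentialOn (D : DiffOp m) (Z V : Set (EuclideanSpace ℝ (Fin m))) : Prop :=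
  ∀ (k : ℕ) (W : Set (EuclideanSpace ℝ (Fin m))), IsOpen W → W ⊆ V →
    ∀ g, MemIdealPow Z k W g → MemIdealPow Z k W (D.apply g)

/-- `h` is measurable and locally bounded on the open set `V`. -/
def MeasurableLocallyBoundedOn (h : EuclideanSpace ℝ (Fin m) → ℂ)
    (V : Set (EuclideanSpace ℝ (Fin m))) : Prop :=
  Measurable h ∧ ∀ K ⊆ V, IsCompact K → ∃ C : ℝ, ∀ y ∈ K, ‖h y‖ ≤ C

end Euclidean

/-! ### Submanifolds -/

/-- `S` is a closed (embedded) submanifold of the `m`-dimensional manifold `M`: a closed subset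
which near each of its points is, in suitable smooth coordinates, the zero set of the first `c`
coordinates. -/
def IsClosedSubmanifold (m : ℕ) {M : Type*} [TopologicalSpace M]
    [ChartedSpace (EuclideanSpace ℝ (Fin m)) M] (S : Set M) : Prop :=
  IsClosed S ∧ ∀ p ∈ S, ∃ e ∈ IsManifold.maximalAtlas (𝓡 m) ∞ M, p ∈ e.source ∧
    ∃ c : ℕ, c ≤ m ∧ ∀ x ∈ e.source, x ∈ S ↔ ∀ i : Fin m, i.1 < c → e x i = 0

/-! ### Vector-valued distributions -/

section Bundles

variable {M : Type*} [TopologicalSpace M]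
  (E : M → Type*) [∀ x, AddCommGroup (E x)] [∀ x, Module ℂ (E x)]
  [∀ x, TopologicalSpace (E x)]

/-- A complex vector bundle is in particular a real vector bundle; its smoothness over the (real)
manifold `M` is smoothness of this real bundle. -/
instance realVectorBundle (r : ℕ) [TopologicalSpace (TotalSpace (Fin r → ℂ) E)]
    [FiberBundle (Fin r → ℂ) E]
    [VectorBundle ℂ (Fin r → ℂ) E] : VectorBundle ℝ (Fin r → ℂ) E := by
  have lin : ∀ (t : Trivialization (Fin r → ℂ) (π (Fin r → ℂ) E)) [MemTrivializationAtlas t],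
      t.IsLinear ℝ := fun t _ => ⟨fun b hb =>
    { map_add := (Trivialization.linear ℂ t hb).map_add
      map_smul := fun c v => by
        have := (Trivialization.linear ℂ t hb).map_smul (c : ℂ) v
        simpa using this }⟩
  refine ⟨lin, fun t t' _ _ => ?_⟩
  have h := continuousOn_coordChange ℂ t t' (F := Fin r → ℂ) (E := E)
  have h2 := (ContinuousLinearMap.restrictScalarsL ℂ (Fin r → ℂ) (Fin r → ℂ) ℝ
    ℝ).continuous.comp_continuousOn h
  refine h2.congr fun b hb => ?_
  ext1 v
  have := lin t
  have := lin t'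
  simp [Trivialization.coordChangeL_apply _ _ hb]

variable (m : ℕ) [ChartedSpace (EuclideanSpace ℝ (Fin m)) M]

/-- The coordinate frame `∂₁, …, ∂ₘ` of the coordinate system `e`, at the point with coordinates
`y`. -/
def coordFrame {M : Type*} [TopologicalSpace M] {m : ℕ}
    [ChartedSpace (EuclideanSpace ℝ (Fin m)) M]
    (e : OpenPartialHomeomorph M (EuclideanSpace ℝ (Fin m)))
    (y : EuclideanSpace ℝ (Fin m)) (i : Fin m) : TangentSpace (𝓡 m) (e.symm y) :=
  mfderiv (𝓡 m) (𝓡 m) e.symm y (EuclideanSpace.single i (1 : ℝ))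

/-- Fields which attach to every `x : M` and every `m`-tuple of tangent vectors at `x` an element
of the dual space of `E x`. Those which scale by `|det A|` under a linear change `A` of the tuple
are the (not necessarily smooth) sections of `E* ⊗ |Λ|`, i.e. the `E*`-valued densities. -/
abbrev DualField := ∀ x : M, (Fin m → TangentSpace (𝓡 m) x) → Module.Dual ℂ (E x)

variable {E m}

/-- The `i`-th component of an `E*`-valued density, relative to Lebesgue measure in the coordinate
system `e` and the frame of `E` given by the local trivialization `t`. -/
def component {r : ℕ} [TopologicalSpace (TotalSpace (Fin r → ℂ) E)]
    (φ : DualField E m) (e : OpenPartialHomeomorph M (EuclideanSpace ℝ (Fin m)))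
    (t : Trivialization (Fin r → ℂ) (π (Fin r → ℂ) E)) (i : Fin r)
    (y : EuclideanSpace ℝ (Fin m)) : ℂ :=
  φ (e.symm y) (coordFrame e y) (t.symm (e.symm y) (Pi.single i 1))

variable (E m)

/-- The space of compactly supported smooth `E*`-valued measures on `M`, viewed as densities. -/
def testMeasures (r : ℕ) [TopologicalSpace (TotalSpace (Fin r → ℂ) E)]
    [FiberBundle (Fin r → ℂ) E] : Submodule ℂ (DualField E m) where
  carrier := {φ |
    (∀ x (A : TangentSpace (𝓡 m) x →ₗ[ℝ] TangentSpace (𝓡 m) x) v,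
      φ x (fun i => A (v i)) = ((|LinearMap.det A| : ℝ) : ℂ) • φ x v) ∧
    (∀ e ∈ IsManifold.maximalAtlas (𝓡 m) ∞ M,
      ∀ (t : Trivialization (Fin r → ℂ) (π (Fin r → ℂ) E)) [MemTrivializationAtlas t]
        (i : Fin r),
        ContDiffOn ℝ ∞ (component φ e t i) (e.target ∩ e.symm ⁻¹' t.baseSet)) ∧
    ∃ K : Set M, IsCompact K ∧ ∀ x ∉ K, φ x = 0}
  zero_mem' := by
    refine ⟨fun x A v => by simp, fun e _ t _ i => ?_, ∅, isCompact_empty, fun x _ => rfl⟩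
    exact contDiffOn_const (c := (0 : ℂ))
  add_mem' := by
    rintro φ ψ ⟨h1, h2, K, hK, h3⟩ ⟨g1, g2, L, hL, g3⟩
    refine ⟨fun x A v => ?_, fun e he t _ i => ?_, K ∪ L, hK.union hL, fun x hx => ?_⟩
    · simp only [Pi.add_apply, h1, g1, smul_add]
    · exact (h2 e he t i).add (g2 e he t i)
    · simp only [mem_union, not_or] at hx
      simp [h3 x hx.1, g3 x hx.2]
  smul_mem' := by
    rintro c φ ⟨h1, h2, K, hK, h3⟩
    refine ⟨fun x A v => ?_, fun e he t _ i => ?_, K, hK, fun x hx => ?_⟩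
    · simp only [Pi.smul_apply, h1, smul_comm c]
    · exact contDiffOn_const.smul (h2 e he t i)
    · simp [h3 x hx]

/-- The space `C^{-∞}(M, E)` of `E`-valued distributions: linear functionals on the compactly
supported smooth `E*`-valued measures which are continuous, i.e. bounded by finitely many
derivatives on the test measures supported in a given compact set `K` of a coordinate patch. -/
structure Distribution (r : ℕ) [TopologicalSpace (TotalSpace (Fin r → ℂ) E)]
    [FiberBundle (Fin r → ℂ) E] where
  /-- the pairing with test measures -/
  pairing : testMeasures E m r →ₗ[ℂ] ℂ
  continuous : ∀ e ∈ IsManifold.maximalAtlas (𝓡 m) ∞ M,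
    ∀ (t : Trivialization (Fin r → ℂ) (π (Fin r → ℂ) E)) [MemTrivializationAtlas t],
    ∀ K : Set M, IsCompact K → K ⊆ e.source ∩ t.baseSet →
      ∃ (C : ℝ) (N : ℕ), ∀ φ : testMeasures E m r, (∀ x ∉ K, φ.1 x = 0) →
        ∀ B : ℝ, (∀ q ≤ N, ∀ i, ∀ y ∈ e '' K,
          ‖iteratedFDeriv ℝ q (component φ.1 e t i) y‖ ≤ B) → ‖pairing φ‖ ≤ C * B

variable {E m}

/-- `σ` vanishes to order `k` along `S`: every `p ∈ S` has an open coordinate neighborhood `U`,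
over which `E` is trivialized, such that each of the scalar components `σᵢ` of `σ` on `U` is of
the form `∑ⱼ fᵢⱼ Dᵢⱼ hᵢⱼ` with `fᵢⱼ` smooth and vanishing to order `k` on `S`, `Dᵢⱼ` a differential
operator tangential to `S`, and `hᵢⱼ` measurable and locally bounded. The identity of distributions
on `U` is tested against all smooth `E*`-valued measures with compact support in `U`. -/
def Distribution.VanishesToOrder {r : ℕ} [TopologicalSpace (TotalSpace (Fin r → ℂ) E)]
    [FiberBundle (Fin r → ℂ) E] (σ : Distribution E m r) (k : ℕ) (S : Set M) : Prop :=
  ∀ p ∈ S, ∃ e ∈ IsManifold.maximalAtlas (𝓡 m) ∞ M,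
    ∃ t : Trivialization (Fin r → ℂ) (π (Fin r → ℂ) E), MemTrivializationAtlas t ∧
    ∃ U ⊆ e.source ∩ t.baseSet, IsOpen U ∧ p ∈ U ∧
    ∃ (N : ℕ) (f : Fin r → Fin N → EuclideanSpace ℝ (Fin m) → ℂ)
      (D : Fin r → Fin N → DiffOp m) (h : Fin r → Fin N → EuclideanSpace ℝ (Fin m) → ℂ),
      (∀ i j, MemIdealPow (e '' (S ∩ U)) k (e '' U) (f i j) ∧
        (D i j).SmoothOn (e '' U) ∧ (D i j).TangentialOn (e '' (S ∩ U)) (e '' U) ∧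
        MeasurableLocallyBoundedOn (h i j) (e '' U)) ∧
      ∀ φ : testMeasures E m r, (∃ K ⊆ U, IsCompact K ∧ ∀ x ∉ K, φ.1 x = 0) →
        σ.pairing φ = ∑ i, ∑ j, ∫ y in e '' U,
          h i j y * (D i j).transpose (fun z => f i j z * component φ.1 e t i z) y

end Bundles

/-! ### Group actions -/

section Action

variable (n m r : ℕ) (H : Type*) [Group H] [TopologicalSpace H]
  [ChartedSpace (EuclideanSpace ℝ (Fin n)) H]
  {M : Type*} [TopologicalSpace M] [ChartedSpace (EuclideanSpace ℝ (Fin m)) M]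
  [MulAction H M]
  (E : M → Type*) [∀ x, AddCommGroup (E x)] [∀ x, Module ℂ (E x)]
  [∀ x, TopologicalSpace (E x)] [TopologicalSpace (TotalSpace (Fin r → ℂ) E)]
  [FiberBundle (Fin r → ℂ) E]

/-- A lift of the action of `H` on `M` to the vector bundle `E`: an action of `H` on the total
space, smooth on `H × E`, which maps `E x` linearly to `E (h • x)`. -/
structure EquivariantLift where
  /-- the action of `h` on the fibre over `x` -/
  act : ∀ (h : H) (x : M), E x →ₗ[ℂ] E (h • x)
  one_act : ∀ v : TotalSpace (Fin r → ℂ) E,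
    TotalSpace.mk' (Fin r → ℂ) ((1 : H) • v.proj) (act 1 v.proj v.snd) = v
  mul_act : ∀ (g h : H) (v : TotalSpace (Fin r → ℂ) E),
    TotalSpace.mk' (Fin r → ℂ) ((g * h) • v.proj) (act (g * h) v.proj v.snd) =
      TotalSpace.mk' (Fin r → ℂ) (g • h • v.proj) (act g (h • v.proj) (act h v.proj v.snd))
  smooth : ContMDiff ((𝓡 n).prod ((𝓡 m).prod 𝓘(ℝ, Fin r → ℂ))) ((𝓡 m).prod 𝓘(ℝ, Fin r → ℂ)) ∞
    (fun p : H × TotalSpace (Fin r → ℂ) E =>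
      TotalSpace.mk' (Fin r → ℂ) (p.1 • p.2.proj) (act p.1 p.2.proj p.2.snd))

end Action

section Pullback

variable {n m r : ℕ} {H : Type*} [Group H] [TopologicalSpace H]
  [ChartedSpace (EuclideanSpace ℝ (Fin n)) H]
  {M : Type*} [TopologicalSpace M] [ChartedSpace (EuclideanSpace ℝ (Fin m)) M]
  [MulAction H M]
  {E : M → Type*} [∀ x, AddCommGroup (E x)] [∀ x, Module ℂ (E x)]
  [∀ x, TopologicalSpace (E x)] [TopologicalSpace (TotalSpace (Fin r → ℂ) E)]
  [FiberBundle (Fin r → ℂ) E]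

/-- The translate of an `E*`-valued density `φ` by `h⁻¹`, i.e. its pullback under the action of
`h` on `M` and on `E`. -/
def pullbackField (L : EquivariantLift n m r H E) (h : H) (φ : DualField E m) : DualField E m :=
  fun x v => (φ (h • x) (fun i => mfderiv (𝓡 m) (𝓡 m) (fun z : M => h • z) x (v i))) ∘ₗ L.act h x

end Pullback

/-- Translation by `h` as a diffeomorphism of `M`. -/
def translateDiffeo (n m : ℕ) {H : Type*} [Group H] [TopologicalSpace H]
    [ChartedSpace (EuclideanSpace ℝ (Fin n)) H]
    (M : Type*) [TopologicalSpace M] [ChartedSpace (EuclideanSpace ℝ (Fin m)) M]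
    [MulAction H M] [ContMDiffSMul (𝓡 n) (𝓡 m) ∞ H M] (h : H) :
    Diffeomorph (𝓡 m) (𝓡 m) M M ∞ where
  toEquiv := MulAction.toPerm h
  contMDiff_toFun := (contMDiff_smul (I := 𝓡 n) (I' := 𝓡 m) (n := ∞) (G := H) (M := M)).comp
    (contMDiff_const (c := h).prodMk contMDiff_id)
  contMDiff_invFun := (contMDiff_smul (I := 𝓡 n) (I' := 𝓡 m) (n := ∞) (G := H) (M := M)).comp
    (contMDiff_const (c := h⁻¹).prodMk contMDiff_id)

section PullbackTest

variable {n m r : ℕ} {H : Type*} [Group H] [TopologicalSpace H]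
  [ChartedSpace (EuclideanSpace ℝ (Fin n)) H]
  {M : Type*} [TopologicalSpace M] [ChartedSpace (EuclideanSpace ℝ (Fin m)) M]
  [MulAction H M] [ContMDiffSMul (𝓡 n) (𝓡 m) ∞ H M]
  {E : M → Type*} [∀ x, AddCommGroup (E x)] [∀ x, Module ℂ (E x)]
  [∀ x, TopologicalSpace (E x)] [TopologicalSpace (TotalSpace (Fin r → ℂ) E)]
  [FiberBundle (Fin r → ℂ) E]

theorem pullbackField_density (L : EquivariantLift n m r H E) (h : H) {φ : DualField E m}
    (hφ : ∀ x (A : TangentSpace (𝓡 m) x →ₗ[ℝ] TangentSpace (𝓡 m) x) v,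
      φ x (fun i => A (v i)) = ((|LinearMap.det A| : ℝ) : ℂ) • φ x v)
    (x : M) (A : TangentSpace (𝓡 m) x →ₗ[ℝ] TangentSpace (𝓡 m) x)
    (v : Fin m → TangentSpace (𝓡 m) x) :
    pullbackField L h φ x (fun i => A (v i)) =
      ((|LinearMap.det A| : ℝ) : ℂ) • pullbackField L h φ x v := by
  let T : TangentSpace (𝓡 m) x ≃ₗ[ℝ] TangentSpace (𝓡 m) (h • x) :=
    ((translateDiffeo n m M h).mfderivToContinuousLinearEquiv (by simp) x).toLinearEquiv
  have key := hφ (h • x) ((T : _ →ₗ[ℝ] _) ∘ₗ A ∘ₗ (T.symm : _ →ₗ[ℝ] _)) (fun i => T (v i))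
  rw [LinearMap.det_conj] at key
  simp only [LinearMap.comp_apply, LinearEquiv.coe_coe, LinearEquiv.symm_apply_apply] at key
  have hT : ∀ w, T w = mfderiv (𝓡 m) (𝓡 m) (fun z : M => h • z) x w := fun w => rfl
  simp only [hT] at key
  simp only [pullbackField, key, LinearMap.smul_comp]

variable [IsManifold (𝓡 m) ∞ M] [VectorBundle ℂ (Fin r → ℂ) E]
  [ContMDiffVectorBundle ∞ (Fin r → ℂ) E (𝓡 m)]

theorem component_smooth_pullbackField (L : EquivariantLift n m r H E) (h : H)
    {φ : DualField E m}
    (hφ : ∀ e ∈ IsManifold.maximalAtlas (𝓡 m) ∞ M,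
      ∀ (t : Trivialization (Fin r → ℂ) (π (Fin r → ℂ) E)) [MemTrivializationAtlas t]
        (i : Fin r),
        ContDiffOn ℝ ∞ (component φ e t i) (e.target ∩ e.symm ⁻¹' t.baseSet))
    (e : OpenPartialHomeomorph M (EuclideanSpace ℝ (Fin m)))
    (he : e ∈ IsManifold.maximalAtlas (𝓡 m) ∞ M)
    (t : Trivialization (Fin r → ℂ) (π (Fin r → ℂ) E)) [MemTrivializationAtlas t] (i : Fin r) :
    ContDiffOn ℝ ∞ (component (pullbackField L h φ) e t i)
      (e.target ∩ e.symm ⁻¹' t.baseSet) := by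
  let Φ := translateDiffeo n m M h
  let e' : OpenPartialHomeomorph M (EuclideanSpace ℝ (Fin m)) :=
    Φ.symm.toHomeomorph.transOpenPartialHomeomorph e
  have hes : ContMDiffOn (𝓡 m) (𝓡 m) ∞ e.symm e.target :=
    contMDiffOn_symm_of_mem_maximalAtlas he
  have he's : ∀ y, e'.symm y = h • e.symm y := fun y => rfl
  have he't : e'.target = e.target := rfl
  have he' : e' ∈ IsManifold.maximalAtlas (𝓡 m) ∞ M := by
    refine OpenPartialHomeomorph.mem_maximalAtlas_of_contMDiffOn _ ?_ ?_
    · exact (contMDiffOn_of_mem_maximalAtlas he).comp Φ.symm.contMDiff.contMDiffOn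
        (fun x hx => hx)
    · exact Φ.contMDiff.comp_contMDiffOn hes
  intro y hy
  let t' := trivializationAt (Fin r → ℂ) E (e'.symm y)
  -- the matrix of the lift in the frames given by `t` and `t'`
  let b : EuclideanSpace ℝ (Fin m) → Fin r → ℂ := fun z =>
    (t' ⟨h • e.symm z, L.act h (e.symm z) (t.symm (e.symm z) (Pi.single i 1))⟩).2
  have hopen : IsOpen (e.target ∩ e.symm ⁻¹' t.baseSet) :=
    e.isOpen_inter_preimage_symm t.open_baseSet
  have hopen' : IsOpen (e'.target ∩ e'.symm ⁻¹' t'.baseSet) :=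
    e'.isOpen_inter_preimage_symm t'.open_baseSet
  have hy' : y ∈ e'.target ∩ e'.symm ⁻¹' t'.baseSet :=
    ⟨hy.1, FiberBundle.mem_baseSet_trivializationAt' _⟩
  have hb : ContDiffAt ℝ ∞ b y := by
    have h1 : ContMDiffAt (𝓡 m) ((𝓡 m).prod 𝓘(ℝ, Fin r → ℂ)) ∞
        (fun z => TotalSpace.mk' (Fin r → ℂ) (e.symm z)
          (t.symm (e.symm z) (Pi.single i 1))) y := by
      rw [t.contMDiffAt_iff (by rw [t.mem_source]; exact hy.2)]
      refine ⟨hes.contMDiffAt (e.open_target.mem_nhds hy.1), ?_⟩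
      refine (contMDiffAt_const (c := (Pi.single i 1 : Fin r → ℂ))).congr_of_eventuallyEq ?_
      filter_upwards [hopen.mem_nhds hy] with z hz
      simp [t.apply_mk_symm hz.2]
    have h2 : ContMDiffAt (𝓡 m) ((𝓡 m).prod 𝓘(ℝ, Fin r → ℂ)) ∞
        (fun z => TotalSpace.mk' (Fin r → ℂ) (h • e.symm z)
          (L.act h (e.symm z) (t.symm (e.symm z) (Pi.single i 1)))) y :=
      L.smooth.contMDiffAt.comp y ((contMDiffAt_const (c := h)).prodMk h1)
    rw [t'.contMDiffAt_iff (by rw [t'.mem_source]; exact hy'.2)] at h2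
    exact h2.2.contDiffAt
  have hsum : ContDiffAt ℝ ∞ (fun z => ∑ j, b z j * component φ e' t' j z) y := by
    refine ContDiffAt.sum fun j _ => ContDiffAt.mul ?_ ?_
    · exact contDiffAt_pi.1 hb j
    · exact (hφ e' he' t' j).contDiffAt (hopen'.mem_nhds hy')
  refine (hsum.congr_of_eventuallyEq ?_).contDiffWithinAt
  filter_upwards [hopen.mem_nhds hy, hopen'.mem_nhds hy'] with z hz hz'
  have hframe : (fun l => mfderiv (𝓡 m) (𝓡 m) (fun x : M => h • x) (e.symm z)
      (coordFrame e z l)) = coordFrame e' z := by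
    funext l
    have hc := mfderiv_comp (I := 𝓡 m) (I' := 𝓡 m) (I'' := 𝓡 m) z
      (g := fun x : M => h • x) (f := e.symm)
      ((Φ.contMDiff.contMDiffAt (x := e.symm z)).mdifferentiableAt (by simp))
      ((hes.contMDiffAt (e.open_target.mem_nhds hz.1)).mdifferentiableAt (by simp))
    exact (congrArg (fun T => T (EuclideanSpace.single l (1 : ℝ))) hc).symm
  have hvec : L.act h (e.symm z) (t.symm (e.symm z) (Pi.single i 1)) =
      ∑ j, b z j • t'.symm (h • e.symm z) (Pi.single j 1) := by
    have h3 : t'.symm (h • e.symm z) (b z) =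
        L.act h (e.symm z) (t.symm (e.symm z) (Pi.single i 1)) :=
      t'.symm_apply_apply_mk hz'.2 _
    have h4 : b z = ∑ j, b z j • (Pi.single j 1 : Fin r → ℂ) := by
      simpa using (pi_eq_sum_univ' (b z))
    rw [← h3]
    conv_lhs => rw [h4]
    have hbase : h • e.symm z ∈ t'.baseSet := hz'.2
    rw [← t'.coe_symmₗ (R := ℂ) hbase, map_sum]
    exact Finset.sum_congr rfl fun j _ => map_smul _ _ _
  change φ (h • e.symm z) (fun l => mfderiv (𝓡 m) (𝓡 m) (fun x : M => h • x) (e.symm z)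
    (coordFrame e z l)) (L.act h (e.symm z) (t.symm (e.symm z) (Pi.single i 1))) = _
  rw [hframe, hvec, map_sum]
  exact Finset.sum_congr rfl fun j _ => by rw [map_smul]; rfl

/-- Pullback of compactly supported smooth `E*`-valued measures under the action of `h`. -/
def pullback (L : EquivariantLift n m r H E) (h : H) :
    testMeasures E m r →ₗ[ℂ] testMeasures E m r where
  toFun φ := ⟨pullbackField L h φ.1, pullbackField_density L h φ.2.1,
    component_smooth_pullbackField L h φ.2.2.1, by
      obtain ⟨K, hK, h3⟩ := φ.2.2.2
      refine ⟨(translateDiffeo n m M h).symm '' K,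
        hK.image (translateDiffeo n m M h).symm.continuous, fun x hx => ?_⟩
      have hx' : h • x ∉ K := fun hK' => hx ⟨h • x, hK', inv_smul_smul h x⟩
      funext v
      simp only [pullbackField, h3 _ hx']
      rfl⟩
  map_add' φ ψ := rfl
  map_smul' c φ := rfl

/-- The translate `ℓ_h σ` of an `E`-valued distribution, as a functional on test measures: its
value on `φ` is the value of `σ` on the pullback of `φ` under `h`. For a smooth section `σ` this is
`(ℓ_h σ)(x) = h · σ(h⁻¹ x)`. -/
def translate (L : EquivariantLift n m r H E) (h : H) (σ : Distribution E m r) :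
    testMeasures E m r →ₗ[ℂ] ℂ :=
  σ.pairing ∘ₗ pullback L h

end PullbackTest

end DistVanish

end

/-! Vanishing to order `k` along `S` is rephrased as an estimate that the group respects and that
survives integration. In coordinates where `S` is the zero set of the first `c` coordinates, let
`nrm` be the distance to `S` and let deg w be the number of normal letters of a word w. Locally, σ
vanishes to order `k` exactly when, for φ supported near the given point, |σ(φ)| is at most a
constant times the sum of the integrals of `nrm`^(k + deg w) |∂_w φ_i| over the components i and the
words w of bounded length. A representation σ = ∑ f D h involves choices that need not depend
measurably on the group element; the estimate involves none.

From a representation to the estimate: the operator f D is transported to straightening coordinates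
by the transition map κ. The coefficient of ∂_w is f times D applied to the monomial ∏ (κ_{w l} -
x_{w l}), up to 1/q!. Expanding the product and using that D is tangential puts this coefficient in
the (k + deg w)-th power of the ideal (`DiffOp.conj_coeff_mem`). A normal derivative costs at most
one power of `nrm` and a tangential one costs none, so the transpose is bounded almost everywhere by
the weighted derivatives (`DiffOp.transpose_bound`,
`Distribution.VanishesToOrder.exists_weight_bound`).

From the estimate to a representation: commuting powers of normal coordinates past derivatives
bounds the weights by the functions ∂_w (x_a^(k + deg w) φ_i). A functional bounded by the L¹ norms
of finitely many expressions is a sum of integrals of them against bounded functions, by Hahn-Banach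
and the duality of L¹ and L^∞ (`exists_densities_of_bound`). Up to sign, ∂_w (x_a^(k + deg w) ·) is
the transpose of the tangential operator x_a^(deg w) ∂_w composed with multiplication by x_a^k
(`vanishesToOrder_of_weight_bound`).

Invariance: a translation preserves `S`, so its normal coordinates vanish on `S` and are O(`nrm`),
together with their tangential derivatives. By the chain rule the weighted derivatives of a pullback
are bounded by those of φ (`Sym.comp_bound`). The inverse translation makes `nrm` comparable at a
point and at its image, and the Jacobian needed for the change of variables is bounded below
(`weight_pullback_le`). Everything depends smoothly on the group element, so the estimate is locally
uniform, hence uniform over the compact set `Ω` (`exists_uniform_weight_bound`), and it can be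
integrated against |ρ|.

That the integral is a distribution at all rests on unweighted estimates of the same kind, the case
c = 0, in which every weight with k = 0 is 0^0 = 1. -/

noncomputable section

namespace DistVanish

open Filter Topology

/-! ### Calculus of iterated partial derivatives -/

section Calculus

variable {m : ℕ}

/-- The model space `ℝᵐ`. -/
abbrev Eu (m : ℕ) := EuclideanSpace ℝ (Fin m)

/-- The partial derivative in the `i`-th coordinate direction. -/
def pd (i : Fin m) (g : Eu m → ℂ) : Eu m → ℂ :=
  fun y => fderiv ℝ g y (EuclideanSpace.single i (1 : ℝ))

/-- `g` is smooth at all points of a neighbourhood of `y`. -/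
def SmoothNear {F G : Type*} [NormedAddCommGroup F] [NormedSpace ℝ F] [NormedAddCommGroup G]
    [NormedSpace ℝ G] (g : F → G) (y : F) : Prop :=
  ∀ᶠ z in 𝓝 y, ContDiffAt ℝ ∞ g z

section SmoothNear

variable {F G G' : Type*} [NormedAddCommGroup F] [NormedSpace ℝ F] [NormedAddCommGroup G]
    [NormedSpace ℝ G] [NormedAddCommGroup G'] [NormedSpace ℝ G'] {f g : F → G} {y : F}

theorem SmoothNear.contDiffAt (h : SmoothNear g y) : ContDiffAt ℝ ∞ g y := h.self_of_nhds

theorem SmoothNear.eventually (h : SmoothNear g y) : ∀ᶠ z in 𝓝 y, SmoothNear g z :=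
  eventually_eventually_nhds.2 h

theorem SmoothNear.congr (h : SmoothNear g y) (hfg : f =ᶠ[𝓝 y] g) : SmoothNear f y := by
  filter_upwards [h, hfg.eventuallyEq_nhds] with z hz hz'
  exact hz.congr_of_eventuallyEq hz'

theorem smoothNear_of_contDiffOn {W : Set F} (h : ContDiffOn ℝ ∞ g W) (hW : IsOpen W) (hy : y ∈ W) :
    SmoothNear g y := by
  filter_upwards [hW.mem_nhds hy] with z hz using h.contDiffAt (hW.mem_nhds hz)

theorem smoothNear_of_contDiff (h : ContDiff ℝ ∞ g) : SmoothNear g y :=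
  Eventually.of_forall fun _ => h.contDiffAt

theorem smoothNear_const (c : G) : SmoothNear (fun _ : F => c) y :=
  Eventually.of_forall fun _ => contDiffAt_const

theorem SmoothNear.add (hf : SmoothNear f y) (hg : SmoothNear g y) :
    SmoothNear (fun z => f z + g z) y := by
  filter_upwards [hf, hg] with z h1 h2 using h1.add h2

theorem SmoothNear.sum {ι : Type*} {s : Finset ι} {f : ι → F → G}
    (h : ∀ i ∈ s, SmoothNear (f i) y) : SmoothNear (fun z => ∑ i ∈ s, f i z) y := by
  have : ∀ᶠ z in 𝓝 y, ∀ i ∈ s, ContDiffAt ℝ ∞ (f i) z := (Finset.eventually_all s).2 h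
  filter_upwards [this] with z hz using ContDiffAt.sum hz

theorem SmoothNear.mul {f g : F → ℂ} (hf : SmoothNear f y) (hg : SmoothNear g y) :
    SmoothNear (fun z => f z * g z) y := by
  filter_upwards [hf, hg] with z h1 h2 using h1.mul h2

theorem SmoothNear.comp {k : G → G'} (hk : SmoothNear k (g y)) (hg : SmoothNear g y) :
    SmoothNear (fun z => k (g z)) y := by
  have := hg.contDiffAt.continuousAt.eventually hk
  filter_upwards [hg, this] with z h1 h2 using h2.comp z h1

theorem SmoothNear.ofReal {f : F → ℝ} (hf : SmoothNear f y) :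
    SmoothNear (fun z => (f z : ℂ)) y := by
  filter_upwards [hf] with z hz using Complex.ofRealCLM.contDiff.contDiffAt.comp z hz

end SmoothNear

theorem SmoothNear.coord {F : Type*} [NormedAddCommGroup F] [NormedSpace ℝ F] {Θ : F → Eu m} {y : F}
    (h : SmoothNear Θ y) (j : Fin m) : SmoothNear (fun z => ((Θ z j : ℝ) : ℂ)) y := by
  refine SmoothNear.ofReal ?_
  filter_upwards [h] with z hz
  exact (EuclideanSpace.proj (𝕜 := ℝ) j).contDiff.contDiffAt.comp z hz

variable {g g' : Eu m → ℂ} {y : Eu m}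

theorem SmoothNear.pd (h : SmoothNear g y) (i : Fin m) : SmoothNear (pd i g) y := by
  filter_upwards [h] with z hz
  exact (hz.fderiv_right (m := ∞) (by simp)).clm_apply contDiffAt_const

theorem pd_congr (h : g =ᶠ[𝓝 y] g') (i : Fin m) : pd i g =ᶠ[𝓝 y] pd i g' := by
  filter_upwards [h.eventuallyEq_nhds] with z hz
  simp [pd, hz.fderiv_eq]

theorem pd_mul (hg : SmoothNear g y) (hg' : SmoothNear g' y) (i : Fin m) :
    pd i (fun z => g z * g' z) =ᶠ[𝓝 y] fun z => pd i g z * g' z + g z * pd i g' z := by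
  filter_upwards [hg, hg'] with z h1 h2
  simp only [pd]
  rw [fderiv_fun_mul (h1.differentiableAt (by simp)) (h2.differentiableAt (by simp))]
  simp [mul_comm, add_comm]

theorem pd_sum {ι : Type*} {s : Finset ι} {f : ι → Eu m → ℂ}
    (h : ∀ i ∈ s, SmoothNear (f i) y) (i : Fin m) :
    pd i (fun z => ∑ a ∈ s, f a z) =ᶠ[𝓝 y] fun z => ∑ a ∈ s, pd i (f a) z := by
  have : ∀ᶠ z in 𝓝 y, ∀ i ∈ s, ContDiffAt ℝ ∞ (f i) z := (Finset.eventually_all s).2 h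
  filter_upwards [this] with z hz
  simp only [pd]
  rw [fderiv_fun_sum fun a ha => (hz a ha).differentiableAt (by simp)]
  simp

/-- Chain rule for partial derivatives. -/
theorem pd_comp {Θ : Eu m → Eu m} (hΘ : SmoothNear Θ y) (hg : SmoothNear g (Θ y)) (i : Fin m) :
    pd i (fun z => g (Θ z)) =ᶠ[𝓝 y]
      fun z => ∑ j, pd i (fun z => ((Θ z j : ℝ) : ℂ)) z * pd j g (Θ z) := by
  filter_upwards [hΘ, hΘ.contDiffAt.continuousAt.eventually hg] with z h1 h2
  have hd := h1.differentiableAt (by simp)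
  have hc : ∀ j, pd i (fun z => ((Θ z j : ℝ) : ℂ)) z =
      ((fderiv ℝ Θ z (EuclideanSpace.single i 1) j : ℝ) : ℂ) := fun j => by
    have h3 : HasFDerivAt (fun z => ((Θ z j : ℝ) : ℂ)) (Complex.ofRealCLM ∘L
        (EuclideanSpace.proj (𝕜 := ℝ) j) ∘L fderiv ℝ Θ z) z :=
      (Complex.ofRealCLM ∘L
        (EuclideanSpace.proj (𝕜 := ℝ) j)).hasFDerivAt.comp z hd.hasFDerivAt
    simp [pd, h3.fderiv]
  simp only [hc]
  have h4 : fderiv ℝ (fun z => g (Θ z)) z = fderiv ℝ g (Θ z) ∘L fderiv ℝ Θ z :=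
    fderiv_comp z (h2.differentiableAt (by simp)) hd
  simp only [pd, h4, ContinuousLinearMap.comp_apply]
  conv_lhs => rw [← (EuclideanSpace.basisFun (Fin m) ℝ).sum_repr
    (fderiv ℝ Θ z (EuclideanSpace.single i 1))]
  simp [map_sum]

theorem partialDeriv_zero (w : Fin 0 → Fin m) (g : Eu m → ℂ) (y : Eu m) :
    partialDeriv w g y = g y := by simp [partialDeriv]

theorem partialDeriv_congr {q : ℕ} (w : Fin q → Fin m) (h : g =ᶠ[𝓝 y] g') :
    partialDeriv w g y = partialDeriv w g' y := by
  simp only [partialDeriv, (h.iteratedFDeriv ℝ q).eq_of_nhds]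

theorem partialDeriv_succ_right {q : ℕ} (w : Fin (q + 1) → Fin m) (hg : SmoothNear g y) :
    partialDeriv w g y = partialDeriv (Fin.init w) (pd (w (Fin.last q)) g) y := by
  simp only [partialDeriv, iteratedFDeriv_succ_apply_right]
  have h2 : ContDiffAt ℝ q (fderiv ℝ g) y := hg.contDiffAt.fderiv_right (by
    exact_mod_cast le_top)
  have := ContinuousLinearMap.iteratedFDeriv_comp_left
    (ContinuousLinearMap.apply ℝ ℂ (EuclideanSpace.single (w (Fin.last q)) (1 : ℝ))) h2 (i := q)
    le_rfl
  change _ = iteratedFDeriv ℝ q (⇑(ContinuousLinearMap.apply ℝ ℂ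
    (EuclideanSpace.single (w (Fin.last q)) (1 : ℝ))) ∘ fderiv ℝ g) y _
  rw [this]
  rfl

theorem SmoothNear.partialDeriv {q : ℕ} (w : Fin q → Fin m) (hg : SmoothNear g y) :
    SmoothNear (partialDeriv w g) y := by
  filter_upwards [hg] with z hz
  have : ContDiffAt ℝ ∞ (iteratedFDeriv ℝ q g) z := hz.iteratedFDeriv_right (by
    exact_mod_cast le_top)
  exact (ContinuousMultilinearMap.apply ℝ (fun _ : Fin q => Eu m) ℂ
    (fun l => EuclideanSpace.single (w l) (1 : ℝ))).contDiff.contDiffAt.comp z this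

theorem partialDeriv_succ_left {q : ℕ} (w : Fin (q + 1) → Fin m) (hg : SmoothNear g y) :
    partialDeriv w g y = pd (w 0) (partialDeriv (Fin.tail w) g) y := by
  have h1 : ContDiffAt ℝ ∞ (iteratedFDeriv ℝ q g) y := hg.contDiffAt.iteratedFDeriv_right (by
    exact_mod_cast le_top)
  have h2 := ((ContinuousMultilinearMap.apply ℝ (fun _ : Fin q => Eu m) ℂ
    (fun l => EuclideanSpace.single (Fin.tail w l) (1 : ℝ))).hasFDerivAt.comp y
    (h1.differentiableAt (by simp)).hasFDerivAt).fderiv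
  simp only [DistVanish.partialDeriv, iteratedFDeriv_succ_apply_left, DistVanish.pd]
  change _ = fderiv ℝ (⇑(ContinuousMultilinearMap.apply ℝ (fun _ : Fin q => Eu m) ℂ
    (fun l => EuclideanSpace.single (Fin.tail w l) (1 : ℝ))) ∘ iteratedFDeriv ℝ q g) y _
  rw [h2]
  rfl

theorem pd_comm (hg : SmoothNear g y) (i j : Fin m) : pd i (pd j g) y = pd j (pd i g) y := by
  have h1 : ContDiffAt ℝ ∞ (fderiv ℝ g) y := hg.contDiffAt.fderiv_right (by simp)
  have h2 : ∀ v, fderiv ℝ (fun z => fderiv ℝ g z v) y =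
      (ContinuousLinearMap.apply ℝ ℂ v) ∘L fderiv ℝ (fderiv ℝ g) y := fun v =>
    ((ContinuousLinearMap.apply ℝ ℂ v).hasFDerivAt.comp y
      (h1.differentiableAt (by simp)).hasFDerivAt).fderiv
  have h3 := hg.contDiffAt.isSymmSndFDerivAt (by
    rw [minSmoothness_of_isRCLikeNormedField]
    exact WithTop.coe_le_coe.2 le_top)
  change fderiv ℝ (fun z => fderiv ℝ g z _) y _ = fderiv ℝ (fun z => fderiv ℝ g z _) y _
  rw [h2, h2]
  exact h3 _ _

theorem partialDeriv_pd_comm {q : ℕ} (w : Fin q → Fin m) (i : Fin m) (hg : SmoothNear g y) :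
    partialDeriv w (pd i g) y = pd i (partialDeriv w g) y := by
  induction q generalizing y with
  | zero =>
    have : partialDeriv w g = g := funext fun z => partialDeriv_zero w g z
    rw [partialDeriv_zero, this]
  | succ q ih =>
    rw [partialDeriv_succ_left w (hg.pd i)]
    have h1 : partialDeriv (Fin.tail w) (pd i g) =ᶠ[𝓝 y] pd i (partialDeriv (Fin.tail w) g) := by
      filter_upwards [hg.eventually] with z hz using ih _ hz
    have h2 : partialDeriv w g =ᶠ[𝓝 y] pd (w 0) (partialDeriv (Fin.tail w) g) := by
      filter_upwards [hg.eventually] with z hz using partialDeriv_succ_left w hz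
    rw [(pd_congr h1 _).self_of_nhds, (pd_congr h2 _).self_of_nhds,
      pd_comm (hg.partialDeriv _)]

theorem partialDeriv_const_mul {q : ℕ} (w : Fin q → Fin m) (c : ℂ) (hg : SmoothNear g y) :
    partialDeriv w (fun z => c * g z) y = c * partialDeriv w g y := by
  have := iteratedFDeriv_const_smul_apply (i := q) (a := c) (f := g) (x := y)
    (hg.contDiffAt.of_le (by exact_mod_cast le_top))
  simp only [partialDeriv]
  change iteratedFDeriv ℝ q (c • g) y _ = _
  rw [this]
  rfl

theorem partialDeriv_sum {ι : Type*} {s : Finset ι} {f : ι → Eu m → ℂ} {q : ℕ}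
    (w : Fin q → Fin m) (h : ∀ i ∈ s, SmoothNear (f i) y) :
    partialDeriv w (fun z => ∑ a ∈ s, f a z) y = ∑ a ∈ s, partialDeriv w (f a) y := by
  simp only [partialDeriv]
  rw [iteratedFDeriv_fun_sum_apply fun j hj => (h j hj).contDiffAt.of_le (by exact_mod_cast le_top)]
  simp

theorem partialDeriv_add {q : ℕ} (w : Fin q → Fin m) (hg : SmoothNear g y)
    (hg' : SmoothNear g' y) :
    partialDeriv w (fun z => g z + g' z) y = partialDeriv w g y + partialDeriv w g' y := by
  simp only [partialDeriv]
  rw [fun_iteratedFDeriv_add_apply (hg.contDiffAt.of_le (by exact_mod_cast le_top))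
    (hg'.contDiffAt.of_le (by exact_mod_cast le_top))]
  simp

theorem norm_partialDeriv_le {q : ℕ} (w : Fin q → Fin m) (g : Eu m → ℂ) (y : Eu m) :
    ‖partialDeriv w g y‖ ≤ ‖iteratedFDeriv ℝ q g y‖ := by
  refine (ContinuousMultilinearMap.le_opNorm _ _).trans ?_
  simp

/-- Expanding each argument in the standard basis yields one term per word, and the coordinates of a
vector are bounded by its norm; there are `m ^ q` words. -/
theorem norm_iteratedFDeriv_le_of_partialDeriv {q : ℕ} {B : ℝ}
    (h : ∀ w : Fin q → Fin m, ‖partialDeriv w g y‖ ≤ B) :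
    ‖iteratedFDeriv ℝ q g y‖ ≤ (m : ℝ) ^ q * B := by
  have hm : (m : ℝ) ^ q = ∑ _w : Fin q → Fin m, (1 : ℝ) := by simp
  by_cases hB : 0 ≤ B
  · refine ContinuousMultilinearMap.opNorm_le_bound (by positivity) fun v => ?_
    have hv : v = fun l => ∑ j, v l j • EuclideanSpace.single j (1 : ℝ) := by
      funext l
      conv_lhs => rw [← (EuclideanSpace.basisFun (Fin m) ℝ).sum_repr (v l)]
      simp
    conv_lhs => rw [hv]
    rw [ContinuousMultilinearMap.map_sum]
    refine (norm_sum_le _ _).trans ?_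
    rw [hm, Finset.sum_mul, Finset.sum_mul]
    refine Finset.sum_le_sum fun w _ => ?_
    rw [ContinuousMultilinearMap.map_smul_univ, norm_smul, one_mul, mul_comm]
    refine mul_le_mul (h w) ?_ (norm_nonneg _) hB
    rw [norm_prod]
    exact Finset.prod_le_prod (fun _ _ => norm_nonneg _) fun l _ => PiLp.norm_apply_le (v l) (w l)
  -- A negative `B` is possible only if there are no words, i.e. `m = 0` and `q > 0`. The derivative
  -- then vanishes because the space is a point.
  · have : IsEmpty (Fin q → Fin m) :=
      ⟨fun w => hB ((norm_nonneg _).trans (h w))⟩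
    have hm0 : m = 0 ∧ q ≠ 0 := by
      have := Fintype.card_eq_zero_iff.2 this
      rw [Fintype.card_fun, Fintype.card_fin, Fintype.card_fin] at this
      exact Nat.pow_eq_zero.1 this
    obtain ⟨rfl, hq⟩ := hm0
    obtain ⟨q, rfl⟩ := Nat.exists_eq_succ_of_ne_zero hq
    have : iteratedFDeriv ℝ (q + 1) g y = 0 := by
      ext v
      rw [Subsingleton.elim v 0]
      exact ContinuousMultilinearMap.map_zero _
    simp [this]

end Calculus

/-! ### Symbol classes adapted to a coordinate subspace -/

section Symbols

variable {m : ℕ}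

/-- The normal degree of a coordinate direction with respect to the subspace
`{y | y i = 0 for i < c}`. -/
def letterDeg (c : ℕ) (i : Fin m) : ℕ := if i.1 < c then 1 else 0

/-- The number of normal directions in a word. -/
def wordDeg (c : ℕ) {q : ℕ} (w : Fin q → Fin m) : ℕ := ∑ l, letterDeg c (w l)

theorem wordDeg_succ (c : ℕ) {q : ℕ} (w : Fin (q + 1) → Fin m) :
    wordDeg c w = wordDeg c (Fin.init w) + letterDeg c (w (Fin.last q)) := by
  simp [wordDeg, Fin.sum_univ_castSucc, Fin.init]

theorem wordDeg_succ_left (c : ℕ) {q : ℕ} (w : Fin (q + 1) → Fin m) :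
    wordDeg c w = letterDeg c (w 0) + wordDeg c (Fin.tail w) := by
  simp [wordDeg, Fin.sum_univ_succ, Fin.tail]

theorem wordDeg_snoc (c : ℕ) {q : ℕ} (w : Fin q → Fin m) (i : Fin m) :
    wordDeg c (Fin.snoc w i : Fin (q + 1) → Fin m) = wordDeg c w + letterDeg c i := by
  simp [wordDeg_succ]

theorem partialDeriv_snoc {q : ℕ} (w : Fin q → Fin m) (i : Fin m) {g : Eu m → ℂ} {y : Eu m}
    (hg : SmoothNear g y) :
    partialDeriv (Fin.snoc w i : Fin (q + 1) → Fin m) g y = partialDeriv w (pd i g) y := by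
  simp [partialDeriv_succ_right _ hg]

/-- The projection to the first `c` coordinates. -/
def normalPart (c : ℕ) : Eu m →L[ℝ] (Fin m → ℝ) :=
  ContinuousLinearMap.pi fun i =>
    if i.1 < c then EuclideanSpace.proj (𝕜 := ℝ) i else 0

theorem normalPart_apply (c : ℕ) (y : Eu m) (i : Fin m) :
    normalPart c y i = if i.1 < c then y i else 0 := by
  simp only [normalPart, ContinuousLinearMap.pi_apply]
  split_ifs <;> simp

/-- The distance of `y` to the subspace `{y | y i = 0 for i < c}`, in the maximum norm. -/
def nrm (c : ℕ) (y : Eu m) : ℝ := ‖normalPart c y‖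

theorem nrm_nonneg (c : ℕ) (y : Eu m) : 0 ≤ nrm c y := norm_nonneg _

theorem continuous_nrm (c : ℕ) : Continuous (nrm c : Eu m → ℝ) :=
  (normalPart c).continuous.norm

theorem nrm_eq_zero_iff {c : ℕ} {y : Eu m} : nrm c y = 0 ↔ ∀ i : Fin m, i.1 < c → y i = 0 := by
  rw [nrm, norm_eq_zero, funext_iff]
  refine forall_congr' fun i => ?_
  rw [normalPart_apply]
  simp

theorem abs_coord_le_nrm {c : ℕ} (y : Eu m) {i : Fin m} (hi : i.1 < c) : |y i| ≤ nrm c y := by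
  have := norm_le_pi_norm (normalPart c y) i
  rwa [normalPart_apply, if_pos hi, Real.norm_eq_abs] at this

theorem nrm_le_of_coord {c : ℕ} {y : Eu m} {B : ℝ} (hB : 0 ≤ B)
    (h : ∀ i : Fin m, i.1 < c → |y i| ≤ B) : nrm c y ≤ B := by
  refine (pi_norm_le_iff_of_nonneg hB).2 fun i => ?_
  rw [normalPart_apply]
  split_ifs with hi
  · exact h i hi
  · simpa using hB

theorem letterDeg_eq_zero {c : ℕ} {i : Fin m} : letterDeg c i = 0 ↔ ¬ i.1 < c := by
  simp [letterDeg]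

theorem wordDeg_zero {q : ℕ} (w : Fin q → Fin m) : wordDeg 0 w = 0 := by
  simp [wordDeg, letterDeg]

variable {P : Type*}

/-- Families of functions which, together with their derivatives, satisfy
`nrm ^ (a + deg v) * |∂_v F| ≤ C * nrm ^ s` along the filter. -/
structure Sym (c : ℕ) (l : Filter (P × Eu m)) (a s : ℕ) (F : P → Eu m → ℂ) : Prop where
  smooth : ∀ᶠ p in l, SmoothNear (F p.1) p.2
  bound : ∀ (q : ℕ) (v : Fin q → Fin m), ∃ C : ℝ, 0 ≤ C ∧ ∀ᶠ p in l,
    nrm c p.2 ^ (a + wordDeg c v) * ‖partialDeriv v (F p.1) p.2‖ ≤ C * nrm c p.2 ^ s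

variable {c : ℕ} {l : Filter (P × Eu m)} {a s a' s' : ℕ} {F F' : P → Eu m → ℂ}

/-- The index `a` counts the normal derivatives already taken, each of which costs one power of
`nrm`; tangential derivatives are free. -/
theorem Sym.pd (h : Sym c l a s F) (i : Fin m) :
    Sym c l (a + letterDeg c i) s (fun ξ => pd i (F ξ)) := by
  refine ⟨h.smooth.mono fun p hp => hp.pd i, fun q v => ?_⟩
  obtain ⟨C, hC, hb⟩ := h.bound (q + 1) (Fin.snoc v i)
  refine ⟨C, hC, ?_⟩
  filter_upwards [hb, h.smooth] with p h1 h2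
  rw [wordDeg_snoc, partialDeriv_snoc _ _ h2] at h1
  convert h1 using 3
  ring

/-- Leibniz rule, peeling off the last letter. The functions and their indices are quantified after
the word because the induction passes to the derivative of one factor, which lies in a shifted
class. -/
theorem Sym.mul_bound {q : ℕ} (v : Fin q → Fin m) : ∀ {a s a' s' : ℕ} {F F' : P → Eu m → ℂ},
    Sym c l a s F → Sym c l a' s' F' → ∃ C : ℝ, 0 ≤ C ∧ ∀ᶠ p in l,
    nrm c p.2 ^ (a + a' + wordDeg c v) * ‖partialDeriv v (fun y => F p.1 y * F' p.1 y) p.2‖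
      ≤ C * nrm c p.2 ^ (s + s') := by
  induction q with
  | zero =>
    intro a s a' s' F F' h h'
    obtain ⟨C, hC, hb⟩ := h.bound 0 v
    obtain ⟨C', hC', hb'⟩ := h'.bound 0 v
    refine ⟨C * C', mul_nonneg hC hC', ?_⟩
    filter_upwards [hb, hb'] with p h1 h2
    simp only [partialDeriv_zero, norm_mul] at *
    have hn := nrm_nonneg c p.2
    have h0 : wordDeg c v = 0 := by simp [wordDeg]
    simp only [h0, add_zero] at *
    calc _ = (nrm c p.2 ^ a * ‖F p.1 p.2‖) * (nrm c p.2 ^ a' * ‖F' p.1 p.2‖) := by ring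
      _ ≤ (C * nrm c p.2 ^ s) * (C' * nrm c p.2 ^ s') := by gcongr
      _ = _ := by ring
  | succ q ih =>
    intro a s a' s' F F' h h'
    obtain ⟨C, hC, hb⟩ := ih (Fin.init v) (h.pd (v (Fin.last q))) h'
    obtain ⟨C', hC', hb'⟩ := ih (Fin.init v) h (h'.pd (v (Fin.last q)))
    refine ⟨C + C', add_nonneg hC hC', ?_⟩
    filter_upwards [hb, hb', h.smooth, h'.smooth] with p h1 h2 h3 h4
    rw [partialDeriv_succ_right v (h3.mul h4), partialDeriv_congr _ (pd_mul h3 h4 _),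
      partialDeriv_add _ ((h3.pd _).mul h4) (h3.mul (h4.pd _)), wordDeg_succ]
    have hn := nrm_nonneg c p.2
    refine (mul_le_mul_of_nonneg_left (norm_add_le _ _) (by positivity)).trans ?_
    rw [mul_add, add_mul]
    refine add_le_add (le_of_eq_of_le ?_ h1) (le_of_eq_of_le ?_ h2)
    · congr 2; ring
    · congr 2; ring

theorem Sym.mul (h : Sym c l a s F) (h' : Sym c l a' s' F') :
    Sym c l (a + a') (s + s') (fun ξ y => F ξ y * F' ξ y) :=
  ⟨(h.smooth.and h'.smooth).mono fun _ hp => hp.1.mul hp.2, fun _ v => h.mul_bound v h'⟩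

theorem Sym.sum {ι : Type*} {t : Finset ι} {F : ι → P → Eu m → ℂ}
    (h : ∀ i ∈ t, Sym c l a s (F i)) : Sym c l a s (fun ξ y => ∑ i ∈ t, F i ξ y) := by
  have hs : ∀ᶠ p in l, ∀ i ∈ t, SmoothNear (F i p.1) p.2 :=
    (Finset.eventually_all t).2 fun i hi => (h i hi).smooth
  refine ⟨hs.mono fun p hp => SmoothNear.sum hp, fun q v => ?_⟩
  choose! C hC hb using fun i hi => (h i hi).bound q v
  refine ⟨∑ i ∈ t, C i, Finset.sum_nonneg hC, ?_⟩
  filter_upwards [hs, (Finset.eventually_all t).2 hb] with p h1 h2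
  rw [partialDeriv_sum v h1, Finset.sum_mul]
  refine (mul_le_mul_of_nonneg_left (norm_sum_le _ _) (by have := nrm_nonneg c p.2; positivity)).trans ?_
  rw [Finset.mul_sum]
  exact Finset.sum_le_sum h2

theorem Sym.congr (h : Sym c l a s F) (hF : ∀ᶠ p in l, F' p.1 =ᶠ[𝓝 p.2] F p.1) :
    Sym c l a s F' := by
  refine ⟨(h.smooth.and hF).mono fun p hp => hp.1.congr hp.2, fun q v => ?_⟩
  obtain ⟨C, hC, hb⟩ := h.bound q v
  refine ⟨C, hC, ?_⟩
  filter_upwards [hb, hF] with p h1 h2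
  rwa [partialDeriv_congr v h2]

/-- Weighted bound for the derivatives of a product `F * g ∘ Θ` in terms of those of `g`. -/
theorem Sym.comp_bound {Θ : P → Eu m → Eu m} (hΘs : ∀ᶠ p in l, SmoothNear (Θ p.1) p.2)
    (hΘ : ∀ j, Sym c l 0 (letterDeg c j) (fun ξ y => ((Θ ξ y j : ℝ) : ℂ)))
    {q : ℕ} (w : Fin q → Fin m) : ∀ {a s : ℕ} {F : P → Eu m → ℂ}, Sym c l a s F →
    ∃ C : ℝ, 0 ≤ C ∧ ∀ᶠ p in l, ∀ g : Eu m → ℂ, SmoothNear g (Θ p.1 p.2) → ∀ B : ℝ,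
      (∀ q' ≤ q, ∀ v : Fin q' → Fin m,
        nrm c p.2 ^ (s + wordDeg c v) * ‖partialDeriv v g (Θ p.1 p.2)‖ ≤ B) →
      nrm c p.2 ^ (a + wordDeg c w) *
        ‖partialDeriv w (fun y => F p.1 y * g (Θ p.1 y)) p.2‖ ≤ C * B := by
  induction q with
  | zero =>
    intro a s F h
    obtain ⟨C, hC, hb⟩ := h.bound 0 w
    refine ⟨C, hC, ?_⟩
    filter_upwards [hb] with p h1 g hg B hB
    have h2 := hB 0 le_rfl w
    have hn := nrm_nonneg c p.2
    simp only [partialDeriv_zero, norm_mul] at *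
    have h0 : wordDeg c w = 0 := by simp [wordDeg]
    simp only [h0, add_zero] at *
    calc _ = (nrm c p.2 ^ a * ‖F p.1 p.2‖) * ‖g (Θ p.1 p.2)‖ := by ring
      _ ≤ (C * nrm c p.2 ^ s) * ‖g (Θ p.1 p.2)‖ := by gcongr
      _ = C * (nrm c p.2 ^ s * ‖g (Θ p.1 p.2)‖) := by ring
      _ ≤ _ := by gcongr
  | succ q ih =>
    intro a s F h
    set i := w (Fin.last q) with hi
    have h1 := h.pd i
    -- The chain rule produces the factor F ∂_iΘ_j in front of (∂_j g) ∘ Θ. Since Θ_j vanishes on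
    -- the subspace for normal j, this factor gains `letterDeg c j` powers of `nrm`, exactly what
    -- the weight of the additional derivative ∂_j of `g` requires.
    have h2 : ∀ j, Sym c l (a + letterDeg c i) (s + letterDeg c j)
        (fun ξ y => F ξ y * DistVanish.pd i (fun y => ((Θ ξ y j : ℝ) : ℂ)) y) := fun j => by
      simpa using h.mul ((hΘ j).pd i)
    obtain ⟨C, hC, hb⟩ := ih (Fin.init w) h1
    choose C' hC' hb' using fun j => ih (Fin.init w) (h2 j)
    refine ⟨C + ∑ j, C' j, add_nonneg hC (Finset.sum_nonneg fun j _ => hC' j), ?_⟩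
    filter_upwards [hb, eventually_all.2 hb', hΘs, h.smooth,
      eventually_all.2 fun j => (h2 j).smooth] with p h3 h4 h5 h6 h7 g hg B hB
    have hn := nrm_nonneg c p.2
    have hgΘ : SmoothNear (fun y => g (Θ p.1 y)) p.2 := SmoothNear.comp hg h5
    have hpdgΘ : ∀ j, SmoothNear (fun y => DistVanish.pd j g (Θ p.1 y)) p.2 := fun j =>
      SmoothNear.comp (k := DistVanish.pd j g) (hg.pd j) h5
    have e1 : DistVanish.pd i (fun y => F p.1 y * g (Θ p.1 y)) =ᶠ[𝓝 p.2]
        fun y => DistVanish.pd i (F p.1) y * g (Θ p.1 y) +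
          ∑ j, (F p.1 y * DistVanish.pd i (fun y => ((Θ p.1 y j : ℝ) : ℂ)) y) *
            DistVanish.pd j g (Θ p.1 y) := by
      filter_upwards [pd_mul h6 hgΘ i, pd_comp h5 hg i] with z hz1 hz2
      rw [hz1, hz2, Finset.mul_sum]
      simp only [mul_assoc]
    rw [partialDeriv_succ_right w (h6.mul hgΘ), ← hi, partialDeriv_congr _ e1,
      partialDeriv_add _ ((h6.pd i).mul hgΘ)
        (SmoothNear.sum fun j _ => (h7 j).mul (hpdgΘ j)),
      partialDeriv_sum _ fun j _ => (h7 j).mul (hpdgΘ j), wordDeg_succ, ← hi]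
    have hexp : a + (wordDeg c (Fin.init w) + letterDeg c i) =
        a + letterDeg c i + wordDeg c (Fin.init w) := by ring
    rw [hexp, add_mul, Finset.sum_mul]
    refine (mul_le_mul_of_nonneg_left (norm_add_le _ _) (by positivity)).trans ?_
    rw [mul_add]
    refine add_le_add (h3 g hg B fun q' hq' v => hB q' (by omega) v) ?_
    refine (mul_le_mul_of_nonneg_left (norm_sum_le _ _) (by positivity)).trans ?_
    rw [Finset.mul_sum]
    refine Finset.sum_le_sum fun j _ => h4 j _ (hg.pd j) B fun q' hq' v => ?_
    have := hB (q' + 1) (by omega) (Fin.snoc v j)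
    rw [wordDeg_snoc, partialDeriv_snoc _ _ hg] at this
    convert this using 3
    ring

/-- Along the filter `nrm` is bounded, so the surplus factor `nrm ^ wordDeg c v` goes into the
constant. -/
theorem sym_of_continuous_bound {F : P → Eu m → ℂ} (hs : ∀ᶠ p in l, SmoothNear (F p.1) p.2)
    {R : ℝ} (hR : ∀ᶠ p in l, nrm c p.2 ≤ R)
    (h : ∀ (q : ℕ) (v : Fin q → Fin m), ∃ C : ℝ, ∀ᶠ p in l, ‖partialDeriv v (F p.1) p.2‖ ≤ C) :
    Sym c l 0 0 F := by
  refine ⟨hs, fun q v => ?_⟩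
  obtain ⟨C, hC⟩ := h q v
  refine ⟨|R| ^ wordDeg c v * |C|, by positivity, ?_⟩
  filter_upwards [hC, hR] with p h1 h2
  have hn := nrm_nonneg c p.2
  rw [pow_zero, mul_one, zero_add]
  gcongr
  · exact h2.trans (le_abs_self R)
  · exact h1.trans (le_abs_self C)

theorem sym_const (k : ℂ) {R : ℝ} (hR : ∀ᶠ p in l, nrm c p.2 ≤ R) :
    Sym c l 0 0 (fun _ _ => k) := by
  refine sym_of_continuous_bound (Eventually.of_forall fun p => smoothNear_const _) hR fun q v => ?_
  refine ⟨‖k‖, Eventually.of_forall fun p => ?_⟩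
  simp only [partialDeriv]
  rcases Nat.eq_zero_or_pos q with rfl | hq
  · simp
  · rw [iteratedFDeriv_const_of_ne hq.ne']
    simp

theorem Sym.prod {k : ℕ} {F : Fin k → P → Eu m → ℂ} {s : Fin k → ℕ}
    (h : ∀ i, Sym c l 0 (s i) (F i)) {R : ℝ} (hR : ∀ᶠ p in l, nrm c p.2 ≤ R) :
    Sym c l 0 (∑ i, s i) (fun ξ y => ∏ i, F i ξ y) := by
  induction k with
  | zero => simpa using sym_const 1 hR
  | succ k ih =>
    simp only [Fin.prod_univ_succ, Fin.sum_univ_succ]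
    exact (h 0).mul (ih fun i => h i.succ)

end Symbols

/-! ### Smooth families of functions as members of the symbol classes -/

section SmoothFamilies

variable {m : ℕ} {P : Type*} [NormedAddCommGroup P] [NormedSpace ℝ P] {c : ℕ}
  {p₀ : P × Eu m} {F : P → Eu m → ℂ}

theorem eventually_nrm_le {P : Type*} [TopologicalSpace P] (c : ℕ) (p₀ : P × Eu m) :
    ∀ᶠ p in 𝓝 p₀, nrm c p.2 ≤ nrm c p₀.2 + 1 := by
  have h : ContinuousAt (fun p : P × Eu m => nrm c p.2) p₀ :=
    ((continuous_nrm c).comp continuous_snd).continuousAt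
  filter_upwards [h.eventually_lt continuousAt_const (lt_add_one (nrm c p₀.2))] with p hp
    using hp.le

theorem SmoothNear.slice {G : Type*} [NormedAddCommGroup G] [NormedSpace ℝ G] {F : P → Eu m → G}
    (h : SmoothNear (Function.uncurry F) p₀) : ∀ᶠ p in 𝓝 p₀, SmoothNear (F p.1) p.2 := by
  filter_upwards [h.eventually] with p hp
  have hc : SmoothNear (fun y : Eu m => (p.1, y)) p.2 :=
    smoothNear_of_contDiff (contDiff_const.prodMk contDiff_id)
  exact SmoothNear.comp (k := Function.uncurry F) hp hc

theorem SmoothNear.family_pd (h : SmoothNear (Function.uncurry F) p₀) (i : Fin m) :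
    SmoothNear (Function.uncurry fun ξ => DistVanish.pd i (F ξ)) p₀ := by
  filter_upwards [h] with p hp
  have h2 : ContDiffAt ℝ ∞ (Function.uncurry fun (p : P × Eu m) (y : Eu m) => F p.1 y) (p, p.2) := by
    have : ContDiff ℝ ∞ (fun z : (P × Eu m) × Eu m => (z.1.1, z.2)) :=
      (contDiff_fst.comp contDiff_fst).prodMk contDiff_snd
    exact ContDiffAt.comp (g := Function.uncurry F) (p, p.2) hp this.contDiffAt
  exact (ContDiffAt.fderiv h2 contDiffAt_snd (m := ∞) (by simp)).clm_apply contDiffAt_const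

theorem SmoothNear.family_partialDeriv {q : ℕ} (w : Fin q → Fin m) :
    ∀ {F : P → Eu m → ℂ}, SmoothNear (Function.uncurry F) p₀ →
    SmoothNear (fun p : P × Eu m => DistVanish.partialDeriv w (F p.1) p.2) p₀ := by
  induction q with
  | zero =>
    intro F h
    exact h.congr (Eventually.of_forall fun p => partialDeriv_zero w _ _)
  | succ q ih =>
    intro F h
    refine (ih (Fin.init w) (h.family_pd (w (Fin.last q)))).congr ?_
    filter_upwards [h.slice] with p hp using partialDeriv_succ_right w hp

theorem SmoothNear.sym (h : SmoothNear (Function.uncurry F) p₀) : Sym c (𝓝 p₀) 0 0 F := by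
  refine sym_of_continuous_bound h.slice (eventually_nrm_le c p₀) fun q v => ?_
  have h1 := (h.family_partialDeriv v).contDiffAt.continuousAt.norm
  exact ⟨_, (h1.eventually_lt continuousAt_const (lt_add_one _)).mono fun p hp => hp.le⟩

/-- A line in a tangential direction through a point of the subspace stays in the subspace, so the
function is zero along it near the point. -/
theorem eventually_pd_eq_zero (h : SmoothNear (Function.uncurry F) p₀)
    (h0 : ∀ᶠ p in 𝓝 p₀, nrm c p.2 = 0 → F p.1 p.2 = 0) {i : Fin m} (hi : ¬ i.1 < c) :
    ∀ᶠ p in 𝓝 p₀, nrm c p.2 = 0 → DistVanish.pd i (F p.1) p.2 = 0 := by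
  filter_upwards [h.slice, h0.eventually_nhds] with p h1 h2 hp
  have hd := h1.contDiffAt.differentiableAt (by simp)
  have h3 : ContinuousAt (fun t : ℝ => (p.1, p.2 + t • EuclideanSpace.single i (1 : ℝ))) 0 := by
    fun_prop
  have h4 : (fun t : ℝ => F p.1 (p.2 + t • EuclideanSpace.single i (1 : ℝ))) =ᶠ[𝓝 0]
      fun _ => 0 := by
    have h5 := h3.eventually (p := fun p => nrm c p.2 = 0 → F p.1 p.2 = 0) (by simpa using h2)
    filter_upwards [h5] with t ht
    refine ht (nrm_eq_zero_iff.2 fun j hj => ?_)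
    have : j ≠ i := fun h => hi (h ▸ hj)
    simp [nrm_eq_zero_iff.1 hp j hj, this]
  have h6 := hd.lineDeriv_eq_fderiv (v := EuclideanSpace.single i (1 : ℝ))
  rw [pd, ← h6, lineDeriv, h4.deriv_eq, deriv_const]

/-- The projection of `y` to the subspace `{y | y i = 0 for i < c}`. -/
def flat (c : ℕ) (y : Eu m) : Eu m :=
  y - (EuclideanSpace.equiv (Fin m) ℝ).symm (normalPart c y)

theorem flat_apply (c : ℕ) (y : Eu m) (i : Fin m) : flat c y i = if i.1 < c then 0 else y i := by
  have : flat c y i = y i - normalPart c y i := rfl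
  rw [this, normalPart_apply]
  split_ifs <;> simp

theorem nrm_flat (c : ℕ) (y : Eu m) : nrm c (flat c y) = 0 :=
  nrm_eq_zero_iff.2 fun i hi => by rw [flat_apply, if_pos hi]

theorem flat_eq_self {c : ℕ} {y : Eu m} (h : nrm c y = 0) : flat c y = y := by
  have : normalPart c y = 0 := norm_eq_zero.1 h
  simp [flat, this]

theorem continuous_flat (c : ℕ) : Continuous (flat c : Eu m → Eu m) := by
  unfold flat
  fun_prop

/-- Near a point of the subspace this is the mean value inequality on the segment from y to its
projection `flat c y`, where the function vanishes. Near any other point `nrm` is bounded below and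
continuity suffices. -/
theorem eventually_norm_le_nrm (h : SmoothNear (Function.uncurry F) p₀)
    (h0 : ∀ᶠ p in 𝓝 p₀, nrm c p.2 = 0 → F p.1 p.2 = 0) :
    ∃ C : ℝ, 0 ≤ C ∧ ∀ᶠ p in 𝓝 p₀, ‖F p.1 p.2‖ ≤ C * nrm c p.2 := by
  rcases (nrm_nonneg c p₀.2).eq_or_lt with hp | hp
  · have hf : ContinuousAt (fun p : P × Eu m => fderiv ℝ (F p.1) p.2) p₀ := by
      have h2 : ContDiffAt ℝ ∞ (Function.uncurry fun (p : P × Eu m) (y : Eu m) => F p.1 y)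
          (p₀, p₀.2) := by
        have : ContDiff ℝ ∞ (fun z : (P × Eu m) × Eu m => (z.1.1, z.2)) :=
          (contDiff_fst.comp contDiff_fst).prodMk contDiff_snd
        exact ContDiffAt.comp (g := Function.uncurry F) (p₀, p₀.2) h.contDiffAt this.contDiffAt
      exact (ContDiffAt.fderiv h2 contDiffAt_snd (m := ∞) (by simp)).continuousAt
    set K := ‖fderiv ℝ (F p₀.1) p₀.2‖ + 1
    have hK : ∀ᶠ p in 𝓝 p₀, ‖fderiv ℝ (F p.1) p.2‖ ≤ K :=
      (hf.norm.eventually_lt continuousAt_const (lt_add_one _)).mono fun p hp => hp.le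
    obtain ⟨r, hr, hball⟩ := Metric.eventually_nhds_iff_ball.1 ((h.slice.and h0).and hK)
    have hfl : ContinuousAt (fun p : P × Eu m => (p.1, flat c p.2)) p₀ :=
      (continuous_fst.prodMk ((continuous_flat c).comp continuous_snd)).continuousAt
    -- The base point is its own projection, so the projections of nearby points stay in the ball on
    -- which the derivative is controlled.
    have hfl' : ∀ᶠ p in 𝓝 p₀, (p.1, flat c p.2) ∈ Metric.ball p₀ r := by
      refine hfl.eventually_mem ?_
      rw [flat_eq_self hp.symm]
      exact Metric.ball_mem_nhds _ hr
    set A : (Fin m → ℝ) →L[ℝ] Eu m :=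
      (EuclideanSpace.equiv (Fin m) ℝ).symm.toContinuousLinearMap
    have hK0 : 0 ≤ K := by positivity
    refine ⟨K * ‖A‖, by positivity, ?_⟩
    filter_upwards [hfl', Metric.ball_mem_nhds _ hr] with p h1 h2
    have hsub : ∀ z ∈ Metric.ball p₀.2 r, (p.1, z) ∈ Metric.ball p₀ r := by
      intro z hz
      rw [← Prod.mk.eta (p := p₀), ← ball_prod_same] at h1 ⊢
      exact ⟨h1.1, hz⟩
    have hb1 : flat c p.2 ∈ Metric.ball p₀.2 r := by
      rw [← Prod.mk.eta (p := p₀), ← ball_prod_same] at h1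
      exact h1.2
    have hb2 : p.2 ∈ Metric.ball p₀.2 r := by
      rw [← Prod.mk.eta (p := p₀), ← ball_prod_same] at h2
      exact h2.2
    have hmv := (convex_ball p₀.2 r).norm_image_sub_le_of_norm_fderiv_le (𝕜 := ℝ) (f := F p.1)
      (C := K) (fun z hz => (hball _ (hsub z hz)).1.1.contDiffAt.differentiableAt (by simp))
      (fun z hz => (hball _ (hsub z hz)).2) hb1 hb2
    rw [(hball _ h1).1.2 (nrm_flat c p.2), sub_zero] at hmv
    refine hmv.trans ?_
    rw [mul_assoc]
    refine mul_le_mul_of_nonneg_left ?_ hK0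
    have : p.2 - flat c p.2 = A (normalPart c p.2) := by
      change _ = (EuclideanSpace.equiv (Fin m) ℝ).symm _
      simp [flat]
    rw [this]
    exact A.le_opNorm _
  · have h1 : ∀ᶠ p in 𝓝 p₀, nrm c p₀.2 / 2 < nrm c p.2 :=
      continuousAt_const.eventually_lt (((continuous_nrm c).comp continuous_snd).continuousAt)
        (half_lt_self hp)
    have h2 : ∀ᶠ p in 𝓝 p₀, ‖F p.1 p.2‖ < ‖F p₀.1 p₀.2‖ + 1 :=
      (h.contDiffAt.continuousAt.norm).eventually_lt continuousAt_const (lt_add_one _)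
    refine ⟨(‖F p₀.1 p₀.2‖ + 1) / (nrm c p₀.2 / 2), by positivity, ?_⟩
    filter_upwards [h1, h2] with p h3 h4
    rw [div_mul_eq_mul_div, le_div_iff₀ (by positivity)]
    gcongr

/-- Derivatives along words without normal letters still vanish on the subspace, hence are O(`nrm`).
For every other word the weight `nrm ^ wordDeg c v` already supplies a power of `nrm`, and
boundedness of the derivative is enough. -/
theorem SmoothNear.sym_one (h : SmoothNear (Function.uncurry F) p₀)
    (h0 : ∀ᶠ p in 𝓝 p₀, nrm c p.2 = 0 → F p.1 p.2 = 0) : Sym c (𝓝 p₀) 0 1 F := by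
  have hz : ∀ (q : ℕ) (v : Fin q → Fin m) (F : P → Eu m → ℂ), wordDeg c v = 0 →
      SmoothNear (Function.uncurry F) p₀ → (∀ᶠ p in 𝓝 p₀, nrm c p.2 = 0 → F p.1 p.2 = 0) →
      ∀ᶠ p in 𝓝 p₀, nrm c p.2 = 0 → DistVanish.partialDeriv v (F p.1) p.2 = 0 := by
    intro q v
    induction q with
    | zero => intro F _ _ h0; simpa only [partialDeriv_zero] using h0
    | succ q ih =>
      intro F hv h h0
      rw [wordDeg_succ, Nat.add_eq_zero_iff, letterDeg_eq_zero] at hv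
      filter_upwards [ih (Fin.init v) _ hv.1 (h.family_pd (v (Fin.last q)))
        (eventually_pd_eq_zero h h0 hv.2), h.slice] with p h1 h2 h3
      rw [partialDeriv_succ_right v h2, h1 h3]
  refine ⟨h.slice, fun q v => ?_⟩
  rcases Nat.eq_zero_or_pos (wordDeg c v) with hv | hv
  · obtain ⟨C, hC, hb⟩ := eventually_norm_le_nrm
      (F := fun ξ y => DistVanish.partialDeriv v (F ξ) y) (h.family_partialDeriv v) (hz q v F hv h h0)
    refine ⟨C, hC, ?_⟩
    filter_upwards [hb] with p hp
    simpa [hv] using hp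
  · obtain ⟨C, hC, hb⟩ := (h.sym (c := c)).bound q v
    have h1 := (h.family_partialDeriv v).contDiffAt.continuousAt.norm
    have h2 := (h1.eventually_lt continuousAt_const (lt_add_one _)).mono fun p hp => hp.le
    set K := ‖DistVanish.partialDeriv v (F p₀.1) p₀.2‖ + 1
    have hK : 0 ≤ K := by positivity
    refine ⟨(nrm c p₀.2 + 1) ^ (wordDeg c v - 1) * K, by have := nrm_nonneg c p₀.2; positivity, ?_⟩
    filter_upwards [h2, eventually_nrm_le c p₀] with p h3 h4
    have hn := nrm_nonneg c p.2
    have hn₀ := nrm_nonneg c p₀.2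
    obtain ⟨d, hd⟩ := Nat.exists_eq_succ_of_ne_zero hv.ne'
    rw [hd, zero_add, Nat.succ_sub_one, pow_succ, pow_one]
    calc _ = (nrm c p.2 ^ d * ‖DistVanish.partialDeriv v (F p.1) p.2‖) * nrm c p.2 := by ring
      _ ≤ ((nrm c p₀.2 + 1) ^ d * K) * nrm c p.2 := by gcongr

/-- Functions in the powers of the ideal of a coordinate subspace belong to the corresponding
symbol classes. -/
theorem MemIdealPow.sym {Z W : Set (Eu m)} {k : ℕ} {g : Eu m → ℂ} (hg : MemIdealPow Z k W g)
    (hp : p₀.2 ∈ W) (hZ : ∀ y ∈ W, nrm c y = 0 → y ∈ Z) :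
    Sym c (𝓝 p₀) 0 k (fun _ => g) := by
  obtain ⟨-, hg⟩ := hg
  obtain ⟨W', hW', hW'o, hpW', N, C, u, hC, hu, hgu⟩ := hg _ hp
  have hev : ∀ᶠ p in 𝓝 p₀, p.2 ∈ W' := continuousAt_snd.eventually_mem (hW'o.mem_nhds hpW')
  have hfam : ∀ f : Eu m → ℂ, ContDiffOn ℝ ∞ f W' →
      SmoothNear (Function.uncurry fun _ : P => f) p₀ := fun f hf =>
    SmoothNear.comp (k := f) (smoothNear_of_contDiffOn hf hW'o hpW') (smoothNear_of_contDiff contDiff_snd)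
  have hsum : Sym c (𝓝 p₀) 0 k (fun _ y => ∑ a, C a y * ∏ b, u a b y) := by
    refine Sym.sum fun a _ => ?_
    have h1 : Sym c (𝓝 p₀) 0 (∑ _b : Fin k, 1) (fun (_ : P) y => ∏ b, u a b y) := by
      refine Sym.prod (F := fun b (_ : P) y => u a b y)
        (fun b => (hfam _ (hu a b).1).sym_one ?_) (eventually_nrm_le c p₀)
      filter_upwards [hev] with p hp' hn using (hu a b).2 _ ⟨hp', hZ _ (hW' hp') hn⟩
    simpa using ((hfam _ (hC a)).sym (c := c)).mul h1
  refine hsum.congr ?_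
  filter_upwards [hev] with p hp'
  filter_upwards [hW'o.mem_nhds hp'] with y hy using hgu y hy

end SmoothFamilies

/-! ### Powers of the ideal of a subset -/

section Ideals

variable {m : ℕ} {Z W : Set (Eu m)} {k k' : ℕ} {g g' : Eu m → ℂ}

/-- `g` is on `W` a finite sum of products of `k` smooth functions vanishing on `Z`. -/
def IdealRep (Z : Set (Eu m)) (k : ℕ) (W : Set (Eu m)) (g : Eu m → ℂ) : Prop :=
  ∃ (ι : Type) (_ : Fintype ι) (c : ι → Eu m → ℂ) (u : ι → Fin k → Eu m → ℂ),
    (∀ a, ContDiffOn ℝ ∞ (c a) W) ∧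
    (∀ a b, ContDiffOn ℝ ∞ (u a b) W ∧ ∀ z ∈ W ∩ Z, u a b z = 0) ∧
    ∀ y ∈ W, g y = ∑ a, c a y * ∏ b, u a b y

theorem IdealRep.contDiffOn (h : IdealRep Z k W g) : ContDiffOn ℝ ∞ g W := by
  obtain ⟨ι, _, c, u, hc, hu, hg⟩ := h
  refine ContDiffOn.congr (ContDiffOn.sum fun a _ => (hc a).mul ?_) hg
  exact contDiffOn_prod fun b _ => (hu a b).1

theorem IdealRep.mono {W' : Set (Eu m)} (h : IdealRep Z k W g) (hW : W' ⊆ W) :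
    IdealRep Z k W' g := by
  obtain ⟨ι, hι, c, u, hc, hu, hg⟩ := h
  exact ⟨ι, hι, c, u, fun a => (hc a).mono hW, fun a b => ⟨(hu a b).1.mono hW,
    fun z hz => (hu a b).2 z ⟨hW hz.1, hz.2⟩⟩, fun y hy => hg y (hW hy)⟩

theorem IdealRep.congr (h : IdealRep Z k W g) (hg : ∀ y ∈ W, g' y = g y) :
    IdealRep Z k W g' := by
  obtain ⟨ι, hι, c, u, hc, hu, hg'⟩ := h
  exact ⟨ι, hι, c, u, hc, hu, fun y hy => (hg y hy).trans (hg' y hy)⟩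

theorem IdealRep.add (h : IdealRep Z k W g) (h' : IdealRep Z k W g') :
    IdealRep Z k W (fun y => g y + g' y) := by
  obtain ⟨ι, hι, c, u, hc, hu, hg⟩ := h
  obtain ⟨ι', hι', c', u', hc', hu', hg'⟩ := h'
  refine ⟨ι ⊕ ι', inferInstance, Sum.elim c c', Sum.elim u u', ?_, ?_, fun y hy => ?_⟩
  · rintro (a | a)
    exacts [hc a, hc' a]
  · rintro (a | a) b
    exacts [hu a b, hu' a b]
  · simp [hg y hy, hg' y hy]

theorem IdealRep.mul (h : IdealRep Z k W g) (h' : IdealRep Z k' W g') :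
    IdealRep Z (k + k') W (fun y => g y * g' y) := by
  obtain ⟨ι, hι, c, u, hc, hu, hg⟩ := h
  obtain ⟨ι', hι', c', u', hc', hu', hg'⟩ := h'
  refine ⟨ι × ι', inferInstance, fun a y => c a.1 y * c' a.2 y,
    fun a => Fin.addCases (u a.1) (u' a.2), fun a => (hc _).mul (hc' _), fun a b => ?_,
    fun y hy => ?_⟩
  · refine Fin.addCases (fun b => ?_) (fun b => ?_) b
    · simpa using hu a.1 b
    · simpa using hu' a.2 b
  · simp only [hg y hy, hg' y hy, Finset.sum_mul_sum, Fintype.sum_prod_type, Fin.prod_univ_add,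
      Fin.addCases_left, Fin.addCases_right]
    exact Finset.sum_congr rfl fun _ _ => Finset.sum_congr rfl fun _ _ => by ring

theorem IdealRep.of_le (h : IdealRep Z k W g) (hk : k' ≤ k) : IdealRep Z k' W g := by
  obtain ⟨d, rfl⟩ := Nat.exists_eq_add_of_le hk
  obtain ⟨ι, hι, c, u, hc, hu, hg⟩ := h
  refine ⟨ι, hι, fun a y => c a y * ∏ b : Fin d, u a (Fin.natAdd k' b) y,
    fun a b => u a (Fin.castAdd d b), fun a => (hc a).mul (contDiffOn_prod fun b _ => (hu a _).1),
    fun a b => hu a _, fun y hy => ?_⟩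
  rw [hg y hy]
  refine Finset.sum_congr rfl fun a _ => ?_
  rw [Fin.prod_univ_add]
  ring

/-- Smoothness follows from the local representations and need not be carried along. Arbitrary
finite index types replace `Fin N`, so that sums and products of representations are indexed by sum
and product types. -/
theorem memIdealPow_iff : MemIdealPow Z k W g ↔
    ∀ p ∈ W, ∃ W' ⊆ W, IsOpen W' ∧ p ∈ W' ∧ IdealRep Z k W' g := by
  constructor
  · rintro ⟨-, h⟩ p hp
    obtain ⟨W', hW', ho, hpW, N, c, u, hc, hu, hg⟩ := h p hp
    exact ⟨W', hW', ho, hpW, Fin N, inferInstance, c, u, hc, hu, hg⟩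
  · intro h
    refine ⟨fun p hp => ?_, fun p hp => ?_⟩
    · obtain ⟨W', hW', ho, hpW, hr⟩ := h p hp
      exact (hr.contDiffOn.contDiffAt (ho.mem_nhds hpW)).contDiffWithinAt
    · obtain ⟨W', hW', ho, hpW, ι, hι, c, u, hc, hu, hg⟩ := h p hp
      let e := Fintype.equivFin ι
      refine ⟨W', hW', ho, hpW, Fintype.card ι, fun a => c (e.symm a), fun a => u (e.symm a),
        fun a => hc _, fun a b => hu _ _, fun y hy => ?_⟩
      rw [hg y hy]
      exact (Equiv.sum_comp e.symm fun a => c a y * ∏ b, u a b y).symm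

theorem IdealRep.memIdealPow (h : IdealRep Z k W g) (hW : IsOpen W) : MemIdealPow Z k W g :=
  memIdealPow_iff.2 fun _ hp => ⟨W, subset_rfl, hW, hp, h⟩

theorem memIdealPow_of_local
    (h : ∀ p ∈ W, ∃ W' ⊆ W, IsOpen W' ∧ p ∈ W' ∧ MemIdealPow Z k W' g) : MemIdealPow Z k W g := by
  refine memIdealPow_iff.2 fun p hp => ?_
  obtain ⟨W', hW', ho, hpW, hr⟩ := h p hp
  obtain ⟨W'', hW'', ho', hpW', hr'⟩ := memIdealPow_iff.1 hr p hpW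
  exact ⟨W'', hW''.trans hW', ho', hpW', hr'⟩

theorem MemIdealPow.mono {W' : Set (Eu m)} (h : MemIdealPow Z k W g) (hW : W' ⊆ W)
    (ho : IsOpen W') : MemIdealPow Z k W' g := by
  refine memIdealPow_iff.2 fun p hp => ?_
  obtain ⟨V, hV, hVo, hpV, hr⟩ := memIdealPow_iff.1 h p (hW hp)
  exact ⟨V ∩ W', inter_subset_right, hVo.inter ho, ⟨hpV, hp⟩, hr.mono inter_subset_left⟩

theorem MemIdealPow.congr (h : MemIdealPow Z k W g) (hg : ∀ y ∈ W, g' y = g y) :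
    MemIdealPow Z k W g' := by
  refine memIdealPow_iff.2 fun p hp => ?_
  obtain ⟨V, hV, hVo, hpV, hr⟩ := memIdealPow_iff.1 h p hp
  exact ⟨V, hV, hVo, hpV, hr.congr fun y hy => hg y (hV hy)⟩

theorem MemIdealPow.add (h : MemIdealPow Z k W g) (h' : MemIdealPow Z k W g') :
    MemIdealPow Z k W (fun y => g y + g' y) := by
  refine memIdealPow_iff.2 fun p hp => ?_
  obtain ⟨V, hV, hVo, hpV, hr⟩ := memIdealPow_iff.1 h p hp
  obtain ⟨V', hV', hVo', hpV', hr'⟩ := memIdealPow_iff.1 h' p hp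
  exact ⟨V ∩ V', inter_subset_left.trans hV, hVo.inter hVo', ⟨hpV, hpV'⟩,
    (hr.mono inter_subset_left).add (hr'.mono inter_subset_right)⟩

theorem MemIdealPow.mul (h : MemIdealPow Z k W g) (h' : MemIdealPow Z k' W g') :
    MemIdealPow Z (k + k') W (fun y => g y * g' y) := by
  refine memIdealPow_iff.2 fun p hp => ?_
  obtain ⟨V, hV, hVo, hpV, hr⟩ := memIdealPow_iff.1 h p hp
  obtain ⟨V', hV', hVo', hpV', hr'⟩ := memIdealPow_iff.1 h' p hp
  exact ⟨V ∩ V', inter_subset_left.trans hV, hVo.inter hVo', ⟨hpV, hpV'⟩,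
    (hr.mono inter_subset_left).mul (hr'.mono inter_subset_right)⟩

theorem MemIdealPow.of_le (h : MemIdealPow Z k W g) (hk : k' ≤ k) : MemIdealPow Z k' W g := by
  refine memIdealPow_iff.2 fun p hp => ?_
  obtain ⟨V, hV, hVo, hpV, hr⟩ := memIdealPow_iff.1 h p hp
  exact ⟨V, hV, hVo, hpV, hr.of_le hk⟩

theorem memIdealPow_zero (hW : IsOpen W) (h : ContDiffOn ℝ ∞ g W) : MemIdealPow Z 0 W g :=
  IdealRep.memIdealPow ⟨Unit, inferInstance, fun _ => g, fun _ _ => g, fun _ => h,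
    fun _ b => b.elim0, fun y _ => by simp⟩ hW

theorem memIdealPow_one (hW : IsOpen W) (h : ContDiffOn ℝ ∞ g W)
    (h0 : ∀ z ∈ W ∩ Z, g z = 0) : MemIdealPow Z 1 W g :=
  IdealRep.memIdealPow ⟨Unit, inferInstance, fun _ _ => 1, fun _ _ => g,
    fun _ => contDiffOn_const, fun _ _ => ⟨h, h0⟩, fun y _ => by simp⟩ hW

theorem memIdealPow_zero_fun (hW : IsOpen W) : MemIdealPow Z k W (fun _ => 0) :=
  IdealRep.memIdealPow ⟨Empty, inferInstance, fun a => a.elim, fun a => a.elim,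
    fun a => a.elim, fun a => a.elim, fun y _ => by simp⟩ hW

theorem MemIdealPow.sum {ι : Type*} {t : Finset ι} {f : ι → Eu m → ℂ} (hW : IsOpen W)
    (h : ∀ a ∈ t, MemIdealPow Z k W (f a)) : MemIdealPow Z k W (fun y => ∑ a ∈ t, f a y) := by
  classical
  induction t using Finset.induction_on with
  | empty => simpa using memIdealPow_zero_fun hW
  | insert a t ha ih =>
    simp only [Finset.sum_insert ha]
    exact (h a (Finset.mem_insert_self _ _)).add
      (ih fun b hb => h b (Finset.mem_insert_of_mem hb))

theorem MemIdealPow.prod {ι : Type*} {t : Finset ι} {f : ι → Eu m → ℂ} {s : ι → ℕ} (hW : IsOpen W)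
    (h : ∀ a ∈ t, MemIdealPow Z (s a) W (f a)) :
    MemIdealPow Z (∑ a ∈ t, s a) W (fun y => ∏ a ∈ t, f a y) := by
  classical
  induction t using Finset.induction_on with
  | empty => simpa using memIdealPow_zero hW contDiffOn_const
  | insert a t ha ih =>
    simp only [Finset.prod_insert ha, Finset.sum_insert ha]
    exact (h a (Finset.mem_insert_self _ _)).mul
      (ih fun b hb => h b (Finset.mem_insert_of_mem hb))

theorem contDiffOn_pd (hW : IsOpen W) (h : ContDiffOn ℝ ∞ g W) (i : Fin m) :
    ContDiffOn ℝ ∞ (pd i g) W := fun y hy =>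
  ((smoothNear_of_contDiffOn h hW hy).pd i).contDiffAt.contDiffWithinAt

/-- Leibniz rule: the differentiated factor leaves the ideal only in a normal direction, because a
tangential derivative of a function vanishing on the subspace vanishes there again. Hence at most
`letterDeg c i` factors are lost. -/
theorem memIdealPow_pd_prod {c : ℕ} (hW : IsOpen W) (hZ : ∀ y ∈ W, y ∈ Z ↔ nrm c y = 0)
    (i : Fin m) (k : ℕ) : ∀ u : Fin (k + letterDeg c i) → Eu m → ℂ,
    (∀ b, ContDiffOn ℝ ∞ (u b) W ∧ ∀ z ∈ W ∩ Z, u b z = 0) →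
    MemIdealPow Z k W (pd i fun y => ∏ b, u b y) := by
  have hone : ∀ f : Eu m → ℂ, ContDiffOn ℝ ∞ f W → (∀ z ∈ W ∩ Z, f z = 0) →
      MemIdealPow Z (1 - letterDeg c i) W (pd i f) := by
    intro f hf hf0
    by_cases hi : i.1 < c
    · rw [letterDeg, if_pos hi]
      exact memIdealPow_zero hW (contDiffOn_pd hW hf i)
    · rw [letterDeg, if_neg hi]
      refine memIdealPow_one hW (contDiffOn_pd hW hf i) fun z hz => ?_
      have h1 : SmoothNear (Function.uncurry fun (_ : ℝ) => f) ((0 : ℝ), z) :=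
        SmoothNear.comp (k := f) (smoothNear_of_contDiffOn hf hW hz.1)
          (smoothNear_of_contDiff contDiff_snd)
      have h2 : ∀ᶠ p : ℝ × Eu m in 𝓝 ((0 : ℝ), z), nrm c p.2 = 0 → f p.2 = 0 := by
        have : ∀ᶠ p : ℝ × Eu m in 𝓝 ((0 : ℝ), z), p.2 ∈ W :=
          continuousAt_snd.eventually_mem (hW.mem_nhds hz.1)
        filter_upwards [this] with p hp hn using hf0 _ ⟨hp, (hZ _ hp).2 hn⟩
      exact (eventually_pd_eq_zero h1 h2 hi).self_of_nhds ((hZ z hz.1).1 hz.2)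
  induction k with
  | zero =>
    intro u hu
    exact memIdealPow_zero hW (contDiffOn_pd hW (contDiffOn_prod fun b _ => (hu b).1) i)
  | succ k ih =>
    rw [Nat.add_right_comm]
    intro u hu
    have hp : ContDiffOn ℝ ∞ (fun y => ∏ b : Fin (k + letterDeg c i), u b.succ y) W :=
      contDiffOn_prod fun b _ => (hu b.succ).1
    have hI : MemIdealPow Z (k + letterDeg c i) W
        (fun y => ∏ b : Fin (k + letterDeg c i), u b.succ y) := by
      simpa using MemIdealPow.prod (t := Finset.univ) (s := fun _ => 1) hW
        fun (b : Fin (k + letterDeg c i)) _ => memIdealPow_one hW (hu b.succ).1 (hu b.succ).2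
    have h1 := (hone _ (hu 0).1 (hu 0).2).mul hI
    have h2 := (memIdealPow_one hW (hu 0).1 (hu 0).2).mul (ih (fun b => u b.succ)
      fun b => hu b.succ)
    have h3 := (h1.of_le (k' := k + 1) (by
      rw [letterDeg]; split_ifs <;> omega)).add (h2.of_le (k' := k + 1) (by omega))
    refine h3.congr fun y hy => ?_
    simp only [Fin.prod_univ_succ]
    exact (pd_mul (smoothNear_of_contDiffOn (hu 0).1 hW hy)
      (smoothNear_of_contDiffOn hp hW hy) i).self_of_nhds

theorem MemIdealPow.pd {c : ℕ} (hW : IsOpen W) (hZ : ∀ y ∈ W, y ∈ Z ↔ nrm c y = 0)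
    {i : Fin m} (h : MemIdealPow Z (k + letterDeg c i) W g) : MemIdealPow Z k W (pd i g) := by
  refine memIdealPow_of_local fun p hp => ?_
  obtain ⟨V, hV, hVo, hpV, ι, hι, C, u, hC, hu, hg⟩ := memIdealPow_iff.1 h p hp
  have hZ' : ∀ y ∈ V, y ∈ Z ↔ nrm c y = 0 := fun y hy => hZ y (hV hy)
  have hprod : ∀ a, ContDiffOn ℝ ∞ (fun y => ∏ b, u a b y) V := fun a =>
    contDiffOn_prod fun b _ => (hu a b).1
  refine ⟨V, hV, hVo, hpV, ?_⟩
  have h1 : ∀ a, MemIdealPow Z k V (fun y => DistVanish.pd i (C a) y * ∏ b, u a b y +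
      C a y * DistVanish.pd i (fun y => ∏ b, u a b y) y) := fun a => by
    refine MemIdealPow.add ?_ ?_
    · have : MemIdealPow Z (∑ _b : Fin (k + letterDeg c i), 1) V (fun y => ∏ b, u a b y) :=
        MemIdealPow.prod hVo fun b _ => memIdealPow_one hVo (hu a b).1 (hu a b).2
      exact ((memIdealPow_zero hVo (contDiffOn_pd hVo (hC a) i)).mul this).of_le (by simp)
    · exact ((memIdealPow_zero hVo (hC a)).mul
        (memIdealPow_pd_prod hVo hZ' i k (u a) (hu a))).of_le (by simp)
  refine (MemIdealPow.sum (t := Finset.univ) hVo fun a _ => h1 a).congr fun y hy => ?_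
  have h2 : g =ᶠ[𝓝 y] fun y => ∑ a, C a y * ∏ b, u a b y := by
    filter_upwards [hVo.mem_nhds hy] with z hz using hg z hz
  rw [(pd_congr h2 i).self_of_nhds, (pd_sum (fun a _ => (smoothNear_of_contDiffOn (hC a) hVo hy).mul
    (smoothNear_of_contDiffOn (hprod a) hVo hy)) i).self_of_nhds]
  exact Finset.sum_congr rfl fun a _ => (pd_mul (smoothNear_of_contDiffOn (hC a) hVo hy)
    (smoothNear_of_contDiffOn (hprod a) hVo hy) i).self_of_nhds

theorem MemIdealPow.partialDeriv {c : ℕ} (hW : IsOpen W) (hZ : ∀ y ∈ W, y ∈ Z ↔ nrm c y = 0)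
    {q : ℕ} (w : Fin q → Fin m) : ∀ {k : ℕ} {g : Eu m → ℂ},
    MemIdealPow Z (k + wordDeg c w) W g → MemIdealPow Z k W (partialDeriv w g) := by
  induction q with
  | zero =>
    intro k g h
    exact (h.of_le (Nat.le_add_right _ _)).congr fun y _ => partialDeriv_zero w g y
  | succ q ih =>
    intro k g h
    rw [wordDeg_succ, ← add_assoc] at h
    refine (ih (Fin.init w) (MemIdealPow.pd hW hZ h)).congr fun y hy => ?_
    exact partialDeriv_succ_right w (smoothNear_of_contDiffOn h.1 hW hy)

/-- Transfer of ideals by a diffeomorphism. -/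
theorem MemIdealPow.comp {Z' W' : Set (Eu m)} (h : MemIdealPow Z k W g) {κ : Eu m → Eu m}
    (hW' : IsOpen W') (hκ : ContDiffOn ℝ ∞ κ W') (hmaps : MapsTo κ W' W)
    (hZ : ∀ y ∈ W', y ∈ Z' → κ y ∈ Z) : MemIdealPow Z' k W' (fun y => g (κ y)) := by
  refine memIdealPow_iff.2 fun p hp => ?_
  obtain ⟨V, hV, hVo, hpV, ι, hι, c, u, hc, hu, hg⟩ := memIdealPow_iff.1 h _ (hmaps hp)
  have hsub : W' ∩ κ ⁻¹' V ⊆ W' := inter_subset_left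
  have hm : MapsTo κ (W' ∩ κ ⁻¹' V) V := fun y hy => hy.2
  exact ⟨W' ∩ κ ⁻¹' V, hsub, hκ.continuousOn.isOpen_inter_preimage hW' hVo, ⟨hp, hpV⟩, ι, hι,
    fun a y => c a (κ y), fun a b y => u a b (κ y),
    fun a => (hc a).comp (hκ.mono hsub) hm,
    fun a b => ⟨(hu a b).1.comp (hκ.mono hsub) hm, fun z hz =>
      (hu a b).2 _ ⟨hz.1.2, hZ z hz.1.1 hz.2⟩⟩, fun y hy => hg _ hy.2⟩

end Ideals

/-! ### Normal linear forms and the model tangential operators -/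

section Coordinates

variable {m : ℕ} {Z W : Set (Eu m)}

/-- The linear forms `0` and `y ↦ y i` for `i < c`. -/
def normalForm (c : ℕ) (a : Option (Fin m)) : Eu m →L[ℝ] ℂ :=
  a.elim 0 fun i => if i.1 < c then Complex.ofRealCLM ∘L EuclideanSpace.proj (𝕜 := ℝ) i else 0

theorem normalForm_none (c : ℕ) (y : Eu m) : normalForm c none y = 0 := rfl

theorem normalForm_some (c : ℕ) (i : Fin m) (y : Eu m) :
    normalForm c (some i) y = if i.1 < c then (y i : ℂ) else 0 := by
  simp only [normalForm, Option.elim]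
  split_ifs <;> simp

theorem normalForm_single {c : ℕ} (a : Option (Fin m)) {i : Fin m} (hi : ¬ i.1 < c) :
    normalForm c a (EuclideanSpace.single i (1 : ℝ)) = 0 := by
  cases a with
  | none => rfl
  | some j =>
    rw [normalForm_some]
    split_ifs with hj
    · have : j ≠ i := fun h => hi (h ▸ hj)
      simp [this]
    · rfl

theorem norm_normalForm_le (c : ℕ) (a : Option (Fin m)) (y : Eu m) :
    ‖normalForm c a y‖ ≤ nrm c y := by
  cases a with
  | none => simpa [normalForm_none] using nrm_nonneg c y
  | some i =>
    rw [normalForm_some]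
    split_ifs with hi
    · simpa using abs_coord_le_nrm y hi
    · simpa using nrm_nonneg c y

/-- A maximum norm is attained at some coordinate. The zero form `none` takes care of `nrm c y = 0`,
in particular of the case without normal coordinates. -/
theorem exists_norm_normalForm_eq (c : ℕ) (y : Eu m) :
    ∃ a : Option (Fin m), ‖normalForm c a y‖ = nrm c y := by
  by_contra! h
  have h1 : ∀ a : Option (Fin m), ‖normalForm c a y‖ < nrm c y := fun a =>
    lt_of_le_of_ne (norm_normalForm_le c a y) (h a)
  have h0 : 0 < nrm c y := by simpa [normalForm_none] using h1 none
  refine lt_irrefl (nrm c y) ?_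
  conv_lhs => rw [nrm]
  refine (pi_norm_lt_iff h0).2 fun i => ?_
  have := h1 (some i)
  rw [normalForm_some] at this
  rw [normalPart_apply]
  split_ifs at this ⊢ with hi
  · simpa using this
  · simpa using h0

theorem nrm_pow_le_sum (c s : ℕ) (y : Eu m) :
    nrm c y ^ s ≤ ∑ a : Option (Fin m), ‖normalForm c a y ^ s‖ := by
  obtain ⟨a, ha⟩ := exists_norm_normalForm_eq c y
  rw [← ha, ← norm_pow]
  exact Finset.single_le_sum (f := fun a => ‖normalForm c a y ^ s‖)
    (fun _ _ => norm_nonneg _) (Finset.mem_univ a)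

theorem memIdealPow_normalForm_pow {c : ℕ} (hW : IsOpen W) (hZ : ∀ y ∈ W, y ∈ Z → nrm c y = 0)
    (a : Option (Fin m)) (k : ℕ) : MemIdealPow Z k W (fun y => normalForm c a y ^ k) := by
  have h1 : MemIdealPow Z 1 W (normalForm c a) :=
    memIdealPow_one hW (normalForm c a).contDiff.contDiffOn fun z hz => by
      have := norm_normalForm_le c a z
      rw [hZ z hz.1 hz.2] at this
      simpa using this
  have := MemIdealPow.prod (t := Finset.univ) (s := fun _ : Fin k => 1) hW fun _ _ => h1
  simpa using this

/-- The differential operator `a ∂_w`. -/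
def monomialOp {q : ℕ} (w : Fin q → Fin m) (a : Eu m → ℂ) : DiffOp m where
  order := q
  coeff q' w' := fun y => if h : q' = q then if w' = w ∘ Fin.cast h then a y else 0 else 0

theorem monomialOp_coeff_self {q : ℕ} (w : Fin q → Fin m) (a : Eu m → ℂ) (w' : Fin q → Fin m)
    (y : Eu m) : (monomialOp w a).coeff q w' y = if w' = w then a y else 0 := by
  simp [monomialOp, Function.comp_def]

theorem monomialOp_apply {q : ℕ} (w : Fin q → Fin m) (a g : Eu m → ℂ) (y : Eu m) :
    (monomialOp w a).apply g y = a y * partialDeriv w g y := by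
  rw [DiffOp.apply, Finset.sum_eq_single_of_mem q (by simp [monomialOp])]
  · simp [monomialOp_coeff_self, ite_mul]
  · intro b _ hb
    simp [monomialOp, hb]

theorem partialDeriv_zero_fun {q : ℕ} (w : Fin q → Fin m) (y : Eu m) :
    partialDeriv w (fun _ => (0 : ℂ)) y = 0 := by
  have : iteratedFDeriv ℝ q (fun _ : Eu m => (0 : ℂ)) y = 0 := by
    simp
  simp [partialDeriv, this]

theorem monomialOp_transpose {q : ℕ} (w : Fin q → Fin m) (a g : Eu m → ℂ) (y : Eu m) :
    (monomialOp w a).transpose g y = (-1) ^ q * partialDeriv w (fun z => a z * g z) y := by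
  rw [DiffOp.transpose, Finset.sum_eq_single_of_mem q (by simp [monomialOp])]
  · rw [Finset.sum_eq_single_of_mem w (Finset.mem_univ _)]
    · simp [monomialOp_coeff_self]
    · intro w' _ hw'
      simp [monomialOp_coeff_self, hw', partialDeriv_zero_fun]
  · intro b _ hb
    simp [monomialOp, hb, partialDeriv_zero_fun]

theorem monomialOp_smoothOn {q : ℕ} (w : Fin q → Fin m) {a : Eu m → ℂ} (ha : ContDiffOn ℝ ∞ a W) :
    (monomialOp w a).SmoothOn W := by
  intro q' w'
  simp only [monomialOp]
  split_ifs
  exacts [ha, contDiffOn_const, contDiffOn_const]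

/-- The operators `x ^ deg w ∂_w` are tangential to the coordinate subspace. -/
theorem monomialOp_tangentialOn {c : ℕ} (hZ : ∀ y ∈ W, y ∈ Z ↔ nrm c y = 0)
    {q : ℕ} (w : Fin q → Fin m) (a : Option (Fin m)) :
    (monomialOp w fun y => normalForm c a y ^ wordDeg c w).TangentialOn Z W := by
  intro k V hV hVW g hg
  have hZV : ∀ y ∈ V, y ∈ Z ↔ nrm c y = 0 := fun y hy => hZ y (hVW hy)
  have h1 := memIdealPow_normalForm_pow hV (fun y hy => (hZV y hy).1) a (wordDeg c w)
  refine MemIdealPow.congr ?_ fun y _ => monomialOp_apply w _ g y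
  -- The derivative loses deg w powers of the ideal and the coefficient restores them. If deg w
  -- exceeds `k`, the coefficient alone lies in a high enough power.
  by_cases hk : wordDeg c w ≤ k
  · obtain ⟨d, rfl⟩ := Nat.exists_eq_add_of_le' hk
    exact (h1.mul (MemIdealPow.partialDeriv hV hZV w hg)).of_le (by omega)
  · have h2 : MemIdealPow Z 0 V (partialDeriv w g) := memIdealPow_zero hV fun y hy =>
      ((smoothNear_of_contDiffOn hg.1 hV hy).partialDeriv w).contDiffAt.contDiffWithinAt
    exact (h1.mul h2).of_le (by omega)

/-- Commuting powers of a normal linear form past derivatives: `x ^ (k + deg w) ∂_w g` is a linear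
combination of the functions `∂_w' (x ^ (k + deg w') g)` with `w'` at most as long as `w`. -/
theorem exists_normalForm_pow_mul_partialDeriv (c : ℕ) (a : Option (Fin m)) {q : ℕ}
    (w : Fin q → Fin m) : ∀ k : ℕ, ∃ (ι : Type) (_ : Fintype ι)
      (W : ι → (q' : ℕ) × (Fin q' → Fin m)) (C : ι → ℂ), (∀ b, (W b).1 ≤ q) ∧
      ∀ (g : Eu m → ℂ) (y : Eu m), SmoothNear g y →
        normalForm c a y ^ (k + wordDeg c w) * partialDeriv w g y =
          ∑ b, C b * partialDeriv (W b).2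
            (fun z => normalForm c a z ^ (k + wordDeg c (W b).2) * g z) y := by
  have hsm : ∀ (s : ℕ) (y : Eu m), SmoothNear (fun z => normalForm c a z ^ s) y := fun s y =>
    smoothNear_of_contDiff ((normalForm c a).contDiff.pow s)
  induction q with
  | zero =>
    refine fun k => ⟨Unit, inferInstance, fun _ => ⟨0, w⟩, fun _ => 1, fun _ => le_rfl,
      fun g y hg => ?_⟩
    simp [partialDeriv_zero]
  | succ q ih =>
    intro k
    set i := w 0 with hi
    set n := wordDeg c (Fin.tail w) with hn
    have hdeg : wordDeg c w = letterDeg c i + n := wordDeg_succ_left c w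
    have hdx : ∀ (s : ℕ) (y : Eu m), pd i (fun z => normalForm c a z ^ (s + 1)) y =
        ((s + 1 : ℕ) : ℂ) * normalForm c a (EuclideanSpace.single i (1 : ℝ)) *
          normalForm c a y ^ s := by
      intro s y
      have := ((normalForm c a).hasFDerivAt (x := y)).pow (s + 1)
      simp only [pd, this.fderiv]
      simp
      ring
    -- Moving the power inside the first derivative ∂_i gives a main term, with ∂_i outermost, and a
    -- commutator. The main term uses the induction hypothesis at `k + letterDeg c i`, the
    -- commutator uses it at `k`.
    obtain ⟨ι, hι, W, C, hW, hC⟩ := ih (Fin.tail w) (k + letterDeg c i)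
    obtain ⟨ι', hι', W', C', hW', hC'⟩ := ih (Fin.tail w) k
    -- the factor produced by differentiating the power
    obtain ⟨d, hd⟩ : ∃ d : ℂ, ∀ y, pd i (fun z => normalForm c a z ^ (k + letterDeg c i + n)) y =
        d * normalForm c a y ^ (k + n) := by
      by_cases hic : i.1 < c
      · have h1 : letterDeg c i = 1 := if_pos hic
        have h2 : k + letterDeg c i + n = (k + n) + 1 := by omega
        rw [h2]
        exact ⟨_, fun y => hdx _ y⟩
      -- A tangential derivative annihilates the normal form, so the commutator is zero.
      · refine ⟨0, fun y => ?_⟩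
        rw [zero_mul]
        rcases Nat.eq_zero_or_pos (k + letterDeg c i + n) with h | h
        · rw [h]
          simp [pd]
        · obtain ⟨t, ht⟩ := Nat.exists_eq_succ_of_ne_zero h.ne'
          rw [ht]
          exact (hdx t y).trans (by simp [normalForm_single a hic])
    refine ⟨ι ⊕ ι', inferInstance,
      Sum.elim (fun b => ⟨(W b).1 + 1, Fin.cons i (W b).2⟩) W',
      Sum.elim C fun b => -d * C' b, ?_, fun g y hg => ?_⟩
    · rintro (b | b)
      · exact Nat.succ_le_succ (hW b)
      · exact (hW' b).trans (Nat.le_succ q)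
    have hY : ∀ (s : ℕ) {q' : ℕ} (w' : Fin q' → Fin m), SmoothNear
        (partialDeriv w' (fun z => normalForm c a z ^ s * g z)) y := fun s q' w' =>
      ((hsm s y).mul hg).partialDeriv w'
    -- the product rule for the first letter
    have e1 : normalForm c a y ^ (k + wordDeg c w) * partialDeriv w g y =
        pd i (fun z => normalForm c a z ^ (k + letterDeg c i + n) *
          partialDeriv (Fin.tail w) g z) y -
        d * (normalForm c a y ^ (k + n) * partialDeriv (Fin.tail w) g y) := by
      have := (pd_mul (hsm (k + letterDeg c i + n) y) (hg.partialDeriv (Fin.tail w)) i).self_of_nhds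
      rw [this, partialDeriv_succ_left w hg, hdeg, ← hi]
      beta_reduce
      rw [hd]
      have h3 : k + letterDeg c i + n = k + (letterDeg c i + n) := by ring
      rw [h3]
      ring
    have e3 : (fun z => normalForm c a z ^ (k + letterDeg c i + n) *
        partialDeriv (Fin.tail w) g z) =ᶠ[𝓝 y] fun z => ∑ b, C b * partialDeriv (W b).2
          (fun z => normalForm c a z ^ (k + letterDeg c i + wordDeg c (W b).2) * g z) z := by
      filter_upwards [hg.eventually] with z hz using hC g z hz
    rw [e1, hC' g y hg, (pd_congr e3 i).self_of_nhds, (pd_sum (fun b _ =>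
      (smoothNear_const _).mul (hY _ _)) i).self_of_nhds, Fintype.sum_sum_type, sub_eq_add_neg,
      Finset.mul_sum, ← Finset.sum_neg_distrib]
    congr 1
    · refine Finset.sum_congr rfl fun b _ => ?_
      have h5 := (pd_mul (smoothNear_const (C b))
        (hY (k + letterDeg c i + wordDeg c (W b).2) (W b).2) i).self_of_nhds
      have h1 := partialDeriv_succ_left (Fin.cons i (W b).2 : Fin ((W b).1 + 1) → Fin m)
        ((hsm (k + letterDeg c i + wordDeg c (W b).2) y).mul hg)
      rw [Fin.cons_zero, Fin.tail_cons] at h1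
      have h2 : wordDeg c (Fin.cons i (W b).2 : Fin ((W b).1 + 1) → Fin m) =
          letterDeg c i + wordDeg c (W b).2 := by rw [wordDeg_succ_left]; simp
      rw [h5]
      beta_reduce
      rw [← h1]
      simp only [Sum.elim_inl, h2, ← add_assoc]
      simp [pd]
    · refine Finset.sum_congr rfl fun b _ => ?_
      simp only [Sum.elim_inr]
      ring

end Coordinates

/-! ### Functionals bounded by `L¹` norms -/

section Duality

variable {α : Type*} [MeasurableSpace α] {ν : Measure α} [IsFiniteMeasure ν]

/-- For a finite measure L² embeds continuously into L¹, so the functional restricts to L² and the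
Riesz representation theorem applies. The conjugate appears because the inner product is
conjugate-linear in its first argument. -/
theorem exists_L2_representation (Λ : Lp ℂ 1 ν →L[ℂ] ℂ) :
    ∃ u : Lp ℂ 2 ν, ∀ (f : α → ℂ) (h2 : MemLp f 2 ν) (h1 : Integrable f ν),
      Λ (h1.toL1 f) = ∫ x, starRingEnd ℂ (u x) * f x ∂ν := by
  have hle : ∀ f : Lp ℂ 2 ν, Integrable f ν := fun f =>
    (Lp.memLp f).integrable (by norm_num)
  let ℓ₀ : Lp ℂ 2 ν →ₗ[ℂ] ℂ :=
    { toFun := fun f => Λ ((hle f).toL1 f)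
      map_add' := fun f g => by
        rw [← map_add, ← Integrable.toL1_add]
        congr 1
        exact (Integrable.toL1_eq_toL1_iff _ _ _ _).2 (Lp.coeFn_add f g)
      map_smul' := fun c f => by
        rw [RingHom.id_apply, ← map_smul, ← Integrable.toL1_smul]
        congr 1
        exact (Integrable.toL1_eq_toL1_iff _ _ _ _).2 (Lp.coeFn_smul c f) }
  obtain ⟨K, hK⟩ : ∃ K : ℝ, ∀ f : Lp ℂ 2 ν, ‖ℓ₀ f‖ ≤ K * ‖f‖ := by
    refine ⟨‖Λ‖ * (ν univ ^ (1 / (1 : ENNReal).toReal - 1 / (2 : ENNReal).toReal)).toReal,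
      fun f => (Λ.le_opNorm _).trans ?_⟩
    rw [mul_assoc]
    refine mul_le_mul_of_nonneg_left ?_ (norm_nonneg _)
    have h := eLpNorm_le_eLpNorm_mul_rpow_measure_univ (μ := ν) (p := 1) (q := 2) (by norm_num)
      (Lp.aestronglyMeasurable f)
    rw [Integrable.norm_toL1_eq_lintegral_norm, Lp.norm_def, mul_comm, ← ENNReal.toReal_mul]
    refine ENNReal.toReal_mono (ENNReal.mul_ne_top (Lp.eLpNorm_ne_top f)
      (ENNReal.rpow_ne_top_of_nonneg (by norm_num) (measure_ne_top ν _))) ?_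
    refine le_trans (le_of_eq ?_) h
    rw [eLpNorm_one_eq_lintegral_enorm]
    simp
  let ℓ : Lp ℂ 2 ν →L[ℂ] ℂ := ℓ₀.mkContinuous K hK
  refine ⟨(InnerProductSpace.toDual ℂ (Lp ℂ 2 ν)).symm ℓ, fun f h2 h1 => ?_⟩
  have h3 : ℓ (h2.toLp f) = Λ (h1.toL1 f) := by
    change Λ _ = Λ _
    congr 1
    exact (Integrable.toL1_eq_toL1_iff _ _ _ _).2 h2.coeFn_toLp
  rw [← h3, ← InnerProductSpace.toDual_symm_apply, L2.inner_def]
  refine integral_congr_ae ?_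
  filter_upwards [h2.coeFn_toLp] with x hx
  rw [hx, RCLike.inner_apply, mul_comm]

/-- Continuous functionals on `L¹` of a finite measure are given by bounded functions. -/
theorem exists_bounded_density (Λ : Lp ℂ 1 ν →L[ℂ] ℂ) :
    ∃ H : α → ℂ, Measurable H ∧ (∀ x, ‖H x‖ ≤ ‖Λ‖) ∧
      ∀ (f : α → ℂ) (h1 : Integrable f ν), Λ (h1.toL1 f) = ∫ x, H x * f x ∂ν := by
  obtain ⟨u, hu⟩ := exists_L2_representation Λ
  have hum : Measurable u := (Lp.stronglyMeasurable u).measurable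
  have hui : Integrable u ν := (Lp.memLp u).integrable (by norm_num)
  -- the sign of `u`
  let sgn : α → ℂ := fun x => u x / (‖u x‖ : ℂ)
  have hsgnm : Measurable sgn := hum.div (Complex.measurable_ofReal.comp hum.norm)
  have hsgn : ∀ x, ‖sgn x‖ ≤ 1 := fun x => by
    simp only [sgn, norm_div, Complex.norm_real, norm_norm]
    exact div_self_le_one _
  -- Testing on the sign of `u` cut off to a measurable set `s` gives ∫_s |u| on one side and at
  -- most ‖Λ‖ ν(s) on the other. The quotient defining the sign is 0 where `u` vanishes, by the
  -- convention for division by zero.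
  have hbound : ∀ᵐ x ∂ν, ‖u x‖ ≤ ‖Λ‖ := by
    refine ae_le_of_forall_setIntegral_le hui.norm (integrable_const _) fun s hs _ => ?_
    have hm : Measurable (s.indicator sgn) := hsgnm.indicator hs
    have hb : ∀ x, ‖s.indicator sgn x‖ ≤ s.indicator (fun _ => (1 : ℝ)) x := fun x => by
      rw [norm_indicator_eq_indicator_norm]
      exact indicator_le_indicator (hsgn x)
    have hb' : ∀ x, ‖s.indicator sgn x‖ ≤ 1 := fun x =>
      (hb x).trans (indicator_le_self' (fun _ _ => zero_le_one) x)
    have h2 : MemLp (s.indicator sgn) 2 ν :=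
      MemLp.of_bound hm.aestronglyMeasurable 1 (Eventually.of_forall hb')
    have h1 : Integrable (s.indicator sgn) ν := h2.integrable (by norm_num)
    have e1 := hu _ h2 h1
    have e2 : ∫ x, starRingEnd ℂ (u x) * s.indicator sgn x ∂ν =
        ((∫ x in s, ‖u x‖ ∂ν : ℝ) : ℂ) := by
      rw [← integral_indicator hs, ← integral_complex_ofReal]
      refine integral_congr_ae (Eventually.of_forall fun x => ?_)
      by_cases hx : x ∈ s
      · simp only [indicator_of_mem hx, sgn]
        by_cases h0 : u x = 0
        · simp [h0]
        · have hn : (‖u x‖ : ℂ) ≠ 0 := by simpa using h0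
          rw [mul_div_assoc', div_eq_iff hn, mul_comm, Complex.mul_conj, Complex.normSq_eq_norm_sq]
          push_cast
          ring
      · simp [indicator_of_notMem hx]
    have e3 := Λ.le_opNorm (h1.toL1 _)
    rw [e1, e2, Complex.norm_real, Real.norm_eq_abs] at e3
    refine (le_abs_self _).trans (e3.trans ?_)
    have e4 : ‖h1.toL1 (s.indicator sgn)‖ ≤ ν.real s := by
      rw [L1.norm_eq_integral_norm]
      calc ∫ x, ‖h1.toL1 (s.indicator sgn) x‖ ∂ν = ∫ x, ‖s.indicator sgn x‖ ∂ν := by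
            refine integral_congr_ae ?_
            filter_upwards [h1.coeFn_toL1] with x hx
            rw [hx]
        _ ≤ ∫ x, s.indicator (fun _ => (1 : ℝ)) x ∂ν :=
            integral_mono h1.norm ((integrable_const _).indicator hs) hb
        _ = ν.real s := by simp [integral_indicator hs]
    rw [setIntegral_const, smul_eq_mul, mul_comm]
    exact mul_le_mul_of_nonneg_right e4 (norm_nonneg _)
  -- Cutting `u` off on a null set turns the almost everywhere bound into a bound at every point.
  let H : α → ℂ := {x | ‖u x‖ ≤ ‖Λ‖}.indicator fun x => starRingEnd ℂ (u x)
  have hHm : Measurable H :=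
    (Complex.continuous_conj.measurable.comp hum).indicator
      (measurableSet_le hum.norm measurable_const)
  have hH : ∀ x, ‖H x‖ ≤ ‖Λ‖ := fun x => by
    by_cases hx : x ∈ {x | ‖u x‖ ≤ ‖Λ‖}
    · simp only [H, indicator_of_mem hx, RCLike.norm_conj]
      exact hx
    · simp [H, indicator_of_notMem hx]
  have hHu : ∀ᵐ x ∂ν, H x = starRingEnd ℂ (u x) := by
    filter_upwards [hbound] with x hx
    exact indicator_of_mem (show x ∈ {x | ‖u x‖ ≤ ‖Λ‖} from hx) _
  have hHi : ∀ f : α → ℂ, Integrable f ν → Integrable (fun x => H x * f x) ν := fun f hf =>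
    hf.bdd_mul hHm.aestronglyMeasurable (Eventually.of_forall hH)
  refine ⟨H, hHm, hH, fun f h1 => ?_⟩
  -- Both sides are continuous on L¹ and agree on indicators of measurable sets, which lie in L².
  refine Integrable.induction (P := fun f => ∀ h1 : Integrable f ν,
    Λ (h1.toL1 f) = ∫ x, H x * f x ∂ν) ?_ ?_ ?_ ?_ h1 h1
  · intro c s hs _ h1
    have h2 : MemLp (s.indicator fun _ => c) 2 ν := (memLp_const c).indicator hs
    rw [hu _ h2 h1]
    refine integral_congr_ae ?_
    filter_upwards [hHu] with x hx
    rw [hx]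
  · intro f g _ hf hg ihf ihg h1
    have : h1.toL1 (f + g) = hf.toL1 f + hg.toL1 g := Integrable.toL1_add _ _ _ _
    rw [this, map_add, ihf hf, ihg hg, ← integral_add (hHi f hf) (hHi g hg)]
    simp [mul_add]
  · have hcont : Continuous fun f : Lp ℂ 1 ν => ∫ x, H x * f x ∂ν := by
      refine continuous_iff_continuousAt.2 fun f => ?_
      refine tendsto_iff_norm_sub_tendsto_zero.2 ?_
      have hb : ∀ g : Lp ℂ 1 ν, ‖(∫ x, H x * g x ∂ν) - ∫ x, H x * f x ∂ν‖ ≤ ‖Λ‖ * ‖g - f‖ := by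
        intro g
        rw [← integral_sub (hHi _ (L1.integrable_coeFn g)) (hHi _ (L1.integrable_coeFn f)),
          L1.norm_eq_integral_norm, ← integral_const_mul]
        refine norm_integral_le_of_norm_le ((L1.integrable_coeFn _).norm.const_mul _) ?_
        filter_upwards [Lp.coeFn_sub g f] with x hx
        rw [hx, ← mul_sub, norm_mul]
        exact mul_le_mul_of_nonneg_right (hH x) (norm_nonneg _)
      refine squeeze_zero (fun _ => norm_nonneg _) hb ?_
      have : Tendsto (fun g : Lp ℂ 1 ν => ‖Λ‖ * ‖g - f‖) (𝓝 f) (𝓝 (‖Λ‖ * ‖f - f‖)) :=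
        Continuous.tendsto (by fun_prop) f
      simpa using this
    have : {f : Lp ℂ 1 ν | ∀ h1 : Integrable f ν, Λ (h1.toL1 f) = ∫ x, H x * f x ∂ν} =
        {f : Lp ℂ 1 ν | Λ f = ∫ x, H x * f x ∂ν} := by
      ext f
      have h1 := L1.integrable_coeFn f
      simp only [mem_ofPred_eq]
      constructor
      · intro h
        simpa using h h1
      · intro h h1
        simpa using h
    rw [this]
    exact isClosed_eq Λ.continuous hcont
  · intro f g hfg hf ih hg
    have : hg.toL1 g = hf.toL1 f := (Integrable.toL1_eq_toL1_iff _ _ _ _).2 hfg.symm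
    rw [this, ih hf]
    refine integral_congr_ae ?_
    filter_upwards [hfg] with x hx
    rw [hx]

/-- A functional which is bounded by the `L¹` norms of finitely many linear expressions is a sum of
integrals of these expressions against bounded measurable functions. -/
theorem exists_densities_of_bound {X B : Type*} [AddCommGroup X] [Module ℂ X] [Fintype B]
    (T : B → X → α → ℂ) (hT : ∀ b x, Integrable (T b x) ν)
    (hadd : ∀ b x x', T b (x + x') =ᵐ[ν] T b x + T b x')
    (hsmul : ∀ b (c : ℂ) x, T b (c • x) =ᵐ[ν] c • T b x)
    (Λ : X →ₗ[ℂ] ℂ) (C : ℝ) (hΛ : ∀ x, ‖Λ x‖ ≤ C * ∑ b, ∫ a, ‖T b x a‖ ∂ν) :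
    ∃ (H : B → α → ℂ) (K : ℝ), (∀ b, Measurable (H b)) ∧ (∀ b a, ‖H b a‖ ≤ K) ∧
      ∀ x, Λ x = ∑ b, ∫ a, H b a * T b x a ∂ν := by
  classical
  let 𝒯 : X →ₗ[ℂ] (B → Lp ℂ 1 ν) :=
    { toFun := fun x b => (hT b x).toL1 _
      map_add' := fun x x' => funext fun b => by
        rw [Pi.add_apply, ← Integrable.toL1_add]
        exact (Integrable.toL1_eq_toL1_iff _ _ _ _).2 (hadd b x x')
      map_smul' := fun c x => funext fun b => by
        rw [RingHom.id_apply, Pi.smul_apply, ← Integrable.toL1_smul]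
        exact (Integrable.toL1_eq_toL1_iff _ _ _ _).2 (hsmul b c x) }
  have hnorm : ∀ b x, ∫ a, ‖T b x a‖ ∂ν = ‖𝒯 x b‖ := fun b x => by
    rw [L1.norm_eq_integral_norm]
    refine integral_congr_ae ?_
    filter_upwards [(hT b x).coeFn_toL1] with a ha
    simp only [𝒯, LinearMap.coe_mk, AddHom.coe_mk, ha]
  have hbound : ∀ x, ‖Λ x‖ ≤ (|C| * Fintype.card B) * ‖𝒯 x‖ := fun x => by
    refine (hΛ x).trans ?_
    have h1 : ∑ b, ∫ a, ‖T b x a‖ ∂ν ≤ Fintype.card B * ‖𝒯 x‖ := by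
      refine (Finset.sum_le_card_nsmul _ _ ‖𝒯 x‖ fun b _ => ?_).trans (by simp)
      rw [hnorm]
      exact norm_le_pi_norm _ b
    have h0 : 0 ≤ ∑ b, ∫ a, ‖T b x a‖ ∂ν :=
      Finset.sum_nonneg fun b _ => integral_nonneg fun a => norm_nonneg _
    calc _ ≤ |C| * ∑ b, ∫ a, ‖T b x a‖ ∂ν := by gcongr; exact le_abs_self C
      _ ≤ |C| * (Fintype.card B * ‖𝒯 x‖) := by gcongr
      _ = _ := by ring
  -- By the bound, Λ depends only on the tuple of classes in L¹, so it descends to a bounded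
  -- functional on the range of `𝒯`.
  have hker : LinearMap.ker 𝒯 ≤ LinearMap.ker Λ := fun x hx => by
    rw [LinearMap.mem_ker] at hx ⊢
    have := hbound x
    rw [hx, norm_zero, mul_zero] at this
    exact norm_le_zero_iff.1 this
  let Λ₁ : LinearMap.range 𝒯 →ₗ[ℂ] ℂ :=
    (LinearMap.ker 𝒯).liftQ Λ hker ∘ₗ (𝒯.quotKerEquivRange.symm : _ →ₗ[ℂ] _)
  have hΛ₁ : ∀ x, Λ₁ ⟨𝒯 x, x, rfl⟩ = Λ x := fun x => by
    have : 𝒯.quotKerEquivRange.symm ⟨𝒯 x, x, rfl⟩ = (LinearMap.ker 𝒯).mkQ x := by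
      rw [LinearEquiv.symm_apply_eq]
      rfl
    simp only [Λ₁, LinearMap.comp_apply, LinearEquiv.coe_coe, this]
    simp
  let Λ₂ : StrongDual ℂ (LinearMap.range 𝒯) := Λ₁.mkContinuous (|C| * Fintype.card B) (by
    rintro ⟨_, x, rfl⟩
    rw [hΛ₁]
    exact hbound x)
  -- Hahn-Banach extends the functional to the full finite product of L¹ spaces, where it is the sum
  -- of its restrictions to the factors; each of these has a bounded density.
  obtain ⟨Λ₃, hΛ₃, -⟩ := exists_extension_norm_eq (LinearMap.range 𝒯) Λ₂
  let ℓ : B → (Lp ℂ 1 ν →L[ℂ] ℂ) := fun b =>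
    Λ₃ ∘L (ContinuousLinearMap.single ℂ (fun _ : B => Lp ℂ 1 ν) b)
  choose H hHm hHb hH using fun b => exists_bounded_density (ℓ b)
  refine ⟨H, ∑ b, ‖ℓ b‖, hHm, fun b a => (hHb b a).trans
    (Finset.single_le_sum (f := fun b => ‖ℓ b‖) (fun _ _ => norm_nonneg _) (Finset.mem_univ b)),
    fun x => ?_⟩
  have h1 : Λ x = Λ₃ (𝒯 x) := by
    rw [← hΛ₁ x]
    exact (hΛ₃ ⟨𝒯 x, x, rfl⟩).symm
  have h2 : 𝒯 x = ∑ b, Pi.single b (𝒯 x b) := (Finset.univ_sum_single _).symm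
  rw [h1, h2, map_sum]
  exact Finset.sum_congr rfl fun b _ => hH b _ (hT b x)

end Duality

/-! ### Integration by parts and Taylor polynomials -/

section IntegrationByParts

variable {m : ℕ} {χ G : Eu m → ℂ}

theorem tsupport_pd_subset (i : Fin m) (χ : Eu m → ℂ) : tsupport (pd i χ) ⊆ tsupport χ := by
  refine closure_minimal (fun x hx => ?_) (isClosed_tsupport χ)
  by_contra h
  have h1 : χ =ᶠ[𝓝 x] fun _ => 0 := notMem_tsupport_iff_eventuallyEq.1 h
  exact hx (by rw [(pd_congr h1 i).self_of_nhds]; simp [pd])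

theorem tsupport_partialDeriv_subset {q : ℕ} (w : Fin q → Fin m) (χ : Eu m → ℂ) :
    tsupport (partialDeriv w χ) ⊆ tsupport χ := by
  refine closure_minimal (fun x hx => ?_) (isClosed_tsupport χ)
  by_contra h
  have h1 : χ =ᶠ[𝓝 x] fun _ => 0 := notMem_tsupport_iff_eventuallyEq.1 h
  exact hx (by rw [partialDeriv_congr w h1, partialDeriv_zero_fun])

theorem contDiff_pd (hχ : ContDiff ℝ ∞ χ) (i : Fin m) : ContDiff ℝ ∞ (pd i χ) :=
  (hχ.fderiv_right (m := ∞) (by simp)).clm_apply contDiff_const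

theorem contDiff_partialDeriv {q : ℕ} (w : Fin q → Fin m) (hχ : ContDiff ℝ ∞ χ) :
    ContDiff ℝ ∞ (partialDeriv w χ) :=
  contDiff_iff_contDiffAt.2 fun _ => ((smoothNear_of_contDiff hχ).partialDeriv w).contDiffAt

theorem integrable_mul_of_tsupport (hχ : Continuous χ) (hc : HasCompactSupport χ)
    (hG : ∀ x ∈ tsupport χ, ContinuousAt G x) : Integrable (fun x => χ x * G x) := by
  have hsub : tsupport (fun x => χ x * G x) ⊆ tsupport χ := tsupport_mul_subset_left
  refine Continuous.integrable_of_hasCompactSupport ?_ (hc.mul_right)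
  exact continuous_of_tsupport fun x hx => hχ.continuousAt.mul (hG x (hsub hx))

theorem integral_pd_mul (hχ : ContDiff ℝ ∞ χ) (hc : HasCompactSupport χ)
    (hG : ∀ x ∈ tsupport χ, SmoothNear G x) (i : Fin m) :
    ∫ x, pd i χ x * G x = -∫ x, χ x * pd i G x := by
  have hc' : HasCompactSupport (pd i χ) := hc.mono' ((subset_tsupport _).trans
    (tsupport_pd_subset i χ))
  have h := integral_mul_fderiv_eq_neg_fderiv_mul_of_integrable (μ := volume) (𝕜 := ℂ)
    (f := G) (g := χ) (v := EuclideanSpace.single i (1 : ℝ)) ?_ ?_ ?_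
    (fun x hx => (hG x hx).contDiffAt.differentiableAt (by simp))
    (fun x _ => hχ.differentiable (by simp) x)
  · simp only [mul_comm (pd i χ _), mul_comm (χ _)]
    exact h
  · simp only [mul_comm _ (χ _)]
    exact integrable_mul_of_tsupport hχ.continuous hc fun x hx =>
      ((hG x hx).pd i).contDiffAt.continuousAt
  · simp only [mul_comm (G _)]
    exact integrable_mul_of_tsupport (contDiff_pd hχ i).continuous hc' fun x hx =>
      (hG x (tsupport_pd_subset i χ hx)).contDiffAt.continuousAt
  · simp only [mul_comm (G _)]
    exact integrable_mul_of_tsupport hχ.continuous hc fun x hx =>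
      (hG x hx).contDiffAt.continuousAt

/-- Only the cut-off function is smooth everywhere; the other factor matters only near its support.
The induction runs over the cut-off function as well, since each step replaces it by a derivative.
-/
theorem integral_partialDeriv_mul {q : ℕ} (w : Fin q → Fin m) : ∀ {χ : Eu m → ℂ},
    ContDiff ℝ ∞ χ → HasCompactSupport χ → (∀ x ∈ tsupport χ, SmoothNear G x) →
    ∫ x, partialDeriv w χ x * G x = (-1) ^ q * ∫ x, χ x * partialDeriv w G x := by
  induction q with
  | zero => intro χ _ _ _; simp [partialDeriv_zero]
  | succ q ih =>
    intro χ hχ hc hG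
    set i := w (Fin.last q)
    have hsub := tsupport_pd_subset i χ
    have h1 := ih (Fin.init w) (contDiff_pd hχ i) (hc.mono' ((subset_tsupport _).trans hsub))
      fun x hx => hG x (hsub hx)
    simp only [partialDeriv_succ_right w (smoothNear_of_contDiff hχ)]
    rw [h1, integral_pd_mul hχ hc (fun x hx => (hG x hx).partialDeriv _) i, pow_succ]
    -- The last letter of the word is innermost but arrives at `G` as the outermost derivative;
    -- partial derivatives commute where `G` is smooth, and elsewhere `χ` vanishes.
    have h2 : ∀ x, χ x * pd i (partialDeriv (Fin.init w) G) x = χ x * partialDeriv w G x := by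
      intro x
      by_cases hx : x ∈ tsupport χ
      · rw [partialDeriv_succ_right w (hG x hx), partialDeriv_pd_comm _ _ (hG x hx)]
      · simp [image_eq_zero_of_notMem_tsupport hx]
    simp only [h2]
    ring

/-- Integration by parts for differential operators. -/
theorem DiffOp.integral_apply_mul {D : DiffOp m} {V : Set (Eu m)} (hV : IsOpen V)
    (hD : D.SmoothOn V) (hχ : ContDiff ℝ ∞ χ) (hc : HasCompactSupport χ) (hχV : tsupport χ ⊆ V)
    (hG : ContDiffOn ℝ ∞ G V) :
    ∫ x, D.apply χ x * G x = ∫ x, χ x * D.transpose G x := by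
  have hGs : ∀ x ∈ tsupport χ, SmoothNear G x := fun x hx =>
    smoothNear_of_contDiffOn hG hV (hχV hx)
  have hDs : ∀ q w, ∀ x ∈ tsupport χ, SmoothNear (fun z => D.coeff q w z * G z) x :=
    fun q w x hx => (smoothNear_of_contDiffOn (hD q w) hV (hχV hx)).mul (hGs x hx)
  have hsub : ∀ {q : ℕ} (w : Fin q → Fin m), HasCompactSupport (partialDeriv w χ) := fun w =>
    hc.mono' ((subset_tsupport _).trans (tsupport_partialDeriv_subset w χ))
  have e1 : ∀ x, D.apply χ x * G x = ∑ q ∈ Finset.range (D.order + 1), ∑ w : Fin q → Fin m,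
      partialDeriv w χ x * (D.coeff q w x * G x) := fun x => by
    simp only [DiffOp.apply, Finset.sum_mul]
    exact Finset.sum_congr rfl fun q _ => Finset.sum_congr rfl fun w _ => by ring
  have e2 : ∀ x, χ x * D.transpose G x = ∑ q ∈ Finset.range (D.order + 1), ∑ w : Fin q → Fin m,
      (-1) ^ q * (χ x * partialDeriv w (fun z => D.coeff q w z * G z) x) := fun x => by
    simp only [DiffOp.transpose, Finset.mul_sum]
    exact Finset.sum_congr rfl fun q _ => Finset.sum_congr rfl fun w _ => by ring
  have i1 : ∀ q (w : Fin q → Fin m),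
      Integrable fun x => partialDeriv w χ x * (D.coeff q w x * G x) := fun q w =>
    integrable_mul_of_tsupport (contDiff_partialDeriv w hχ).continuous (hsub w) fun x hx =>
      (hDs q w x (tsupport_partialDeriv_subset w χ hx)).contDiffAt.continuousAt
  have i2 : ∀ q (w : Fin q → Fin m),
      Integrable fun x => (-1) ^ q * (χ x * partialDeriv w (fun z => D.coeff q w z * G z) x) :=
    fun q w => (integrable_mul_of_tsupport hχ.continuous hc fun x hx =>
      ((hDs q w x hx).partialDeriv w).contDiffAt.continuousAt).const_mul _
  simp only [e1, e2]
  rw [integral_finsetSum _ fun q _ => integrable_finsetSum _ fun w _ => i1 q w,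
    integral_finsetSum _ fun q _ => integrable_finsetSum _ fun w _ => i2 q w]
  refine Finset.sum_congr rfl fun q _ => ?_
  rw [integral_finsetSum _ fun w _ => i1 q w, integral_finsetSum _ fun w _ => i2 q w]
  refine Finset.sum_congr rfl fun w _ => ?_
  rw [integral_partialDeriv_mul w hχ hc (hDs q w), integral_const_mul]

end IntegrationByParts

/-! ### Taylor polynomials and the dependence of differential operators on jets -/

section Jets

variable {m : ℕ} {g : Eu m → ℂ} {y : Eu m}

/-- Iterated partial derivatives along a list of directions. -/
def pdList : List (Fin m) → (Eu m → ℂ) → Eu m → ℂ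
  | [], g => g
  | i :: l, g => pd i (pdList l g)

theorem SmoothNear.pdList (hg : SmoothNear g y) (l : List (Fin m)) :
    SmoothNear (pdList l g) y := by
  induction l with
  | nil => exact hg
  | cons i l ih => exact ih.pd i

theorem partialDeriv_eq_pdList {q : ℕ} (w : Fin q → Fin m) (hg : SmoothNear g y) :
    partialDeriv w g y = pdList (List.ofFn w) g y := by
  induction q generalizing y with
  | zero => simp [partialDeriv_zero, pdList]
  | succ q ih =>
    rw [partialDeriv_succ_left w hg, List.ofFn_succ, pdList]
    have : partialDeriv (Fin.tail w) g =ᶠ[𝓝 y] pdList (List.ofFn (Fin.tail w)) g := by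
      filter_upwards [hg.eventually] with z hz using ih _ hz
    exact (pd_congr this _).self_of_nhds

theorem pdList_perm {l l' : List (Fin m)} (h : l.Perm l') (hg : SmoothNear g y) :
    pdList l g y = pdList l' g y := by
  induction h generalizing y with
  | nil => rfl
  | cons i _ ih =>
    refine (pd_congr ?_ i).self_of_nhds
    filter_upwards [hg.eventually] with z hz using ih hz
  | swap i j l => exact pd_comm (hg.pdList l) j i
  | trans _ _ ih1 ih2 => exact (ih1 hg).trans (ih2 hg)

/-- Iterated partial derivatives of smooth functions do not depend on the order. -/
theorem partialDeriv_comp_perm {q : ℕ} (w : Fin q → Fin m) (σ : Equiv.Perm (Fin q))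
    (hg : SmoothNear g y) : partialDeriv (w ∘ σ) g y = partialDeriv w g y := by
  rw [partialDeriv_eq_pdList _ hg, partialDeriv_eq_pdList _ hg]
  exact pdList_perm (Equiv.Perm.ofFn_comp_perm σ w) hg

/-- The monomial `∏ (y - x)_{w l}`. -/
def wordMonomial {q : ℕ} (w : Fin q → Fin m) (x y : Eu m) : ℂ := ∏ l, ((y (w l) - x (w l) : ℝ) : ℂ)

/-- The Taylor polynomial of degree `d` of `g` at `x`. -/
def taylorPoly (d : ℕ) (g : Eu m → ℂ) (x y : Eu m) : ℂ :=
  ∑ q ∈ Finset.range (d + 1), ∑ w : Fin q → Fin m,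
    ((q.factorial : ℂ)⁻¹ * partialDeriv w g x) * wordMonomial w x y

theorem contDiff_wordMonomial {q : ℕ} (w : Fin q → Fin m) (x : Eu m) :
    ContDiff ℝ ∞ (wordMonomial w x) := by
  refine contDiff_prod fun l _ => Complex.ofRealCLM.contDiff.comp ?_
  exact ((EuclideanSpace.proj (𝕜 := ℝ) (w l)).contDiff).sub contDiff_const

theorem contDiff_taylorPoly (d : ℕ) (g : Eu m → ℂ) (x : Eu m) :
    ContDiff ℝ ∞ (taylorPoly d g x) :=
  ContDiff.sum fun _ _ => ContDiff.sum fun w _ => contDiff_const.mul (contDiff_wordMonomial w x)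

theorem iteratedFDeriv_diag_eq (q : ℕ) (g : Eu m → ℂ) (x v : Eu m) :
    iteratedFDeriv ℝ q g x (fun _ => v) =
      ∑ w : Fin q → Fin m, partialDeriv w g x * ∏ l, ((v (w l) : ℝ) : ℂ) := by
  have hv : (fun _ : Fin q => v) = fun _ => ∑ j, v j • EuclideanSpace.single j (1 : ℝ) := by
    funext l
    conv_lhs => rw [← (EuclideanSpace.basisFun (Fin m) ℝ).sum_repr v]
    simp
  conv_lhs => rw [hv]
  rw [ContinuousMultilinearMap.map_sum]
  refine Finset.sum_congr rfl fun w _ => ?_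
  rw [ContinuousMultilinearMap.map_smul_univ, ← Complex.ofReal_prod, Complex.real_smul, mul_comm]
  rfl

/-- The Taylor polynomial is the sum of a finite power series, whose q-th derivative sums the q-th
coefficient over all permutations of the arguments. Symmetry makes the q! terms equal, which cancels
the factorial. -/
theorem partialDeriv_taylorPoly {d : ℕ} {x : Eu m} (hg : SmoothNear g x) {q : ℕ} (hq : q ≤ d)
    (v : Fin q → Fin m) : partialDeriv v (taylorPoly d g x) x = partialDeriv v g x := by
  let p : FormalMultilinearSeries ℝ (Eu m) ℂ := fun q =>
    if q ≤ d then (q.factorial : ℝ)⁻¹ • iteratedFDeriv ℝ q g x else 0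
  have hp : HasFiniteFPowerSeriesOnBall (taylorPoly d g x) p x (d + 1) ⊤ := by
    refine HasFiniteFPowerSeriesOnBall.mk' (fun n hn => if_neg (by omega)) ENNReal.zero_lt_top ?_
    intro y _
    rw [taylorPoly]
    refine Finset.sum_congr rfl fun q hq => ?_
    have : q ≤ d := by simpa [Nat.lt_succ_iff] using hq
    simp only [p, if_pos this, _root_.smul_apply, iteratedFDeriv_diag_eq,
      Finset.smul_sum]
    refine Finset.sum_congr rfl fun w _ => ?_
    rw [Complex.real_smul]
    simp [wordMonomial]
    ring
  have h1 := hp.toHasFPowerSeriesOnBall.iteratedFDeriv_eq_sum_of_completeSpace (n := q)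
    (fun l => EuclideanSpace.single (v l) (1 : ℝ))
  rw [partialDeriv, h1]
  have h2 : ∀ σ : Equiv.Perm (Fin q),
      p q (fun l => EuclideanSpace.single (v (σ l)) (1 : ℝ)) =
        (q.factorial : ℝ)⁻¹ • partialDeriv v g x := fun σ => by
    rw [← partialDeriv_comp_perm v σ hg]
    simp only [p, if_pos hq]
    rfl
  simp only [h2, Finset.sum_const, Finset.card_univ, Fintype.card_perm, Fintype.card_fin]
  rw [← Nat.cast_smul_eq_nsmul ℝ, smul_smul, mul_inv_cancel₀ (by positivity), one_smul]

/-- The case c = 0 of `Sym.comp_bound`, where all weights are 1, with the bound 0 for the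
derivatives of `g`: a vanishing jet pulls back to a vanishing jet. -/
theorem partialDeriv_comp_eq_zero {κ : Eu m → Eu m} {q : ℕ} (w : Fin q → Fin m)
    (hκ : SmoothNear κ y) (hg : SmoothNear g (κ y))
    (h : ∀ q' ≤ q, ∀ v : Fin q' → Fin m, partialDeriv v g (κ y) = 0) :
    partialDeriv w (fun z => g (κ z)) y = 0 := by
  have hκ' : SmoothNear (fun p : ℝ × Eu m => κ p.2) ((0 : ℝ), y) :=
    SmoothNear.comp (k := κ) hκ (smoothNear_of_contDiff contDiff_snd)
  have h1 : Sym 0 (𝓝 ((0 : ℝ), y)) 0 0 (fun (_ : ℝ) (_ : Eu m) => (1 : ℂ)) :=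
    SmoothNear.sym (smoothNear_const 1)
  obtain ⟨C, -, hC⟩ := Sym.comp_bound (Θ := fun _ : ℝ => κ)
    (SmoothNear.slice (F := fun _ : ℝ => κ) hκ')
    (fun j => by
      have : letterDeg 0 j = 0 := by simp [letterDeg]
      rw [this]
      exact SmoothNear.sym (F := fun (_ : ℝ) z => ((κ z j : ℝ) : ℂ)) (hκ'.coord j)) w h1
  have := hC.self_of_nhds g hg 0 fun q' hq' v => by simp [h q' hq' v]
  simpa [wordDeg_zero] using this

/-- An operator of finite order sees only the jet of that order. This reduces the computation of a
transported operator to its values on monomials. -/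
theorem DiffOp.apply_congr_jet (D : DiffOp m) {κ : Eu m → Eu m} (hκ : SmoothNear κ y)
    (hg : SmoothNear g (κ y)) :
    D.apply (fun z => g (κ z)) y = D.apply (fun z => taylorPoly D.order g (κ y) (κ z)) y := by
  have hT : SmoothNear (taylorPoly D.order g (κ y)) (κ y) :=
    smoothNear_of_contDiff (contDiff_taylorPoly _ _ _)
  refine Finset.sum_congr rfl fun q hq => Finset.sum_congr rfl fun w _ => ?_
  have hq' : q ≤ D.order := by simpa [Nat.lt_succ_iff] using hq
  congr 1
  have hR : SmoothNear (fun x => g x + -1 * taylorPoly D.order g (κ y) x) (κ y) :=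
    hg.add ((smoothNear_const _).mul hT)
  have h0 := partialDeriv_comp_eq_zero w hκ hR fun q' hq'' v => by
    rw [partialDeriv_add v hg ((smoothNear_const _).mul hT), partialDeriv_const_mul v _ hT,
      partialDeriv_taylorPoly hg (hq''.trans hq')]
    ring
  rw [partialDeriv_add w (SmoothNear.comp (k := g) hg hκ) ((smoothNear_const _).mul
    (SmoothNear.comp (k := taylorPoly D.order g (κ y)) hT hκ)),
    partialDeriv_const_mul w _ (SmoothNear.comp (k := taylorPoly D.order g (κ y)) hT hκ)] at h0
  linear_combination h0

theorem DiffOp.apply_sum {ι : Type*} {s : Finset ι} (D : DiffOp m) {f : ι → Eu m → ℂ}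
    (h : ∀ a ∈ s, SmoothNear (f a) y) :
    D.apply (fun z => ∑ a ∈ s, f a z) y = ∑ a ∈ s, D.apply (f a) y := by
  simp only [DiffOp.apply, partialDeriv_sum _ h, Finset.mul_sum]
  rw [Finset.sum_comm]
  simp only [Finset.sum_comm (s := s)]

theorem DiffOp.apply_const_mul (D : DiffOp m) (c : ℂ) (h : SmoothNear g y) :
    D.apply (fun z => c * g z) y = c * D.apply g y := by
  simp only [DiffOp.apply, partialDeriv_const_mul _ c h, Finset.mul_sum]
  exact Finset.sum_congr rfl fun _ _ => Finset.sum_congr rfl fun _ _ => by ring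

end Jets

/-! ### Tangential operators and their transposes in straightening coordinates -/

section Conjugation

variable {m : ℕ}

theorem contDiff_clm_det : ContDiff ℝ ∞ fun A : Eu m →L[ℝ] Eu m => A.det := by
  have h : (fun A : Eu m →L[ℝ] Eu m => A.det) = fun A => ∑ σ : Equiv.Perm (Fin m),
      (Equiv.Perm.sign σ : ℝ) * ∏ i, A (EuclideanSpace.single i (1 : ℝ)) (σ i) := by
    funext A
    rw [ContinuousLinearMap.det,
      ← LinearMap.det_toMatrix (EuclideanSpace.basisFun (Fin m) ℝ).toBasis, Matrix.det_apply']
    refine Finset.sum_congr rfl fun σ _ => ?_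
    simp [LinearMap.toMatrix_apply]
  rw [h]
  refine ContDiff.sum fun σ _ => contDiff_const.mul (contDiff_prod fun i _ => ?_)
  exact (EuclideanSpace.proj (𝕜 := ℝ) (σ i)).contDiff.comp
    (ContinuousLinearMap.apply ℝ (Eu m) (EuclideanSpace.single i (1 : ℝ))).contDiff

theorem contDiffAt_abs_det {F : Type*} [NormedAddCommGroup F] [NormedSpace ℝ F]
    {A : F → Eu m →L[ℝ] Eu m} {x : F} (hA : ContDiffAt ℝ ∞ A x) (h0 : (A x).det ≠ 0) :
    ContDiffAt ℝ ∞ (fun z => ((|(A z).det| : ℝ) : ℂ)) x :=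
  Complex.ofRealCLM.contDiff.contDiffAt.comp x
    (ContDiffAt.comp (g := fun t : ℝ => |t|) x (contDiffAt_abs h0)
      (contDiff_clm_det.contDiffAt.comp x hA))

variable {κ : OpenPartialHomeomorph (Eu m) (Eu m)}

theorem det_fderiv_ne_zero (hκ : ContDiffOn ℝ ∞ κ κ.source) (hκ' : ContDiffOn ℝ ∞ κ.symm κ.target)
    {y : Eu m} (hy : y ∈ κ.source) : (fderiv ℝ κ y).det ≠ 0 := by
  have h1 : HasFDerivAt κ (fderiv ℝ κ y) y :=
    ((hκ.contDiffAt (κ.open_source.mem_nhds hy)).differentiableAt (by simp)).hasFDerivAt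
  have h2 : HasFDerivAt κ.symm (fderiv ℝ κ.symm (κ y)) (κ y) :=
    ((hκ'.contDiffAt (κ.open_target.mem_nhds (κ.map_source hy))).differentiableAt
      (by simp)).hasFDerivAt
  have h3 := (h2.comp y h1).congr_of_eventuallyEq (f₁ := id) (by
    filter_upwards [κ.open_source.mem_nhds hy] with z hz using (κ.left_inv hz).symm)
  have h4 := h3.unique (hasFDerivAt_id y)
  have h5 : (fderiv ℝ κ.symm (κ y)).det * (fderiv ℝ κ y).det = 1 := by
    rw [ContinuousLinearMap.det, ContinuousLinearMap.det, ← LinearMap.det_comp,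
      ← ContinuousLinearMap.toLinearMap_comp, h4]
    simp
  exact right_ne_zero_of_mul_eq_one h5

/-- The absolute value of the Jacobian determinant. -/
def jac (κ : Eu m → Eu m) (y : Eu m) : ℝ := |(fderiv ℝ κ y).det|

theorem contDiffOn_jac (hκ : ContDiffOn ℝ ∞ κ κ.source) (hκ' : ContDiffOn ℝ ∞ κ.symm κ.target) :
    ContDiffOn ℝ ∞ (fun y => (jac κ y : ℂ)) κ.source := fun y hy =>
  (contDiffAt_abs_det ((hκ.contDiffAt (κ.open_source.mem_nhds hy)).fderiv_right (by simp))
    (det_fderiv_ne_zero hκ hκ' hy)).contDiffWithinAt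

theorem setIntegral_comp_mul_jac (hκ : ContDiffOn ℝ ∞ κ κ.source) (g : Eu m → ℂ) :
    ∫ y in κ.source, (jac κ y : ℂ) * g (κ y) = ∫ x in κ.target, g x := by
  rw [← κ.image_source_eq_target, integral_image_eq_integral_abs_det_fderiv_smul volume
    κ.open_source.measurableSet (f' := fderiv ℝ κ) (fun y hy =>
      ((hκ.contDiffAt (κ.open_source.mem_nhds hy)).differentiableAt
        (by simp)).hasFDerivAt.hasFDerivWithinAt) κ.injOn]
  rfl

/-- The operator `f D`, transported to the target of the diffeomorphism `κ`. -/
def DiffOp.conj (D : DiffOp m) (κ : OpenPartialHomeomorph (Eu m) (Eu m)) (f : Eu m → ℂ) :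
    DiffOp m where
  order := D.order
  coeff q w x := f (κ.symm x) *
    ((q.factorial : ℂ)⁻¹ * D.apply (fun y => wordMonomial w x (κ y)) (κ.symm x))

/-- Replacing g by its Taylor polynomial at κ y and using linearity, the coefficient of ∂_w g(κ y)
is D applied to the monomial centred at κ y. The factor 1/q! compensates for summing over ordered
words. -/
theorem DiffOp.conj_apply (D : DiffOp m) (hκ : ContDiffOn ℝ ∞ κ κ.source) (f : Eu m → ℂ)
    {g : Eu m → ℂ} (hg : ContDiffOn ℝ ∞ g κ.target) {y : Eu m} (hy : y ∈ κ.source) :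
    (D.conj κ f).apply g (κ y) = f y * D.apply (fun z => g (κ z)) y := by
  have hκy : SmoothNear κ y := smoothNear_of_contDiffOn hκ κ.open_source hy
  have hgy : SmoothNear g (κ y) :=
    smoothNear_of_contDiffOn hg κ.open_target (κ.map_source hy)
  have hm : ∀ {q : ℕ} (w : Fin q → Fin m) (x : Eu m),
      SmoothNear (fun z => wordMonomial w x (κ z)) y := fun w x =>
    SmoothNear.comp (k := wordMonomial w x)
      (smoothNear_of_contDiff (contDiff_wordMonomial w x)) hκy
  rw [D.apply_congr_jet hκy hgy]
  have e : D.apply (fun z => taylorPoly D.order g (κ y) (κ z)) y =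
      ∑ q ∈ Finset.range (D.order + 1), ∑ w : Fin q → Fin m,
        ((q.factorial : ℂ)⁻¹ * partialDeriv w g (κ y)) *
          D.apply (fun z => wordMonomial w (κ y) (κ z)) y := by
    simp only [taylorPoly]
    rw [D.apply_sum fun q _ => SmoothNear.sum fun w _ => (smoothNear_const _).mul (hm w _)]
    refine Finset.sum_congr rfl fun q _ => ?_
    rw [D.apply_sum fun w _ => (smoothNear_const _).mul (hm w _)]
    exact Finset.sum_congr rfl fun w _ => D.apply_const_mul _ (hm _ _)
  rw [e, Finset.mul_sum, DiffOp.apply]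
  refine Finset.sum_congr rfl fun q _ => ?_
  rw [Finset.mul_sum]
  refine Finset.sum_congr rfl fun w _ => ?_
  simp only [DiffOp.conj, κ.left_inv hy]
  ring

variable {D : DiffOp m} {Z' : Set (Eu m)} {c k : ℕ} {f : Eu m → ℂ}

/-- The centred monomial ∏ (κ_{w l} - x_{w l}) is expanded over the subsets A of its factors. The
factors in A form a function in the ideal power deg A, where D leaves it because D is tangential;
the constants -x_{w l} outside A contribute the remaining powers once x varies. So D supplies deg w
powers and f supplies `k`. -/
theorem DiffOp.conj_coeff_mem (hκ : ContDiffOn ℝ ∞ κ κ.source)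
    (hκ' : ContDiffOn ℝ ∞ κ.symm κ.target) (hZ' : ∀ y ∈ κ.source, y ∈ Z' ↔ nrm c (κ y) = 0)
    (hD : D.TangentialOn Z' κ.source) (hf : MemIdealPow Z' k κ.source f)
    (q : ℕ) (w : Fin q → Fin m) :
    MemIdealPow {x | nrm c x = 0} (k + wordDeg c w) κ.target ((D.conj κ f).coeff q w) := by
  have hcomp : ∀ {k : ℕ} {g : Eu m → ℂ}, MemIdealPow Z' k κ.source g →
      MemIdealPow {x | nrm c x = 0} k κ.target (fun x => g (κ.symm x)) := fun h =>
    h.comp κ.open_target hκ' κ.mapsTo_symm fun x hx hx0 =>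
      (hZ' _ (κ.map_target hx)).2 (by rwa [κ.right_inv hx])
  have hcoord : ∀ i : Fin m, MemIdealPow Z' (letterDeg c i) κ.source
      (fun y => ((κ y i : ℝ) : ℂ)) := by
    intro i
    have hs : ContDiffOn ℝ ∞ (fun y => ((κ y i : ℝ) : ℂ)) κ.source :=
      (Complex.ofRealCLM ∘L EuclideanSpace.proj (𝕜 := ℝ) i).contDiff.comp_contDiffOn hκ
    by_cases hi : i.1 < c
    · rw [letterDeg, if_pos hi]
      refine memIdealPow_one κ.open_source hs fun y hy => ?_
      simp [nrm_eq_zero_iff.1 ((hZ' y hy.1).1 hy.2) i hi]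
    · rw [letterDeg, if_neg hi]
      exact memIdealPow_zero κ.open_source hs
  have hlin : ∀ i : Fin m, MemIdealPow {x | nrm c x = 0} (letterDeg c i) κ.target
      (fun x => ((-x i : ℝ) : ℂ)) := by
    intro i
    have hs : ContDiffOn ℝ ∞ (fun x : Eu m => ((-x i : ℝ) : ℂ)) κ.target :=
      (Complex.ofRealCLM ∘L (-EuclideanSpace.proj (𝕜 := ℝ) i)).contDiff.contDiffOn
    by_cases hi : i.1 < c
    · rw [letterDeg, if_pos hi]
      refine memIdealPow_one κ.open_target hs fun x hx => ?_
      simp [nrm_eq_zero_iff.1 hx.2 i hi]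
    · rw [letterDeg, if_neg hi]
      exact memIdealPow_zero κ.open_target hs
  refine (hcomp hf).mul ?_
  rw [← zero_add (wordDeg c w)]
  refine (memIdealPow_zero κ.open_target contDiffOn_const).mul ?_
  have hA : ∀ A : Finset (Fin q), MemIdealPow Z' (∑ l ∈ A, letterDeg c (w l)) κ.source
      (fun y => ∏ l ∈ A, ((κ y (w l) : ℝ) : ℂ)) := fun A =>
    MemIdealPow.prod κ.open_source fun l _ => hcoord (w l)
  have hexp : ∀ x ∈ κ.target, D.apply (fun y => wordMonomial w x (κ y)) (κ.symm x) =
      ∑ A ∈ (Finset.univ : Finset (Fin q)).powerset, (∏ l ∈ Finset.univ \ A, ((-x (w l) : ℝ) : ℂ)) *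
        D.apply (fun y => ∏ l ∈ A, ((κ y (w l) : ℝ) : ℂ)) (κ.symm x) := by
    intro x hx
    have hs : ∀ A : Finset (Fin q), SmoothNear (fun y => ∏ l ∈ A, ((κ y (w l) : ℝ) : ℂ))
        (κ.symm x) := fun A =>
      smoothNear_of_contDiffOn (hA A).1 κ.open_source (κ.map_target hx)
    have h1 : (fun y => wordMonomial w x (κ y)) = fun y =>
        ∑ A ∈ (Finset.univ : Finset (Fin q)).powerset,
          (∏ l ∈ Finset.univ \ A, ((-x (w l) : ℝ) : ℂ)) * ∏ l ∈ A, ((κ y (w l) : ℝ) : ℂ) := by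
      funext y
      have := Finset.prod_add (fun l => ((κ y (w l) : ℝ) : ℂ)) (fun l => ((-x (w l) : ℝ) : ℂ))
        Finset.univ
      simp only [wordMonomial, sub_eq_add_neg, Complex.ofReal_add, this]
      exact Finset.sum_congr rfl fun A _ => mul_comm _ _
    rw [h1, D.apply_sum fun A _ => (smoothNear_const _).mul (hs A)]
    exact Finset.sum_congr rfl fun A _ => D.apply_const_mul _ (hs A)
  refine MemIdealPow.congr (MemIdealPow.sum κ.open_target fun A _ => ?_) hexp
  have h1 : MemIdealPow {x | nrm c x = 0} (∑ l ∈ Finset.univ \ A, letterDeg c (w l)) κ.target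
      (fun x => ∏ l ∈ Finset.univ \ A, ((-x (w l) : ℝ) : ℂ)) :=
    MemIdealPow.prod κ.open_target fun l _ => hlin (w l)
  have h2 := hcomp (hD _ _ κ.open_source subset_rfl _ (hA A))
  have h3 := h1.mul h2
  rwa [Finset.sum_sdiff (Finset.subset_univ A)] at h3

theorem DiffOp.contDiffOn_transpose {D : DiffOp m} {V : Set (Eu m)} (hV : IsOpen V)
    (hD : D.SmoothOn V) {G : Eu m → ℂ} (hG : ContDiffOn ℝ ∞ G V) :
    ContDiffOn ℝ ∞ (D.transpose G) V := by
  refine ContDiffOn.sum fun q _ => ContDiffOn.sum fun w _ => contDiffOn_const.mul ?_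
  intro y hy
  exact ((smoothNear_of_contDiffOn ((hD q w).mul hG) hV hy).partialDeriv w).contDiffAt.contDiffWithinAt

theorem DiffOp.apply_eq_zero_of_notMem_tsupport (D : DiffOp m) {χ : Eu m → ℂ} {y : Eu m}
    (hy : y ∉ tsupport χ) : D.apply χ y = 0 := by
  refine Finset.sum_eq_zero fun q _ => Finset.sum_eq_zero fun w _ => ?_
  rw [image_eq_zero_of_notMem_tsupport fun h => hy (tsupport_partialDeriv_subset w χ h), mul_zero]

theorem DiffOp.apply_congr (D : DiffOp m) {g g' : Eu m → ℂ} {y : Eu m} (h : g =ᶠ[𝓝 y] g') :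
    D.apply g y = D.apply g' y := by
  simp only [DiffOp.apply, partialDeriv_congr _ h]

theorem DiffOp.transpose_congr (D : DiffOp m) {g g' : Eu m → ℂ} {y : Eu m} (h : g =ᶠ[𝓝 y] g') :
    D.transpose g y = D.transpose g' y := by
  have : ∀ q (w : Fin q → Fin m), (fun z => D.coeff q w z * g z) =ᶠ[𝓝 y]
      fun z => D.coeff q w z * g' z := fun q w => by
    filter_upwards [h] with z hz
    rw [hz]
  simp only [DiffOp.transpose, partialDeriv_congr _ (this _ _)]

/-- The transpose under a change of coordinates. -/
theorem DiffOp.transpose_conj (hκ : ContDiffOn ℝ ∞ κ κ.source)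
    (hκ' : ContDiffOn ℝ ∞ κ.symm κ.target) (hD : D.SmoothOn κ.source)
    (hf : ContDiffOn ℝ ∞ f κ.source) (hP : (D.conj κ f).SmoothOn κ.target)
    {g : Eu m → ℂ} (hg : ContDiffOn ℝ ∞ g κ.target) :
    ∀ᵐ y : Eu m, y ∈ κ.source → D.transpose (fun z => f z * ((jac κ z : ℂ) * g (κ z))) y =
      (jac κ y : ℂ) * (D.conj κ f).transpose g (κ y) := by
  set P := D.conj κ f
  set F : Eu m → ℂ := fun z => f z * ((jac κ z : ℂ) * g (κ z))
  have hJ := contDiffOn_jac hκ hκ'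
  have hF : ContDiffOn ℝ ∞ F κ.source := hf.mul (hJ.mul (hg.comp hκ κ.mapsTo))
  have hPg := DiffOp.contDiffOn_transpose κ.open_target hP hg
  have hDF := DiffOp.contDiffOn_transpose κ.open_source hD hF
  have hcont : ContinuousOn (fun y => D.transpose F y - (jac κ y : ℂ) * P.transpose g (κ y))
      κ.source :=
    hDF.continuousOn.sub (hJ.continuousOn.mul (hPg.continuousOn.comp hκ.continuousOn κ.mapsTo))
  -- The two sides are compared weakly. Against a test function `χ`, integration by parts and the
  -- change of variables turn both integrals into the integral of the transported operator applied
  -- to `χ` ∘ κ⁻¹, multiplied by g.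
  have key := IsOpen.ae_eq_zero_of_integral_contDiff_smul_eq_zero (μ := volume) κ.open_source
    (hcont.locallyIntegrableOn κ.open_source.measurableSet) ?_
  · filter_upwards [key] with y hy hys using sub_eq_zero.1 (hy hys)
  intro χ₀ hχ₀ hc₀ hsub₀
  let χ : Eu m → ℂ := fun y => (χ₀ y : ℂ)
  have hχ : ContDiff ℝ ∞ χ := Complex.ofRealCLM.contDiff.comp hχ₀
  have hts : tsupport χ ⊆ tsupport χ₀ := closure_mono fun y hy h => hy (by simp [χ, h])
  have hc : HasCompactSupport χ := hc₀.mono' ((subset_tsupport _).trans hts)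
  have hsub : tsupport χ ⊆ κ.source := hts.trans hsub₀
  -- the test function in the other coordinates
  let K : Set (Eu m) := κ '' tsupport χ
  have hK : IsCompact K := hc.isCompact.image_of_continuousOn (κ.continuousOn.mono hsub)
  have hKV : K ⊆ κ.target := by
    rintro _ ⟨y, hy, rfl⟩
    exact κ.map_source (hsub hy)
  let ψ : Eu m → ℂ := κ.target.indicator fun x => χ (κ.symm x)
  have hψ0 : ∀ x ∉ K, ψ x = 0 := fun x hx => by
    by_cases hxt : x ∈ κ.target
    · simp only [ψ, indicator_of_mem hxt]
      by_contra h
      exact hx ⟨κ.symm x, subset_tsupport _ h, κ.right_inv hxt⟩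
    · exact indicator_of_notMem hxt _
  have hψc : HasCompactSupport ψ := HasCompactSupport.intro hK hψ0
  have hψK : tsupport ψ ⊆ K := closure_minimal
    (fun x hx => by by_contra h; exact hx (hψ0 x h)) hK.isClosed
  have hψs : ContDiff ℝ ∞ ψ := by
    refine contDiff_iff_contDiffAt.2 fun x => ?_
    by_cases hx : x ∈ κ.target
    · refine ((hχ.contDiffAt (x := κ.symm x)).comp x
        (hκ'.contDiffAt (κ.open_target.mem_nhds hx))).congr_of_eventuallyEq ?_
      filter_upwards [κ.open_target.mem_nhds hx] with z hz
      simp [ψ, indicator_of_mem hz]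
    · refine (contDiffAt_const (c := (0 : ℂ))).congr_of_eventuallyEq ?_
      filter_upwards [hK.isClosed.isOpen_compl.mem_nhds fun h => hx (hKV h)] with z hz
        using hψ0 z hz
  have hψχ : ∀ y ∈ κ.source, ψ (κ y) = χ y := fun y hy => by
    simp only [ψ, indicator_of_mem (κ.map_source hy), κ.left_inv hy]
  have hout : ∀ y ∉ κ.source, χ y = 0 := fun y hy =>
    image_eq_zero_of_notMem_tsupport fun h => hy (hsub h)
  have i1 : Integrable fun y => χ y * D.transpose F y :=
    integrable_mul_of_tsupport hχ.continuous hc fun y hy =>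
      hDF.continuousOn.continuousAt (κ.open_source.mem_nhds (hsub hy))
  have i2 : Integrable fun y => χ y * ((jac κ y : ℂ) * P.transpose g (κ y)) :=
    integrable_mul_of_tsupport hχ.continuous hc fun y hy =>
      (hJ.continuousOn.mul (hPg.continuousOn.comp hκ.continuousOn κ.mapsTo)).continuousAt
        (κ.open_source.mem_nhds (hsub hy))
  have e1 : ∫ y, χ y * D.transpose F y = ∫ x in κ.target, P.apply ψ x * g x := by
    rw [← DiffOp.integral_apply_mul κ.open_source hD hχ hc hsub hF,
      ← setIntegral_comp_mul_jac hκ (fun x => P.apply ψ x * g x),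
      ← setIntegral_eq_integral_of_forall_compl_eq_zero (s := κ.source)]
    · refine setIntegral_congr_fun κ.open_source.measurableSet fun y hy => ?_
      have h1 := D.conj_apply hκ f (hψs.contDiffOn (s := κ.target)) hy
      have h2 : (fun z => ψ (κ z)) =ᶠ[𝓝 y] χ := by
        filter_upwards [κ.open_source.mem_nhds hy] with z hz using hψχ z hz
      rw [D.apply_congr h2] at h1
      simp only [F]
      rw [h1]
      ring
    · intro y hy
      rw [D.apply_eq_zero_of_notMem_tsupport fun h => hy (hsub h), zero_mul]
  have e2 : ∫ y, χ y * ((jac κ y : ℂ) * P.transpose g (κ y)) =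
      ∫ x in κ.target, P.apply ψ x * g x := by
    have h1 : ∫ x in κ.target, P.apply ψ x * g x = ∫ x, P.apply ψ x * g x :=
      setIntegral_eq_integral_of_forall_compl_eq_zero fun x hx => by
        rw [P.apply_eq_zero_of_notMem_tsupport fun h => hx (hKV (hψK h)), zero_mul]
    have h2 : ∫ x in κ.target, ψ x * P.transpose g x = ∫ x, ψ x * P.transpose g x :=
      setIntegral_eq_integral_of_forall_compl_eq_zero fun x hx => by
        rw [hψ0 x fun h => hx (hKV h), zero_mul]
    rw [h1, DiffOp.integral_apply_mul κ.open_target hP hψs hψc (hψK.trans hKV) hg, ← h2,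
      ← setIntegral_comp_mul_jac hκ, ← setIntegral_eq_integral_of_forall_compl_eq_zero
        (s := κ.source)]
    · refine setIntegral_congr_fun κ.open_source.measurableSet fun y hy => ?_
      simp only [hψχ y hy]
      ring
    · intro y hy
      rw [hout y hy, zero_mul]
  have e3 : ∀ y, χ₀ y • (D.transpose F y - (jac κ y : ℂ) * P.transpose g (κ y)) =
      χ y * D.transpose F y - χ y * ((jac κ y : ℂ) * P.transpose g (κ y)) := fun y => by
    rw [Complex.real_smul, mul_sub]
  simp only [e3]
  rw [integral_sub i1 i2, e1, e2, sub_self]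

/-- Weighted pointwise bound for the transpose of an operator with coefficients in the appropriate
powers of the ideal. -/
theorem DiffOp.transpose_bound {P : DiffOp m} {V : Set (Eu m)}
    (hP : ∀ q w, MemIdealPow {x | nrm c x = 0} (k + wordDeg c w) V (P.coeff q w))
    {x₀ : Eu m} (hx₀ : x₀ ∈ V) :
    ∃ C : ℝ, 0 ≤ C ∧ ∀ᶠ x in 𝓝 x₀, ∀ g : Eu m → ℂ, SmoothNear g x → (nrm c x = 0 → c = 0) →
      ∀ B : ℝ, (∀ q' ≤ P.order, ∀ v : Fin q' → Fin m,
        nrm c x ^ (k + wordDeg c v) * ‖partialDeriv v g x‖ ≤ B) →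
      ‖P.transpose g x‖ ≤ C * B := by
  have hid : SmoothNear (fun p : ℝ × Eu m => p.2) ((0 : ℝ), x₀) :=
    smoothNear_of_contDiff contDiff_snd
  have hΘ : ∀ j : Fin m, Sym c (𝓝 ((0 : ℝ), x₀)) 0 (letterDeg c j)
      (fun (_ : ℝ) y => ((y j : ℝ) : ℂ)) := fun j => by
    by_cases hj : j.1 < c
    · rw [letterDeg, if_pos hj]
      refine SmoothNear.sym_one (F := fun (_ : ℝ) (y : Eu m) => ((y j : ℝ) : ℂ)) (hid.coord j)
        (Eventually.of_forall fun p hp => ?_)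
      simp [nrm_eq_zero_iff.1 hp j hj]
    · rw [letterDeg, if_neg hj]
      exact SmoothNear.sym (F := fun (_ : ℝ) (y : Eu m) => ((y j : ℝ) : ℂ)) (hid.coord j)
  have hterm : ∀ q (w : Fin q → Fin m), ∃ C : ℝ, 0 ≤ C ∧ ∀ᶠ x in 𝓝 x₀, ∀ g : Eu m → ℂ,
      SmoothNear g x → (nrm c x = 0 → c = 0) → ∀ B : ℝ, (∀ q' ≤ q, ∀ v : Fin q' → Fin m,
        nrm c x ^ (k + wordDeg c v) * ‖partialDeriv v g x‖ ≤ B) →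
      ‖partialDeriv w (fun z => P.coeff q w z * g z) x‖ ≤ C * B := by
    intro q w
    obtain ⟨C, hC, hb⟩ := Sym.comp_bound (Θ := fun (_ : ℝ) (y : Eu m) => y)
      (Eventually.of_forall fun p => smoothNear_of_contDiff contDiff_id) hΘ w
      ((hP q w).sym (p₀ := ((0 : ℝ), x₀)) hx₀ fun y _ hy => hy)
    have hin : Tendsto (fun x : Eu m => ((0 : ℝ), x)) (𝓝 x₀) (𝓝 ((0 : ℝ), x₀)) :=
      Continuous.tendsto (by fun_prop) x₀
    refine ⟨C, hC, ?_⟩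
    filter_upwards [hin.eventually hb] with x hx g hg hc B hB
    have hn := nrm_nonneg c x
    -- The coefficient lies in the class with s = k + deg w, which asks for deg w more powers of
    -- `nrm` than the hypothesis on `g` contains. They are put into the bound and cancelled at the
    -- end against the weight of the derivative ∂_w.
    have h1 := hx g hg (nrm c x ^ wordDeg c w * B) fun q' hq' v => by
      have := hB q' hq' v
      calc _ = nrm c x ^ wordDeg c w * (nrm c x ^ (k + wordDeg c v) * ‖partialDeriv v g x‖) := by
            ring
        _ ≤ _ := by gcongr
    simp only [zero_add] at h1
    -- Off the subspace `nrm` is positive; if c = 0 there are no normal letters and the power is 0^0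
    -- = 1.
    have hpos : 0 < nrm c x ^ wordDeg c w := by
      rcases hn.eq_or_lt with h | h
      · have : c = 0 := hc h.symm
        subst this
        simp [wordDeg_zero]
      · positivity
    refine le_of_mul_le_mul_left (h1.trans (le_of_eq ?_)) hpos
    ring
  choose C hC hb using hterm
  refine ⟨∑ q ∈ Finset.range (P.order + 1), ∑ w : Fin q → Fin m, C q w,
    Finset.sum_nonneg fun q _ => Finset.sum_nonneg fun w _ => hC q w, ?_⟩
  have hev : ∀ᶠ x in 𝓝 x₀, ∀ q ∈ Finset.range (P.order + 1), ∀ w : Fin q → Fin m,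
      ∀ g : Eu m → ℂ, SmoothNear g x → (nrm c x = 0 → c = 0) → ∀ B : ℝ,
      (∀ q' ≤ q, ∀ v : Fin q' → Fin m,
        nrm c x ^ (k + wordDeg c v) * ‖partialDeriv v g x‖ ≤ B) →
      ‖partialDeriv w (fun z => P.coeff q w z * g z) x‖ ≤ C q w * B :=
    (Finset.eventually_all _).2 fun q _ => eventually_all.2 fun w => hb q w
  filter_upwards [hev] with x hx g hg hc B hB
  rw [DiffOp.transpose, Finset.sum_mul]
  refine (norm_sum_le _ _).trans (Finset.sum_le_sum fun q hq => ?_)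
  rw [Finset.sum_mul]
  refine (norm_sum_le _ _).trans (Finset.sum_le_sum fun w _ => ?_)
  rw [norm_mul, norm_pow, norm_neg, norm_one, one_pow, one_mul]
  have hq' : q ≤ P.order := by simpa [Nat.lt_succ_iff] using hq
  exact hx q hq w g hg hc B fun q' hq'' v => hB q' (hq''.trans hq') v

/-- A proper linear subspace is a null set. The condition c ≤ m guarantees that a normal coordinate
exists when c > 0. -/
theorem ae_nrm_eq_zero_imp {c : ℕ} (hcm : c ≤ m) : ∀ᵐ x : Eu m, nrm c x = 0 → c = 0 := by
  by_cases h : c = 0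
  · exact Eventually.of_forall fun _ _ => h
  have hc : 0 < c := Nat.pos_of_ne_zero h
  let i : Fin m := ⟨0, hc.trans_le hcm⟩
  let S : Submodule ℝ (Eu m) := LinearMap.ker (EuclideanSpace.proj (𝕜 := ℝ) i).toLinearMap
  have hS : S ≠ ⊤ := fun h => by
    have h1 : EuclideanSpace.single i (1 : ℝ) ∈ S := h ▸ Submodule.mem_top
    have h2 : EuclideanSpace.single i (1 : ℝ) i = 0 := h1
    simp at h2
  have h0 := Measure.addHaar_submodule (volume : Measure (Eu m)) S hS
  have h1 : ∀ᵐ x : Eu m, x ∉ S := measure_eq_zero_iff_ae_notMem.1 h0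
  filter_upwards [h1] with x hx hn
  exact absurd (nrm_eq_zero_iff.1 hn i hc) hx

end Conjugation

/-! ### Components of densities under changes of coordinates and under the action -/

theorem det_ne_zero_of_comp_eq_id {m : ℕ} {A B : Eu m →L[ℝ] Eu m}
    (h : A ∘L B = ContinuousLinearMap.id ℝ (Eu m)) : B.det ≠ 0 := by
  have h5 : A.det * B.det = 1 := by
    rw [ContinuousLinearMap.det, ContinuousLinearMap.det, ← LinearMap.det_comp,
      ← ContinuousLinearMap.toLinearMap_comp, h]
    simp
  exact right_ne_zero_of_mul_eq_one h5

section Charts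

variable {m r : ℕ} {M : Type*} [TopologicalSpace M] [ChartedSpace (EuclideanSpace ℝ (Fin m)) M]
  [IsManifold (𝓡 m) ∞ M]

theorem contDiffOn_transition {e₁ e₂ : OpenPartialHomeomorph M (Eu m)}
    (h₁ : e₁ ∈ IsManifold.maximalAtlas (𝓡 m) ∞ M) (h₂ : e₂ ∈ IsManifold.maximalAtlas (𝓡 m) ∞ M) :
    ContDiffOn ℝ ∞ (e₁.symm.trans e₂) (e₁.symm.trans e₂).source := by
  rw [← contMDiffOn_iff_contDiffOn]
  refine (contMDiffOn_of_mem_maximalAtlas h₂).comp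
    ((contMDiffOn_symm_of_mem_maximalAtlas h₁).mono ?_) ?_
  · intro y hy
    simp only [mfld_simps] at hy
    exact hy.1
  · intro y hy
    simp only [mfld_simps] at hy
    exact hy.2

theorem contDiffOn_transition_symm {e₁ e₂ : OpenPartialHomeomorph M (Eu m)}
    (h₁ : e₁ ∈ IsManifold.maximalAtlas (𝓡 m) ∞ M) (h₂ : e₂ ∈ IsManifold.maximalAtlas (𝓡 m) ∞ M) :
    ContDiffOn ℝ ∞ (e₁.symm.trans e₂).symm (e₁.symm.trans e₂).target := by
  have h := contDiffOn_transition h₂ h₁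
  have e : (e₁.symm.trans e₂).symm = e₂.symm.trans e₁ := by
    rw [OpenPartialHomeomorph.trans_symm_eq_symm_trans_symm, OpenPartialHomeomorph.symm_symm]
  have e' : (e₁.symm.trans e₂).target = (e₂.symm.trans e₁).source := by
    rw [← e, OpenPartialHomeomorph.symm_source]
  rw [e, e']
  exact h

variable {E : M → Type*} [∀ x, AddCommGroup (E x)] [∀ x, Module ℂ (E x)]
  [∀ x, TopologicalSpace (E x)] [TopologicalSpace (TotalSpace (Fin r → ℂ) E)]

/-- The value of a field on a tuple of tangent vectors and an element of the local frame. -/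
def frameEval (φ : DualField E m) (t : Trivialization (Fin r → ℂ) (π (Fin r → ℂ) E))
    (i : Fin r) (x : M) (v : Fin m → Eu m) : ℂ :=
  φ x v (t.symm x (Pi.single i 1))

/-- The density law concerns endomorphisms of the tangent space. The tuple T(A e_l) is the image of
the tuple T e_l under the conjugate T A T⁻¹, which has the determinant of A. -/
theorem frameEval_clm {φ : DualField E m}
    (hφ : ∀ x (A : TangentSpace (𝓡 m) x →ₗ[ℝ] TangentSpace (𝓡 m) x) v,
      φ x (fun i => A (v i)) = ((|LinearMap.det A| : ℝ) : ℂ) • φ x v)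
    (t : Trivialization (Fin r → ℂ) (π (Fin r → ℂ) E)) (i : Fin r) (x : M)
    (T A : Eu m →L[ℝ] Eu m) (hT : T.det ≠ 0) :
    frameEval φ t i x (fun l => T (A (EuclideanSpace.single l 1))) =
      ((|A.det| : ℝ) : ℂ) * frameEval φ t i x (fun l => T (EuclideanSpace.single l 1)) := by
  let T' : Eu m ≃ₗ[ℝ] Eu m := LinearEquiv.ofIsUnitDet (f := (T : Eu m →ₗ[ℝ] Eu m))
    (v := (EuclideanSpace.basisFun (Fin m) ℝ).toBasis)
    (v' := (EuclideanSpace.basisFun (Fin m) ℝ).toBasis) (by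
      rw [LinearMap.det_toMatrix]
      exact isUnit_iff_ne_zero.2 hT)
  have hT' : ∀ z, T' z = T z := fun z => rfl
  have hdet : LinearMap.det (M := TangentSpace (𝓡 m) x) ((T' : Eu m →ₗ[ℝ] Eu m) ∘ₗ
      (A : Eu m →ₗ[ℝ] Eu m) ∘ₗ (T'.symm : Eu m →ₗ[ℝ] Eu m)) = A.det :=
    LinearMap.det_conj (A : Eu m →ₗ[ℝ] Eu m) T'
  have key : φ x (fun l => ((T' : Eu m →ₗ[ℝ] Eu m) ∘ₗ (A : Eu m →ₗ[ℝ] Eu m) ∘ₗ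
      (T'.symm : Eu m →ₗ[ℝ] Eu m)) (T (EuclideanSpace.single l 1))) =
      ((|A.det| : ℝ) : ℂ) • φ x (fun l => T (EuclideanSpace.single l 1)) := by
    rw [← hdet]
    exact hφ x _ _
  have h2 := congrArg (fun ℓ : Module.Dual ℂ (E x) => ℓ (t.symm x (Pi.single i 1))) key
  have h3 : (fun l => ((T' : Eu m →ₗ[ℝ] Eu m) ∘ₗ (A : Eu m →ₗ[ℝ] Eu m) ∘ₗ
      (T'.symm : Eu m →ₗ[ℝ] Eu m)) (T (EuclideanSpace.single l 1))) =
      fun l => T (A (EuclideanSpace.single l 1)) := by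
    funext l
    simp only [LinearMap.comp_apply, LinearEquiv.coe_coe, ← hT', T'.symm_apply_apply]
    rfl
  change φ x (fun l => ((T' : Eu m →ₗ[ℝ] Eu m) ∘ₗ (A : Eu m →ₗ[ℝ] Eu m) ∘ₗ
      (T'.symm : Eu m →ₗ[ℝ] Eu m)) (T (EuclideanSpace.single l 1))) _ = _ at h2
  rw [h3] at h2
  exact h2

/-- The derivative of the inverse of a coordinate system, as a map of the model space. -/
def coordDeriv (e : OpenPartialHomeomorph M (Eu m)) (y : Eu m) : Eu m →L[ℝ] Eu m :=
  mfderiv (𝓡 m) (𝓡 m) e.symm y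

theorem coordDeriv_det_ne_zero {e : OpenPartialHomeomorph M (Eu m)}
    (he : e ∈ IsManifold.maximalAtlas (𝓡 m) ∞ M) {y : Eu m} (hy : y ∈ e.target) :
    (coordDeriv e y).det ≠ 0 := by
  have hes := ((contMDiffOn_symm_of_mem_maximalAtlas he).contMDiffAt
    (e.open_target.mem_nhds hy)).mdifferentiableAt (by simp)
  have he' := ((contMDiffOn_of_mem_maximalAtlas he).contMDiffAt
    (e.open_source.mem_nhds (e.map_target hy))).mdifferentiableAt (by simp)
  have hc := mfderiv_comp (I := 𝓡 m) (I' := 𝓡 m) (I'' := 𝓡 m) y he' hes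
  have h1 : mfderiv (𝓡 m) (𝓡 m) (e ∘ e.symm) y = mfderiv (𝓡 m) (𝓡 m) (id : Eu m → Eu m) y := by
    refine Filter.EventuallyEq.mfderiv_eq ?_
    filter_upwards [e.open_target.mem_nhds hy] with z hz using e.right_inv hz
  have h2 : (mfderiv (𝓡 m) (𝓡 m) e (e.symm y) : Eu m →L[ℝ] Eu m) ∘L coordDeriv e y =
      ContinuousLinearMap.id ℝ (Eu m) := by
    refine Eq.trans hc.symm (h1.trans ?_)
    exact mfderiv_id
  exact det_ne_zero_of_comp_eq_id h2

/-- Chain rule for the map e⁻¹ ∘ Θ. Only the germ of `f` enters, so the formula serves both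
transition maps between charts and the group action in coordinates. -/
theorem frameEval_mfderiv {φ : DualField E m}
    (hφ : ∀ x (A : TangentSpace (𝓡 m) x →ₗ[ℝ] TangentSpace (𝓡 m) x) v,
      φ x (fun i => A (v i)) = ((|LinearMap.det A| : ℝ) : ℂ) • φ x v)
    (t : Trivialization (Fin r → ℂ) (π (Fin r → ℂ) E)) (i : Fin r)
    {e : OpenPartialHomeomorph M (Eu m)} (he : e ∈ IsManifold.maximalAtlas (𝓡 m) ∞ M)
    {Θ : Eu m → Eu m} {f : Eu m → M} {y : Eu m} (hΘ : DifferentiableAt ℝ Θ y)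
    (hy : Θ y ∈ e.target) (hf : f =ᶠ[𝓝 y] fun z => e.symm (Θ z)) :
    frameEval φ t i (f y)
        (fun l => (mfderiv (𝓡 m) (𝓡 m) f y : Eu m →L[ℝ] Eu m) (EuclideanSpace.single l 1)) =
      (jac Θ y : ℂ) * component φ e t i (Θ y) := by
  have hes := ((contMDiffOn_symm_of_mem_maximalAtlas he).contMDiffAt
    (e.open_target.mem_nhds hy)).mdifferentiableAt (by simp)
  have h1 : (mfderiv (𝓡 m) (𝓡 m) f y : Eu m →L[ℝ] Eu m) = coordDeriv e (Θ y) ∘L fderiv ℝ Θ y := by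
    have e1 : (mfderiv (𝓡 m) (𝓡 m) f y : Eu m →L[ℝ] Eu m) =
        (mfderiv (𝓡 m) (𝓡 m) (e.symm ∘ Θ) y : Eu m →L[ℝ] Eu m) :=
      Filter.EventuallyEq.mfderiv_eq hf
    have e2 := mfderiv_comp (I := 𝓡 m) (I' := 𝓡 m) (I'' := 𝓡 m) (g := e.symm) (f := Θ) y hes
      hΘ.mdifferentiableAt
    rw [mfderiv_eq_fderiv] at e2
    exact e1.trans e2
  rw [h1, hf.eq_of_nhds]
  exact frameEval_clm hφ t i _ _ _ (coordDeriv_det_ne_zero he hy)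

/-- Components of a density in two coordinate systems. -/
theorem component_transition {φ : DualField E m}
    (hφ : ∀ x (A : TangentSpace (𝓡 m) x →ₗ[ℝ] TangentSpace (𝓡 m) x) v,
      φ x (fun i => A (v i)) = ((|LinearMap.det A| : ℝ) : ℂ) • φ x v)
    (t : Trivialization (Fin r → ℂ) (π (Fin r → ℂ) E)) (i : Fin r)
    {e₁ e₂ : OpenPartialHomeomorph M (Eu m)}
    (h₁ : e₁ ∈ IsManifold.maximalAtlas (𝓡 m) ∞ M) (h₂ : e₂ ∈ IsManifold.maximalAtlas (𝓡 m) ∞ M)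
    {y : Eu m} (hy : y ∈ (e₁.symm.trans e₂).source) :
    component φ e₁ t i y =
      (jac (e₁.symm.trans e₂) y : ℂ) * component φ e₂ t i ((e₁.symm.trans e₂) y) := by
  refine frameEval_mfderiv (Θ := e₁.symm.trans e₂) hφ t i h₂
    (((contDiffOn_transition h₁ h₂).contDiffAt
      ((e₁.symm.trans e₂).open_source.mem_nhds hy)).differentiableAt (by simp)) ?_ ?_
  · have := (e₁.symm.trans e₂).map_source hy
    simp only [mfld_simps] at this ⊢
    exact this.1
  · filter_upwards [(e₁.symm.trans e₂).open_source.mem_nhds hy] with z hz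
    simp only [mfld_simps] at hz ⊢
    rw [e₂.left_inv hz.2]

end Charts

/-! ### The group action and its lift in coordinates, with the group element as a parameter -/

section ActionFamilies

variable {n m r : ℕ} {H : Type*} [Group H] [TopologicalSpace H]
  [ChartedSpace (EuclideanSpace ℝ (Fin n)) H]
  {M : Type*} [TopologicalSpace M] [ChartedSpace (EuclideanSpace ℝ (Fin m)) M]
  [IsManifold (𝓡 m) ∞ M]
  [MulAction H M] [ContMDiffSMul (𝓡 n) (𝓡 m) ∞ H M]

/-- The coordinate system `x ↦ e (h • x)`. -/
def translateChart (n : ℕ) {m : ℕ} {H : Type*} [Group H] [TopologicalSpace H]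
    [ChartedSpace (EuclideanSpace ℝ (Fin n)) H]
    {M : Type*} [TopologicalSpace M] [ChartedSpace (EuclideanSpace ℝ (Fin m)) M]
    [MulAction H M] [ContMDiffSMul (𝓡 n) (𝓡 m) ∞ H M]
    (h : H) (e : OpenPartialHomeomorph M (Eu m)) : OpenPartialHomeomorph M (Eu m) :=
  (translateDiffeo n m M h).toHomeomorph.transOpenPartialHomeomorph e

theorem translateChart_mem (h : H) {e : OpenPartialHomeomorph M (Eu m)}
    (he : e ∈ IsManifold.maximalAtlas (𝓡 m) ∞ M) :
    translateChart n h e ∈ IsManifold.maximalAtlas (𝓡 m) ∞ M := by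
  refine OpenPartialHomeomorph.mem_maximalAtlas_of_contMDiffOn _ ?_ ?_
  · exact (contMDiffOn_of_mem_maximalAtlas he).comp
      (translateDiffeo n m M h).contMDiff.contMDiffOn (fun x hx => hx)
  · exact (translateDiffeo n m M h).symm.contMDiff.comp_contMDiffOn
      (contMDiffOn_symm_of_mem_maximalAtlas he)

theorem translateChart_apply (h : H) (e : OpenPartialHomeomorph M (Eu m)) (x : M) :
    translateChart n h e x = e (h • x) := rfl

theorem translateChart_source (h : H) (e : OpenPartialHomeomorph M (Eu m)) {x : M} :
    x ∈ (translateChart n h e).source ↔ h • x ∈ e.source := Iff.rfl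

/-- The action in coordinates. -/
def actionMap (e e' : OpenPartialHomeomorph M (Eu m)) (h : H) (y : Eu m) : Eu m :=
  e' (h • e.symm y)

theorem actionMap_eq (e e' : OpenPartialHomeomorph M (Eu m)) (h : H) :
    actionMap e e' h = e.symm.trans (translateChart n h e') := rfl

theorem mem_trans_translateChart {e e' : OpenPartialHomeomorph M (Eu m)} {h : H} {y : Eu m} :
    y ∈ (e.symm.trans (translateChart n h e')).source ↔
      y ∈ e.target ∧ h • e.symm y ∈ e'.source := by
  simp only [mfld_simps, translateChart_source]

variable {e e' : OpenPartialHomeomorph M (Eu m)} {a : Eu n → H} {ξ₀ : Eu n} {y₀ : Eu m}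

theorem continuousAt_family_smul (ha : ∀ᶠ ξ in 𝓝 ξ₀, ContMDiffAt (𝓡 n) (𝓡 n) ∞ a ξ)
    (hy₀ : y₀ ∈ e.target) :
    ContinuousAt (fun p : Eu n × Eu m => a p.1 • e.symm p.2) (ξ₀, y₀) := by
  have hsm := (contMDiff_smul (I := 𝓡 n) (I' := 𝓡 m) (n := ∞) (G := H) (M := M)).continuous
  exact hsm.continuousAt.comp ((ContinuousAt.comp (x := (ξ₀, y₀)) (f := Prod.fst)
    ha.self_of_nhds.continuousAt continuousAt_fst).prodMk
    (ContinuousAt.comp (x := (ξ₀, y₀)) (f := Prod.snd) (e.continuousAt_symm hy₀) continuousAt_snd))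

theorem eventually_family_mem (ha : ∀ᶠ ξ in 𝓝 ξ₀, ContMDiffAt (𝓡 n) (𝓡 n) ∞ a ξ)
    (hy₀ : y₀ ∈ e.target) {V : Set M} (hV : IsOpen V) (h0 : a ξ₀ • e.symm y₀ ∈ V) :
    ∀ᶠ p in 𝓝 (ξ₀, y₀), ContMDiffAt (𝓡 n) (𝓡 n) ∞ a p.1 ∧ p.2 ∈ e.target ∧
      a p.1 • e.symm p.2 ∈ V := by
  have h1 : ∀ᶠ p : Eu n × Eu m in 𝓝 (ξ₀, y₀), ContMDiffAt (𝓡 n) (𝓡 n) ∞ a p.1 :=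
    continuousAt_fst.eventually ha
  have h2 : ∀ᶠ p : Eu n × Eu m in 𝓝 (ξ₀, y₀), p.2 ∈ e.target :=
    continuousAt_snd.eventually (e.open_target.mem_nhds hy₀)
  have h3 := (continuousAt_family_smul ha hy₀).eventually (hV.mem_nhds h0)
  filter_upwards [h1, h2, h3] with p hp1 hp2 hp3 using ⟨hp1, hp2, hp3⟩

theorem smoothNear_actionMap (he : e ∈ IsManifold.maximalAtlas (𝓡 m) ∞ M)
    (he' : e' ∈ IsManifold.maximalAtlas (𝓡 m) ∞ M)
    (ha : ∀ᶠ ξ in 𝓝 ξ₀, ContMDiffAt (𝓡 n) (𝓡 n) ∞ a ξ)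
    (hy₀ : y₀ ∈ e.target) (h0 : a ξ₀ • e.symm y₀ ∈ e'.source) :
    SmoothNear (fun p : Eu n × Eu m => actionMap e e' (a p.1) p.2) (ξ₀, y₀) := by
  filter_upwards [eventually_family_mem ha hy₀ e'.open_source h0] with p hp
  rw [← contMDiffAt_iff_contDiffAt]
  have h1 : ContMDiffAt 𝓘(ℝ, Eu n × Eu m) (𝓡 n) ∞ (fun p : Eu n × Eu m => a p.1) p :=
    ContMDiffAt.comp (I' := 𝓡 n) p hp.1 contDiff_fst.contMDiff.contMDiffAt
  have h2 : ContMDiffAt 𝓘(ℝ, Eu n × Eu m) (𝓡 m) ∞ (fun p : Eu n × Eu m => e.symm p.2) p :=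
    ContMDiffAt.comp (I' := 𝓡 m) p ((contMDiffOn_symm_of_mem_maximalAtlas he).contMDiffAt
      (e.open_target.mem_nhds hp.2.1)) contDiff_snd.contMDiff.contMDiffAt
  have h3 := (contMDiff_smul (I := 𝓡 n) (I' := 𝓡 m) (n := ∞) (G := H)
    (M := M)).contMDiffAt.comp p (h1.prodMk h2)
  exact ((contMDiffOn_of_mem_maximalAtlas he').contMDiffAt
    (e'.open_source.mem_nhds hp.2.2)).comp p h3

theorem det_fderiv_actionMap_ne_zero (he : e ∈ IsManifold.maximalAtlas (𝓡 m) ∞ M)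
    (he' : e' ∈ IsManifold.maximalAtlas (𝓡 m) ∞ M) {h : H} {y : Eu m}
    (hy : y ∈ (e.symm.trans (translateChart n h e')).source) :
    (fderiv ℝ (actionMap e e' h) y).det ≠ 0 := by
  have ht := translateChart_mem (n := n) h he'
  rw [actionMap_eq (n := n)]
  exact det_fderiv_ne_zero (contDiffOn_transition he ht) (contDiffOn_transition_symm he ht)
    hy

theorem smoothNear_jac_actionMap (he : e ∈ IsManifold.maximalAtlas (𝓡 m) ∞ M)
    (he' : e' ∈ IsManifold.maximalAtlas (𝓡 m) ∞ M)
    (ha : ∀ᶠ ξ in 𝓝 ξ₀, ContMDiffAt (𝓡 n) (𝓡 n) ∞ a ξ)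
    (hy₀ : y₀ ∈ e.target) (h0 : a ξ₀ • e.symm y₀ ∈ e'.source) :
    SmoothNear (fun p : Eu n × Eu m => (jac (actionMap e e' (a p.1)) p.2 : ℂ)) (ξ₀, y₀) := by
  filter_upwards [eventually_family_mem ha hy₀ e'.open_source h0,
    smoothNear_actionMap he he' ha hy₀ h0] with p hp hs
  refine contDiffAt_abs_det ?_ (det_fderiv_actionMap_ne_zero he he'
    (mem_trans_translateChart (n := n) |>.2 hp.2))
  have hs' : ContDiffAt ℝ ∞ (Function.uncurry fun (p : Eu n × Eu m) (y : Eu m) =>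
      actionMap e e' (a p.1) y) (p, p.2) :=
    ContDiffAt.comp (p, p.2) (g := fun p : Eu n × Eu m => actionMap e e' (a p.1) p.2)
      (f := fun q : (Eu n × Eu m) × Eu m => (q.1.1, q.2)) hs (by fun_prop)
  exact hs'.fderiv (g := fun p : Eu n × Eu m => p.2) contDiffAt_snd (by simp)

variable {E : M → Type*} [∀ x, AddCommGroup (E x)] [∀ x, Module ℂ (E x)]
  [∀ x, TopologicalSpace (E x)] [TopologicalSpace (TotalSpace (Fin r → ℂ) E)]
  [FiberBundle (Fin r → ℂ) E] [VectorBundle ℂ (Fin r → ℂ) E]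
  [ContMDiffVectorBundle ∞ (Fin r → ℂ) E (𝓡 m)]

/-- The matrix of the lift of the action in local frames. -/
def liftMatrix (L : EquivariantLift n m r H E) (e : OpenPartialHomeomorph M (Eu m))
    (t t' : Trivialization (Fin r → ℂ) (π (Fin r → ℂ) E)) (i j : Fin r) (h : H) (y : Eu m) : ℂ :=
  (t' ⟨h • e.symm y, L.act h (e.symm y) (t.symm (e.symm y) (Pi.single i 1))⟩).2 j

theorem smoothNear_liftMatrix (L : EquivariantLift n m r H E)
    (he : e ∈ IsManifold.maximalAtlas (𝓡 m) ∞ M)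
    (t t' : Trivialization (Fin r → ℂ) (π (Fin r → ℂ) E)) [MemTrivializationAtlas t]
    [MemTrivializationAtlas t'] (i j : Fin r)
    (ha : ∀ᶠ ξ in 𝓝 ξ₀, ContMDiffAt (𝓡 n) (𝓡 n) ∞ a ξ)
    (hy₀ : y₀ ∈ e.target) (ht : e.symm y₀ ∈ t.baseSet) (ht' : a ξ₀ • e.symm y₀ ∈ t'.baseSet) :
    SmoothNear (fun p : Eu n × Eu m => liftMatrix L e t t' i j (a p.1) p.2) (ξ₀, y₀) := by
  have hopen : IsOpen (e.target ∩ e.symm ⁻¹' t.baseSet) :=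
    e.isOpen_inter_preimage_symm t.open_baseSet
  have hev : ∀ᶠ p : Eu n × Eu m in 𝓝 (ξ₀, y₀), p.2 ∈ e.target ∩ e.symm ⁻¹' t.baseSet :=
    continuousAt_snd.eventually (hopen.mem_nhds ⟨hy₀, ht⟩)
  filter_upwards [eventually_family_mem ha hy₀ t'.open_baseSet ht', hev] with p hp hpt
  have h1 : ContMDiffAt (𝓡 m) ((𝓡 m).prod 𝓘(ℝ, Fin r → ℂ)) ∞
      (fun z => TotalSpace.mk' (Fin r → ℂ) (e.symm z)
        (t.symm (e.symm z) (Pi.single i 1))) p.2 := by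
    rw [t.contMDiffAt_iff (by rw [t.mem_source]; exact hpt.2)]
    refine ⟨(contMDiffOn_symm_of_mem_maximalAtlas he).contMDiffAt
      (e.open_target.mem_nhds hp.2.1), ?_⟩
    refine (contMDiffAt_const (c := (Pi.single i 1 : Fin r → ℂ))).congr_of_eventuallyEq ?_
    filter_upwards [hopen.mem_nhds hpt] with z hz
    simp [t.apply_mk_symm hz.2]
  have h2 : ContMDiffAt 𝓘(ℝ, Eu n × Eu m) (𝓡 n) ∞ (fun p : Eu n × Eu m => a p.1) p :=
    ContMDiffAt.comp (I' := 𝓡 n) p hp.1 contDiff_fst.contMDiff.contMDiffAt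
  have h3 : ContMDiffAt 𝓘(ℝ, Eu n × Eu m) ((𝓡 m).prod 𝓘(ℝ, Fin r → ℂ)) ∞
      (fun p : Eu n × Eu m => TotalSpace.mk' (Fin r → ℂ) (e.symm p.2)
        (t.symm (e.symm p.2) (Pi.single i 1))) p :=
    ContMDiffAt.comp (I' := 𝓡 m) p h1 contDiff_snd.contMDiff.contMDiffAt
  have h4 : ContMDiffAt 𝓘(ℝ, Eu n × Eu m) ((𝓡 m).prod 𝓘(ℝ, Fin r → ℂ)) ∞
      (fun p : Eu n × Eu m => TotalSpace.mk' (Fin r → ℂ) (a p.1 • e.symm p.2)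
        (L.act (a p.1) (e.symm p.2) (t.symm (e.symm p.2) (Pi.single i 1)))) p :=
    L.smooth.contMDiffAt.comp p (h2.prodMk h3)
  rw [t'.contMDiffAt_iff (by rw [t'.mem_source]; exact hp.2.2)] at h4
  exact contDiffAt_pi.1 h4.2.contDiffAt j

/-- Components of the pullback of a density under the action. -/
theorem component_pullbackField (L : EquivariantLift n m r H E) {φ : DualField E m}
    (hφ : ∀ x (A : TangentSpace (𝓡 m) x →ₗ[ℝ] TangentSpace (𝓡 m) x) v,
      φ x (fun i => A (v i)) = ((|LinearMap.det A| : ℝ) : ℂ) • φ x v)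
    (he : e ∈ IsManifold.maximalAtlas (𝓡 m) ∞ M) (he' : e' ∈ IsManifold.maximalAtlas (𝓡 m) ∞ M)
    (t t' : Trivialization (Fin r → ℂ) (π (Fin r → ℂ) E)) [MemTrivializationAtlas t']
    (i : Fin r) {h : H} {y : Eu m} (hy : y ∈ e.target) (h0 : h • e.symm y ∈ e'.source)
    (ht' : h • e.symm y ∈ t'.baseSet) :
    component (pullbackField L h φ) e t i y = ∑ j, liftMatrix L e t t' i j h y *
      ((jac (actionMap e e' h) y : ℂ) * component φ e' t' j (actionMap e e' h y)) := by
  have hsrc := mem_trans_translateChart (n := n) |>.2 ⟨hy, h0⟩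
  have hopen := (e.symm.trans (translateChart n h e')).open_source
  have hes := contMDiffOn_symm_of_mem_maximalAtlas he
  have hfr : ∀ j, frameEval φ t' j (h • e.symm y) (fun l =>
      (mfderiv (𝓡 m) (𝓡 m) (fun z => h • e.symm z) y : Eu m →L[ℝ] Eu m)
        (EuclideanSpace.single l 1)) =
      (jac (actionMap e e' h) y : ℂ) * component φ e' t' j (actionMap e e' h y) := fun j => by
    refine frameEval_mfderiv hφ t' j he' (f := fun z => h • e.symm z) ?_ (e'.map_source h0) ?_
    · rw [actionMap_eq (n := n)]
      exact ((contDiffOn_transition he (translateChart_mem h he')).contDiffAt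
        (hopen.mem_nhds hsrc)).differentiableAt (by simp)
    · filter_upwards [hopen.mem_nhds hsrc] with z hz
      exact (e'.left_inv (mem_trans_translateChart.1 hz).2).symm
  have hframe : ∀ l, (mfderiv (𝓡 m) (𝓡 m) (fun x : M => h • x) (e.symm y)
      (coordFrame e y l) : Eu m) = (mfderiv (𝓡 m) (𝓡 m) (fun z => h • e.symm z) y :
        Eu m →L[ℝ] Eu m) (EuclideanSpace.single l 1) := by
    intro l
    have hc := mfderiv_comp (I := 𝓡 m) (I' := 𝓡 m) (I'' := 𝓡 m) y
      (g := fun x : M => h • x) (f := e.symm)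
      (((translateDiffeo n m M h).contMDiff.contMDiffAt (x := e.symm y)).mdifferentiableAt
        (by simp))
      ((hes.contMDiffAt (e.open_target.mem_nhds hy)).mdifferentiableAt (by simp))
    exact (congrArg (fun T => T (EuclideanSpace.single l (1 : ℝ))) hc).symm
  have hvec : L.act h (e.symm y) (t.symm (e.symm y) (Pi.single i 1)) =
      ∑ j, liftMatrix L e t t' i j h y • t'.symm (h • e.symm y) (Pi.single j 1) := by
    have h3 : t'.symm (h • e.symm y) (fun j => liftMatrix L e t t' i j h y) =
        L.act h (e.symm y) (t.symm (e.symm y) (Pi.single i 1)) :=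
      t'.symm_apply_apply_mk ht' _
    have h4 : (fun j => liftMatrix L e t t' i j h y) =
        ∑ j, liftMatrix L e t t' i j h y • (Pi.single j 1 : Fin r → ℂ) := by
      simpa using (pi_eq_sum_univ' (fun j => liftMatrix L e t t' i j h y))
    rw [← h3]
    conv_lhs => rw [h4]
    rw [← t'.coe_symmₗ (R := ℂ) ht', map_sum]
    exact Finset.sum_congr rfl fun j _ => map_smul _ _ _
  change φ (h • e.symm y) (fun l => mfderiv (𝓡 m) (𝓡 m) (fun x : M => h • x) (e.symm y)
    (coordFrame e y l)) (L.act h (e.symm y) (t.symm (e.symm y) (Pi.single i 1))) = _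
  rw [hvec, map_sum]
  refine Finset.sum_congr rfl fun j _ => ?_
  rw [map_smul, smul_eq_mul, ← hfr j]
  congr 1
  refine congrArg (fun v => frameEval φ t' j (h • e.symm y) v) (funext hframe)

end ActionFamilies

/-! ### Continuity of the translates of a distribution -/

section Uniformity

variable {X Y : Type*} [TopologicalSpace X] [TopologicalSpace Y]

/-- A tube lemma with constants: finitely many product neighbourhoods cover the compact set, and
monotonicity in the constant permits taking the maximum. -/
theorem IsCompact.exists_eventually_forall {x₀ : X} {K : Set Y} (hK : IsCompact K)
    {P : ℝ → X → Y → Prop} (hP : ∀ C C' x y, C ≤ C' → P C x y → P C' x y)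
    (h : ∀ y ∈ K, ∃ C, ∀ᶠ p in 𝓝 (x₀, y), P C p.1 p.2) :
    ∃ C, 0 ≤ C ∧ ∀ᶠ x in 𝓝 x₀, ∀ y ∈ K, P C x y := by
  refine hK.induction_on (p := fun s => ∃ C, 0 ≤ C ∧ ∀ᶠ x in 𝓝 x₀, ∀ y ∈ s, P C x y)
    ⟨0, le_rfl, by simp⟩ ?_ ?_ ?_
  · rintro s t hst ⟨C, hC, h⟩
    exact ⟨C, hC, h.mono fun x hx y hy => hx y (hst hy)⟩
  · rintro s t ⟨C, hC, h⟩ ⟨C', hC', h'⟩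
    refine ⟨max C C', hC.trans (le_max_left _ _), ?_⟩
    filter_upwards [h, h'] with x hx hx' y hy
    rcases hy with hy | hy
    · exact hP _ _ _ _ (le_max_left _ _) (hx y hy)
    · exact hP _ _ _ _ (le_max_right _ _) (hx' y hy)
  · intro y hy
    obtain ⟨C, hC⟩ := h y hy
    rw [nhds_prod_eq] at hC
    obtain ⟨pa, ha, pb, hb, hab⟩ := Filter.eventually_prod_iff.1 hC
    refine ⟨{z | pb z}, mem_nhdsWithin_of_mem_nhds hb, max C 0, le_max_right _ _, ?_⟩
    filter_upwards [ha] with x hx z hz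
    exact hP _ _ _ _ (le_max_left _ _) (hab hx hz)

end Uniformity

/-! ### Local estimates for pullbacks of test measures -/

section Translates

variable {n m r : ℕ} {H : Type*} [Group H] [TopologicalSpace H]
  [ChartedSpace (EuclideanSpace ℝ (Fin n)) H]
  {M : Type*} [TopologicalSpace M] [ChartedSpace (EuclideanSpace ℝ (Fin m)) M]
  [IsManifold (𝓡 m) ∞ M]

/-- Estimates are proved for families smooth in a Euclidean parameter; this transfers them to group
elements near `h₀`. -/
theorem eventually_of_chart (h₀ : H) {Q : Eu n → Prop}
    (hQ : ∀ᶠ ξ in 𝓝 (chartAt (Eu n) h₀ h₀), Q ξ) :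
    ∀ᶠ h in 𝓝 h₀, ∃ ξ, Q ξ ∧ (chartAt (Eu n) h₀).symm ξ = h := by
  filter_upwards [((chartAt (Eu n) h₀).continuousAt (mem_chart_source _ h₀)).eventually hQ,
    (chartAt (Eu n) h₀).open_source.mem_nhds (mem_chart_source _ h₀)] with h h1 h2
  exact ⟨_, h1, (chartAt (Eu n) h₀).left_inv h2⟩

theorem eventually_contMDiffAt_chart_symm [IsManifold (𝓡 n) ∞ H] (h₀ : H) :
    ∀ᶠ ξ in 𝓝 (chartAt (Eu n) h₀ h₀), ContMDiffAt (𝓡 n) (𝓡 n) ∞ (chartAt (Eu n) h₀).symm ξ := by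
  filter_upwards [(chartAt (Eu n) h₀).open_target.mem_nhds (mem_chart_target _ h₀)] with ξ hξ
  exact (contMDiffOn_symm_of_mem_maximalAtlas
    (IsManifold.chart_mem_maximalAtlas (I := 𝓡 n) (n := ∞) h₀)).contMDiffAt
    ((chartAt (Eu n) h₀).open_target.mem_nhds hξ)

variable {E : M → Type*} [∀ x, AddCommGroup (E x)] [∀ x, Module ℂ (E x)]
  [∀ x, TopologicalSpace (E x)] [TopologicalSpace (TotalSpace (Fin r → ℂ) E)]
  [FiberBundle (Fin r → ℂ) E]

theorem smoothNear_component (φ : testMeasures E m r) {e : OpenPartialHomeomorph M (Eu m)}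
    (he : e ∈ IsManifold.maximalAtlas (𝓡 m) ∞ M)
    (t : Trivialization (Fin r → ℂ) (π (Fin r → ℂ) E)) [MemTrivializationAtlas t] (i : Fin r)
    {y : Eu m} (hy : y ∈ e.target) (ht : e.symm y ∈ t.baseSet) :
    SmoothNear (component φ.1 e t i) y :=
  smoothNear_of_contDiffOn (φ.2.2.1 e he t i) (e.isOpen_inter_preimage_symm t.open_baseSet)
    ⟨hy, ht⟩

theorem component_eventuallyEq_zero [T2Space M] (φ : DualField E m) {K : Set M} (hK : IsCompact K)
    (hφ : ∀ x ∉ K, φ x = 0) {e : OpenPartialHomeomorph M (Eu m)}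
    (t : Trivialization (Fin r → ℂ) (π (Fin r → ℂ) E)) (i : Fin r) {y : Eu m}
    (hy : y ∈ e.target) (hyK : e.symm y ∉ K) :
    component φ e t i =ᶠ[𝓝 y] fun _ => 0 := by
  filter_upwards [(e.continuousAt_symm hy).eventually
    (hK.isClosed.isOpen_compl.mem_nhds hyK)] with z hz
  simp [component, hφ _ hz]

/-- Continuity of a distribution in terms of partial derivatives. -/
theorem Distribution.exists_bound (σ : Distribution E m r) {e : OpenPartialHomeomorph M (Eu m)}
    (he : e ∈ IsManifold.maximalAtlas (𝓡 m) ∞ M)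
    (t : Trivialization (Fin r → ℂ) (π (Fin r → ℂ) E)) [MemTrivializationAtlas t]
    {K : Set M} (hK : IsCompact K) (hKe : K ⊆ e.source ∩ t.baseSet) :
    ∃ (C : ℝ) (N : ℕ), 0 ≤ C ∧ ∀ φ : testMeasures E m r, (∀ x ∉ K, φ.1 x = 0) →
      ∀ B : ℝ, 0 ≤ B → (∀ y ∈ e '' K, ∀ q ≤ N, ∀ (w : Fin q → Fin m) (i : Fin r),
        ‖partialDeriv w (component φ.1 e t i) y‖ ≤ B) → ‖σ.pairing φ‖ ≤ C * B := by
  obtain ⟨C, N, h⟩ := σ.continuous e he t K hK hKe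
  refine ⟨|C| * ((m : ℝ) + 1) ^ N, N, by positivity, fun φ hφ B hB hb => ?_⟩
  have h1 := h φ hφ (((m : ℝ) + 1) ^ N * B) fun q hq i y hy =>
    (norm_iteratedFDeriv_le_of_partialDeriv fun w => hb y hy q hq w i).trans (by
      gcongr
      calc (m : ℝ) ^ q ≤ ((m : ℝ) + 1) ^ q := by gcongr; linarith
        _ ≤ _ := pow_le_pow_right₀ (by linarith [Nat.cast_nonneg (α := ℝ) m]) hq)
  calc _ ≤ C * (((m : ℝ) + 1) ^ N * B) := h1
    _ ≤ |C| * (((m : ℝ) + 1) ^ N * B) := by gcongr; exact le_abs_self C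
    _ = _ := by ring

variable [LieGroup (𝓡 n) ∞ H] [MulAction H M] [ContMDiffSMul (𝓡 n) (𝓡 m) ∞ H M]
  [VectorBundle ℂ (Fin r → ℂ) E] [ContMDiffVectorBundle ∞ (Fin r → ℂ) E (𝓡 m)]

theorem pullback_apply_eq_zero (L : EquivariantLift n m r H E) {h : H} {φ : testMeasures E m r}
    {x : M} (hx : φ.1 (h • x) = 0) : (pullback L h φ).1 x = 0 := by
  funext v
  change (φ.1 (h • x) _) ∘ₗ L.act h x = 0
  rw [hx]
  rfl

/-- The matrix of the pullback of densities in local coordinates and frames. -/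
def pullbackMatrix (L : EquivariantLift n m r H E) (e e' : OpenPartialHomeomorph M (Eu m))
    (t t' : Trivialization (Fin r → ℂ) (π (Fin r → ℂ) E)) (i j : Fin r) (h : H) (y : Eu m) : ℂ :=
  liftMatrix L e t t' i j h y * (jac (actionMap e e' h) y : ℂ)

variable {e e' : OpenPartialHomeomorph M (Eu m)} {a : Eu n → H} {ξ₀ : Eu n} {y₀ : Eu m}
  (he : e ∈ IsManifold.maximalAtlas (𝓡 m) ∞ M) (he' : e' ∈ IsManifold.maximalAtlas (𝓡 m) ∞ M)
  (t t' : Trivialization (Fin r → ℂ) (π (Fin r → ℂ) E)) [MemTrivializationAtlas t]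
  [MemTrivializationAtlas t']
  (ha : ∀ᶠ ξ in 𝓝 ξ₀, ContMDiffAt (𝓡 n) (𝓡 n) ∞ a ξ)
  (hy₀ : y₀ ∈ e.target ∩ e.symm ⁻¹' t.baseSet)
  (h0 : a ξ₀ • e.symm y₀ ∈ e'.source ∩ t'.baseSet) (L : EquivariantLift n m r H E)

include he he' ha hy₀ h0

theorem smoothNear_pullbackMatrix (i j : Fin r) :
    SmoothNear (Function.uncurry fun ξ y => pullbackMatrix L e e' t t' i j (a ξ) y) (ξ₀, y₀) :=
  (smoothNear_liftMatrix L he t t' i j ha hy₀.1 hy₀.2 h0.2).mul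
    (smoothNear_jac_actionMap he he' ha hy₀.1 h0.1)

theorem eventually_component_pullback :
    ∀ᶠ p in 𝓝 (ξ₀, y₀), ∀ (φ : testMeasures E m r) (i : Fin r),
      component (pullback L (a p.1) φ).1 e t i =ᶠ[𝓝 p.2] fun z =>
        ∑ j, pullbackMatrix L e e' t t' i j (a p.1) z *
          component φ.1 e' t' j (actionMap e e' (a p.1) z) := by
  have h1 := eventually_family_mem ha hy₀.1 (e'.open_source.inter t'.open_baseSet) h0
  filter_upwards [h1.eventually_nhds] with p hp φ i
  have h2 : Tendsto (fun z : Eu m => (p.1, z)) (𝓝 p.2) (𝓝 p) :=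
    Continuous.tendsto (f := fun z : Eu m => (p.1, z)) (by fun_prop) p.2
  filter_upwards [h2.eventually hp] with z hz
  have h3 := component_pullbackField L φ.2.1 he he' t t' i (h := a p.1) (y := z) hz.2.1 hz.2.2.1
    hz.2.2.2
  refine h3.trans (Finset.sum_congr rfl fun j _ => ?_)
  rw [pullbackMatrix]
  ring

theorem smoothNear_component_pullback (φ : testMeasures E m r) (i : Fin r) :
    SmoothNear (Function.uncurry fun ξ y => component (pullback L (a ξ) φ).1 e t i y)
      (ξ₀, y₀) := by
  have h1 : SmoothNear (fun p : Eu n × Eu m => ∑ j, pullbackMatrix L e e' t t' i j (a p.1) p.2 *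
      component φ.1 e' t' j (actionMap e e' (a p.1) p.2)) (ξ₀, y₀) := by
    refine SmoothNear.sum fun j _ =>
      (smoothNear_pullbackMatrix he he' t t' ha hy₀ h0 L i j).mul ?_
    refine SmoothNear.comp (k := component φ.1 e' t' j) (smoothNear_component φ he' t' j ?_ ?_)
      (smoothNear_actionMap he he' ha hy₀.1 h0.1)
    · exact e'.map_source h0.1
    · simp only [actionMap, e'.left_inv h0.1]
      exact h0.2
  refine h1.congr ?_
  filter_upwards [eventually_component_pullback he he' t t' ha hy₀ h0 L] with p hp
    using (hp φ i).eq_of_nhds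

/-- Weighted bounds for the derivatives of the components of a pullback. -/
theorem pullback_bound {c : ℕ} (hΘ : ∀ j, Sym c (𝓝 (ξ₀, y₀)) 0 (letterDeg c j)
      (fun ξ y => ((actionMap e e' (a ξ) y j : ℝ) : ℂ))) (N : ℕ) :
    ∃ C : ℝ, 0 ≤ C ∧ ∀ᶠ p in 𝓝 (ξ₀, y₀), ∀ (φ : testMeasures E m r) (B : ℝ), 0 ≤ B →
      (∀ q ≤ N, ∀ (v : Fin q → Fin m) (j : Fin r), nrm c p.2 ^ wordDeg c v *
        ‖partialDeriv v (component φ.1 e' t' j) (actionMap e e' (a p.1) p.2)‖ ≤ B) →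
      ∀ q ≤ N, ∀ (w : Fin q → Fin m) (i : Fin r), nrm c p.2 ^ wordDeg c w *
        ‖partialDeriv w (component (pullback L (a p.1) φ).1 e t i) p.2‖ ≤ C * B := by
  have hΘs := smoothNear_actionMap he he' ha hy₀.1 h0.1
  -- The matrix entries are merely smooth, hence in the class with a = s = 0. The further factor
  -- `nrm`^k does not take part here and is multiplied in later.
  have hterm : ∀ (q : ℕ) (w : Fin q → Fin m) (i j : Fin r), _ := fun q w i j =>
    Sym.comp_bound (SmoothNear.slice (F := fun ξ y => actionMap e e' (a ξ) y) hΘs) hΘ w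
      (smoothNear_pullbackMatrix he he' t t' ha hy₀ h0 L i j).sym
  choose C hC hb using hterm
  let Ct : ℝ := ∑ q ∈ Finset.range (N + 1), ∑ w : Fin q → Fin m, ∑ i, ∑ j, C q w i j
  have hCt : ∀ q ≤ N, ∀ (w : Fin q → Fin m) i, ∑ j, C q w i j ≤ Ct := by
    intro q hq w i
    have h3 : ∀ q (w : Fin q → Fin m) i, 0 ≤ ∑ j, C q w i j := fun q w i =>
      Finset.sum_nonneg fun j _ => hC q w i j
    have h2 : ∀ q (w : Fin q → Fin m), 0 ≤ ∑ i, ∑ j, C q w i j := fun q w =>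
      Finset.sum_nonneg fun i _ => h3 q w i
    calc _ ≤ ∑ i, ∑ j, C q w i j :=
          Finset.single_le_sum (f := fun i => ∑ j, C q w i j) (fun i _ => h3 q w i)
            (Finset.mem_univ i)
      _ ≤ ∑ w : Fin q → Fin m, ∑ i, ∑ j, C q w i j :=
          Finset.single_le_sum (f := fun w : Fin q → Fin m => ∑ i, ∑ j, C q w i j)
            (fun w _ => h2 q w) (Finset.mem_univ w)
      _ ≤ Ct := Finset.single_le_sum (f := fun q => ∑ w : Fin q → Fin m, ∑ i, ∑ j, C q w i j)
            (fun q _ => Finset.sum_nonneg fun w _ => h2 q w) (by simpa [Nat.lt_succ_iff] using hq)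
  refine ⟨Ct, Finset.sum_nonneg fun q _ => Finset.sum_nonneg fun w _ => Finset.sum_nonneg
    fun i _ => Finset.sum_nonneg fun j _ => hC q w i j, ?_⟩
  have hev : ∀ᶠ p in 𝓝 (ξ₀, y₀), ∀ q ∈ Finset.range (N + 1), ∀ (w : Fin q → Fin m) (i j : Fin r),
      _ := (Finset.eventually_all _).2 fun q _ => eventually_all.2 fun w => eventually_all.2
        fun i => eventually_all.2 fun j => hb q w i j
  filter_upwards [hev, eventually_component_pullback he he' t t' ha hy₀ h0 L,
    eventually_family_mem ha hy₀.1 (e'.open_source.inter t'.open_baseSet) h0,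
    SmoothNear.slice (F := fun ξ y => actionMap e e' (a ξ) y) hΘs,
    eventually_all.2 fun i => eventually_all.2 fun j =>
      (smoothNear_pullbackMatrix he he' t t' ha hy₀ h0 L i j).slice]
    with p hp hcomp hmem hs hF φ B hB hg q hq w i
  have hgs : ∀ j, SmoothNear (component φ.1 e' t' j) (actionMap e e' (a p.1) p.2) := fun j => by
    refine smoothNear_component φ he' t' j (e'.map_source hmem.2.2.1) ?_
    simp only [actionMap, e'.left_inv hmem.2.2.1]
    exact hmem.2.2.2
  have hn := nrm_nonneg c p.2
  have hj : ∀ j, nrm c p.2 ^ wordDeg c w * ‖partialDeriv w (fun z =>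
      pullbackMatrix L e e' t t' i j (a p.1) z *
        component φ.1 e' t' j (actionMap e e' (a p.1) z)) p.2‖ ≤ C q w i j * B := fun j => by
    have h1 := hp q (by simpa [Nat.lt_succ_iff] using hq) w i j (component φ.1 e' t' j) (hgs j) B
      fun q' hq' v => by simpa using hg q' (hq'.trans hq) v j
    simpa using h1
  rw [partialDeriv_congr w (hcomp φ i), partialDeriv_sum w fun j _ =>
    (hF i j).mul (SmoothNear.comp (k := component φ.1 e' t' j) (hgs j) hs)]
  calc _ ≤ nrm c p.2 ^ wordDeg c w * ∑ j, ‖partialDeriv w (fun z =>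
        pullbackMatrix L e e' t t' i j (a p.1) z *
          component φ.1 e' t' j (actionMap e e' (a p.1) z)) p.2‖ := by
        gcongr
        exact norm_sum_le _ _
    _ ≤ (∑ j, C q w i j) * B := by
        rw [Finset.mul_sum, Finset.sum_mul]
        exact Finset.sum_le_sum fun j _ => hj j
    _ ≤ Ct * B := by
        gcongr
        exact hCt q hq w i

end Translates

/-! ### The integrated distribution -/

section Localization

variable {m r : ℕ}
  {M : Type*} [TopologicalSpace M] [ChartedSpace (EuclideanSpace ℝ (Fin m)) M]
  {E : M → Type*} [∀ x, AddCommGroup (E x)] [∀ x, Module ℂ (E x)]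
  [∀ x, TopologicalSpace (E x)] [TopologicalSpace (TotalSpace (Fin r → ℂ) E)]
  [FiberBundle (Fin r → ℂ) E]

/-- The product of a test measure with a smooth function. -/
def mulTest [IsManifold (𝓡 m) ∞ M] (χ : C^∞⟮𝓡 m, M; ℝ⟯) (φ : testMeasures E m r) :
    testMeasures E m r :=
  ⟨fun x v => (χ x : ℂ) • φ.1 x v, fun x A v => by
    change (χ x : ℂ) • φ.1 x (fun i => A (v i)) = _ • (χ x : ℂ) • φ.1 x v
    rw [φ.2.1 x A v, smul_comm],
    fun e he t _ i => by
      have hχ : ContDiffOn ℝ ∞ (fun y => (χ (e.symm y) : ℂ)) e.target :=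
        Complex.ofRealCLM.contDiff.comp_contDiffOn (contMDiffOn_iff_contDiffOn.1
          (χ.contMDiff.comp_contMDiffOn (contMDiffOn_symm_of_mem_maximalAtlas he)))
      exact (hχ.mono inter_subset_left).mul (φ.2.2.1 e he t i), by
      obtain ⟨K, hK, h⟩ := φ.2.2.2
      refine ⟨K, hK, fun x hx => ?_⟩
      funext v
      simp [h x hx]⟩

theorem mulTest_apply [IsManifold (𝓡 m) ∞ M] (χ : C^∞⟮𝓡 m, M; ℝ⟯) (φ : testMeasures E m r) (x : M)
    (v : Fin m → TangentSpace (𝓡 m) x) : (mulTest χ φ).1 x v = (χ x : ℂ) • φ.1 x v := rfl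

theorem component_mulTest [IsManifold (𝓡 m) ∞ M] (χ : C^∞⟮𝓡 m, M; ℝ⟯) (φ : testMeasures E m r)
    (e : OpenPartialHomeomorph M (Eu m)) (t : Trivialization (Fin r → ℂ) (π (Fin r → ℂ) E))
    (i : Fin r) :
    component (mulTest χ φ).1 e t i = fun y => (χ (e.symm y) : ℂ) * component φ.1 e t i y := rfl

theorem mulTest_eq_zero [IsManifold (𝓡 m) ∞ M] {χ : C^∞⟮𝓡 m, M; ℝ⟯} {φ : testMeasures E m r}
    {K : Set M} (hφ : ∀ x ∉ K, φ.1 x = 0) : ∀ x ∉ K ∩ tsupport χ, (mulTest χ φ).1 x = 0 := by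
  intro x hx
  funext v
  rw [mulTest_apply]
  by_cases hK : x ∈ K
  · rw [image_eq_zero_of_notMem_tsupport fun h => hx ⟨hK, h⟩]
    simp
  · simp [hφ x hK]

/-- Test measures supported in a compact set are sums of test measures supported in the members of
an open cover. -/
theorem exists_sum_mulTest [IsManifold (𝓡 m) ∞ M] [T2Space M] [SigmaCompactSpace M] {K : Set M}
    (hK : IsCompact K) {P : M → Set M} (hP : ∀ x ∈ K, IsOpen (P x) ∧ x ∈ P x) :
    ∃ (s : Finset M) (χ : M → C^∞⟮𝓡 m, M; ℝ⟯), (∀ x ∈ s, x ∈ K) ∧ (∀ x, tsupport (χ x) ⊆ P x) ∧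
      ∀ φ : testMeasures E m r, (∀ x ∉ K, φ.1 x = 0) → φ = ∑ x ∈ s, mulTest (χ x) φ := by
  obtain ⟨s, hs⟩ := hK.elim_nhds_subcover' (fun x _ => P x) fun x hx =>
    (hP x hx).1.mem_nhds (hP x hx).2
  classical
  let s' : Finset M := s.image (fun x : K => (x : M))
  have hs'K : ∀ x ∈ s', x ∈ K := fun x hx => by
    obtain ⟨y, _, rfl⟩ := Finset.mem_image.1 hx
    exact y.2
  obtain ⟨f, hf⟩ := SmoothPartitionOfUnity.exists_isSubordinate (𝓡 m) hK.isClosed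
    (fun x : s' => P x) (fun x => (hP x (hs'K x x.2)).1) (by
      intro x hx
      have h1 : x ∈ ⋃ y ∈ s, P (y : M) := hs hx
      obtain ⟨y, hy, hxy⟩ := mem_iUnion₂.1 h1
      exact mem_iUnion.2 ⟨⟨y, Finset.mem_image.2 ⟨y, hy, rfl⟩⟩, hxy⟩)
  -- The partition functions are extended by zero to indices outside the subcover, where the support
  -- condition becomes trivial.
  let χ : M → C^∞⟮𝓡 m, M; ℝ⟯ := fun x => if h : x ∈ s' then f ⟨x, h⟩ else 0
  refine ⟨s', χ, hs'K, fun x => ?_, fun φ hφ => ?_⟩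
  · by_cases h : x ∈ s'
    · simp only [χ, dif_pos h]
      exact hf ⟨x, h⟩
    · simp only [χ, dif_neg h]
      have : tsupport (⇑(0 : C^∞⟮𝓡 m, M; ℝ⟯)) = ∅ := by
        rw [tsupport_eq_empty_iff]
        rfl
      rw [this]
      exact empty_subset _
  · refine Subtype.ext ?_
    funext x v
    have e1 : (↑(∑ x ∈ s', mulTest (χ x) φ) : DualField E m) x v =
        ∑ z ∈ s', (χ z x : ℂ) • φ.1 x v := by
      rw [AddSubmonoidClass.coe_finsetSum, Finset.sum_apply, Finset.sum_apply]
      rfl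
    rw [e1, ← Finset.sum_smul]
    by_cases hx : x ∈ K
    · have h1 : ∑ z ∈ s', (χ z x : ℂ) = 1 := by
        have h2 := f.sum_eq_one hx
        rw [finsum_eq_sum_of_fintype] at h2
        rw [← Finset.sum_coe_sort s' (fun z => (χ z x : ℂ))]
        have h3 : ∀ z : s', (χ z x : ℂ) = ((f z x : ℝ) : ℂ) := fun z => by
          simp only [χ, dif_pos z.2]
        simp only [h3]
        exact_mod_cast h2
      rw [h1, one_smul]
    · rw [hφ x hx]
      simp

end Localization

/-! ### Continuity of the translates in the group element, uniform bounds, and the integral -/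

section Integration

variable {n m r : ℕ} {H : Type*} [Group H] [TopologicalSpace H]
  [ChartedSpace (EuclideanSpace ℝ (Fin n)) H] [LieGroup (𝓡 n) ∞ H]
  {M : Type*} [TopologicalSpace M] [ChartedSpace (EuclideanSpace ℝ (Fin m)) M]
  [IsManifold (𝓡 m) ∞ M] [T2Space M] [MulAction H M] [ContMDiffSMul (𝓡 n) (𝓡 m) ∞ H M]

theorem continuous_inv_smul (n m : ℕ) (H : Type*) [Group H] [TopologicalSpace H]
    [ChartedSpace (EuclideanSpace ℝ (Fin n)) H] [LieGroup (𝓡 n) ∞ H]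
    (M : Type*) [TopologicalSpace M] [ChartedSpace (EuclideanSpace ℝ (Fin m)) M]
    [MulAction H M] [ContMDiffSMul (𝓡 n) (𝓡 m) ∞ H M] :
    Continuous fun p : H × M => p.1⁻¹ • p.2 := by
  have h1 : Continuous fun p : H × M => p.1 • p.2 :=
    (contMDiff_smul (I := 𝓡 n) (I' := 𝓡 m) (n := ∞) (G := H) (M := M)).continuous
  have h2 : Continuous fun h : H => h⁻¹ := (contMDiff_inv (𝓡 n) ∞).continuous
  exact h1.comp ((h2.comp continuous_fst).prodMk continuous_snd)

variable (E : M → Type*) [∀ x, AddCommGroup (E x)] [∀ x, Module ℂ (E x)]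
  [∀ x, TopologicalSpace (E x)] [TopologicalSpace (TotalSpace (Fin r → ℂ) E)]
  [FiberBundle (Fin r → ℂ) E]

/-- A coordinate patch at `h₀⁻¹ • x₀` which contains the supports of the pullbacks of test measures
supported near `x₀` under elements near `h₀`. -/
theorem exists_patch (hc : Continuous fun p : H × M => p.1⁻¹ • p.2) (h₀ : H) {x₀ : M} {V : Set M} (hV : IsOpen V) (hx₀ : x₀ ∈ V) :
    ∃ e ∈ IsManifold.maximalAtlas (𝓡 m) ∞ M,
      ∃ t : Trivialization (Fin r → ℂ) (π (Fin r → ℂ) E), MemTrivializationAtlas t ∧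
      ∃ K : Set M, IsCompact K ∧ K ⊆ e.source ∩ t.baseSet ∧ (∀ x ∈ K, h₀ • x ∈ V) ∧
      ∃ O : Set M, IsOpen O ∧ x₀ ∈ O ∧ O ⊆ V ∧ ∀ᶠ h in 𝓝 h₀, ∀ x ∈ O, h⁻¹ • x ∈ K := by
  have : LocallyCompactSpace M := ChartedSpace.locallyCompactSpace (Eu m) M
  let z₀ := h₀⁻¹ • x₀
  let e := chartAt (Eu m) z₀
  let t := trivializationAt (Fin r → ℂ) E z₀
  have hW : IsOpen ((e.source ∩ t.baseSet) ∩ (fun x => h₀ • x) ⁻¹' V) :=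
    (e.open_source.inter t.open_baseSet).inter
      (hV.preimage (by
        have := hc.comp (Continuous.prodMk_right h₀⁻¹)
        simpa [Function.comp_def] using this))
  obtain ⟨K, hK, hzK, hKW⟩ := exists_compact_subset hW (x := z₀)
    ⟨⟨mem_chart_source _ _, FiberBundle.mem_baseSet_trivializationAt' _⟩, by
      simpa [z₀] using hx₀⟩
  have hc := (hc.continuousAt (x := (h₀, x₀))).eventually
    (isOpen_interior.mem_nhds hzK)
  rw [nhds_prod_eq] at hc
  obtain ⟨pa, hpa, pb, hpb, hab⟩ := Filter.eventually_prod_iff.1 hc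
  obtain ⟨O, hO, hOo, hxO⟩ := eventually_nhds_iff.1 hpb
  refine ⟨e, IsManifold.chart_mem_maximalAtlas z₀, t, inferInstance, K, hK,
    hKW.trans inter_subset_left, fun x hx => (hKW hx).2, O ∩ V, hOo.inter hV, ⟨hxO, hx₀⟩,
    inter_subset_right, ?_⟩
  filter_upwards [hpa] with h hh x hx
  exact interior_subset (hab hh (hO x hx.1))

variable {E} [VectorBundle ℂ (Fin r → ℂ) E] [ContMDiffVectorBundle ∞ (Fin r → ℂ) E (𝓡 m)]
  (L : EquivariantLift n m r H E) (σ : Distribution E m r)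

theorem pullback_eq_zero_of_patch {h : H} {φ : testMeasures E m r} {K K' O : Set M}
    (hφ : ∀ x ∉ K', φ.1 x = 0) (hK' : K' ⊆ O) (hO : ∀ x ∈ O, h⁻¹ • x ∈ K) :
    ∀ x ∉ K, (pullback L h φ).1 x = 0 := by
  intro x hx
  refine pullback_apply_eq_zero L (hφ _ fun hK => hx ?_)
  simpa using hO _ (hK' hK)

/-- For h near h₀ the pullbacks of all test measures supported near x₀ live in one compact
coordinate patch at h₀⁻¹ x₀. There σ is controlled by finitely many derivatives, and the unweighted
case c = 0 of `pullback_bound` controls these by derivatives of φ. -/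
theorem exists_local_bound (h₀ : H) {e' : OpenPartialHomeomorph M (Eu m)}
    (he' : e' ∈ IsManifold.maximalAtlas (𝓡 m) ∞ M)
    (t' : Trivialization (Fin r → ℂ) (π (Fin r → ℂ) E)) [MemTrivializationAtlas t']
    {x₀ : M} (hx₀ : x₀ ∈ e'.source ∩ t'.baseSet) :
    ∃ O : Set M, IsOpen O ∧ x₀ ∈ O ∧ ∃ (C : ℝ) (N : ℕ), 0 ≤ C ∧ ∀ᶠ h in 𝓝 h₀,
      ∀ (φ : testMeasures E m r) (K : Set M), IsCompact K → K ⊆ O → (∀ x ∉ K, φ.1 x = 0) →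
      ∀ B : ℝ, 0 ≤ B → (∀ q ≤ N, ∀ (v : Fin q → Fin m) (j : Fin r), ∀ y ∈ e' '' K,
        ‖partialDeriv v (component φ.1 e' t' j) y‖ ≤ B) → ‖translate L h σ φ‖ ≤ C * B := by
  obtain ⟨e, he, t, ht, Kc, hKc, hKe, hKV, O, hO, hxO, hOV, hOK⟩ :=
    exists_patch (m := m) (r := r) E (continuous_inv_smul n m H M) h₀ (e'.open_source.inter t'.open_baseSet) hx₀
  obtain ⟨C, N, hC, hσ⟩ := σ.exists_bound he t hKc hKe
  set a := (chartAt (Eu n) h₀).symm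
  set ξ₀ := chartAt (Eu n) h₀ h₀
  have haξ : a ξ₀ = h₀ := (chartAt (Eu n) h₀).left_inv (mem_chart_source _ h₀)
  have ha := eventually_contMDiffAt_chart_symm (n := n) h₀
  have hKec : IsCompact (e '' Kc) :=
    hKc.image_of_continuousOn (e.continuousOn.mono fun x hx => (hKe hx).1)
  obtain ⟨C', hC', hb⟩ := IsCompact.exists_eventually_forall (x₀ := ξ₀) hKec
    (P := fun C ξ y => ∀ (φ : testMeasures E m r) (K : Set M), IsCompact K → K ⊆ O →
      (∀ x ∉ K, φ.1 x = 0) → ∀ B : ℝ, 0 ≤ B →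
      (∀ q ≤ N, ∀ (v : Fin q → Fin m) (j : Fin r), ∀ y ∈ e' '' K,
        ‖partialDeriv v (component φ.1 e' t' j) y‖ ≤ B) → ∀ q ≤ N, ∀ (w : Fin q → Fin m)
        (i : Fin r), ‖partialDeriv w (component (pullback L (a ξ) φ).1 e t i) y‖ ≤ C * B)
    (fun C C' ξ y hCC h φ K hK hKO hφ B hB hb q hq w i =>
      (h φ K hK hKO hφ B hB hb q hq w i).trans (by gcongr)) (by
    rintro _ ⟨x, hx, rfl⟩
    have hxe := (hKe hx).1
    have hy : e x ∈ e.target ∩ e.symm ⁻¹' t.baseSet := ⟨e.map_source hxe, by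
      simpa [e.left_inv hxe] using (hKe hx).2⟩
    have h0 : a ξ₀ • e.symm (e x) ∈ e'.source ∩ t'.baseSet := by
      rw [haξ, e.left_inv hxe]
      exact hKV x hx
    have hΘs := smoothNear_actionMap he he' ha hy.1 h0.1
    obtain ⟨C, hC, hb⟩ := pullback_bound he he' t t' ha hy h0 L (c := 0) (fun j => by
      have : letterDeg 0 j = 0 := by simp [letterDeg]
      rw [this]
      exact SmoothNear.sym (F := fun ξ y => ((actionMap e e' (a ξ) y j : ℝ) : ℂ)) (hΘs.coord j)) N
    refine ⟨C, ?_⟩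
    filter_upwards [hb, eventually_family_mem ha hy.1 e'.open_source h0.1] with p hp hm
      φ K hK hKO hφ B hB hbd q hq w i
    have h1 := hp φ B hB ?_ q hq w i
    · simpa [wordDeg_zero] using h1
    · intro q hq v j
      rw [wordDeg_zero, pow_zero, one_mul]
      -- The hypothesis controls derivatives only over `K`; at image points outside `K` the
      -- components vanish identically nearby.
      by_cases hK' : a p.1 • e.symm p.2 ∈ K
      · exact hbd q hq v j _ ⟨_, hK', rfl⟩
      · have h1 : component φ.1 e' t' j =ᶠ[𝓝 (actionMap e e' (a p.1) p.2)] fun _ => 0 :=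
          component_eventuallyEq_zero φ.1 hK hφ t' j (e'.map_source hm.2.2) (by
            rw [actionMap, e'.left_inv (show a p.1 • e.symm p.2 ∈ e'.source from hm.2.2)]
            exact hK')
        rw [partialDeriv_congr v h1, partialDeriv_zero_fun, norm_zero]
        exact hB)
  refine ⟨O, hO, hxO, C * C', N, mul_nonneg hC hC', ?_⟩
  filter_upwards [eventually_of_chart (n := n) h₀ hb, hOK] with h hξ hhO φ K hK hKO hφ B hB hbd
  obtain ⟨ξ, hh, rfl⟩ := hξ
  rw [mul_assoc]
  exact hσ _ (pullback_eq_zero_of_patch L hφ hKO hhO) _ (mul_nonneg hC' hB) fun y hy q hq w i =>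
    hh y hy φ K hK hKO hφ B hB hbd q hq w i

/-- The components of a pullback are smooth jointly in the group parameter and the point. Hence,
uniformly on a compact patch, the derivatives up to the order of σ of the difference of the
pullbacks under h and h₀ tend to zero as h tends to h₀. -/
theorem exists_local_continuousAt (h₀ : H) (x₀ : M) :
    ∃ O : Set M, IsOpen O ∧ x₀ ∈ O ∧ ∀ (φ : testMeasures E m r) (K : Set M), K ⊆ O →
      (∀ x ∉ K, φ.1 x = 0) → ContinuousAt (fun h => translate L h σ φ) h₀ := by
  let e' := chartAt (Eu m) x₀
  let t' := trivializationAt (Fin r → ℂ) E x₀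
  have he' : e' ∈ IsManifold.maximalAtlas (𝓡 m) ∞ M := IsManifold.chart_mem_maximalAtlas x₀
  obtain ⟨e, he, t, ht, Kc, hKc, hKe, hKV, O, hO, hxO, hOV, hOK⟩ :=
    exists_patch (m := m) (r := r) E (continuous_inv_smul n m H M) h₀ (e'.open_source.inter t'.open_baseSet)
      ⟨mem_chart_source _ _, FiberBundle.mem_baseSet_trivializationAt' x₀⟩
  obtain ⟨C, N, hC, hσ⟩ := σ.exists_bound he t hKc hKe
  refine ⟨O, hO, hxO, fun φ K hKO hφ => ?_⟩
  set a := (chartAt (Eu n) h₀).symm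
  set ξ₀ := chartAt (Eu n) h₀ h₀
  have haξ : a ξ₀ = h₀ := (chartAt (Eu n) h₀).left_inv (mem_chart_source _ h₀)
  have ha := eventually_contMDiffAt_chart_symm (n := n) h₀
  have hKec : IsCompact (e '' Kc) :=
    hKc.image_of_continuousOn (e.continuousOn.mono fun x hx => (hKe hx).1)
  rw [ContinuousAt, Metric.tendsto_nhds]
  intro ε hε
  let δ := ε / (C + 1)
  have hδ : 0 < δ := by positivity
  have key : ∀ᶠ ξ in 𝓝 ξ₀, ∀ y ∈ e '' Kc, ∀ q ∈ Finset.range (N + 1), ∀ (w : Fin q → Fin m)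
      (i : Fin r), ‖partialDeriv w (component (pullback L (a ξ) φ - pullback L h₀ φ).1 e t i) y‖
        ≤ δ := by
    refine hKec.eventually_forall_of_forall_eventually ?_
    rintro _ ⟨x, hx, rfl⟩
    have hxe := (hKe hx).1
    have hy : e x ∈ e.target ∩ e.symm ⁻¹' t.baseSet := ⟨e.map_source hxe, by
      simpa [e.left_inv hxe] using (hKe hx).2⟩
    have h0 : a ξ₀ • e.symm (e x) ∈ e'.source ∩ t'.baseSet := by
      rw [haξ, e.left_inv hxe]
      exact hKV x hx
    refine (Finset.eventually_all _).2 fun q _ => eventually_all.2 fun w => eventually_all.2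
      fun i => ?_
    have h1 := smoothNear_component_pullback he he' t t' ha hy h0 L φ i
    have h2 : SmoothNear (fun p : Eu n × Eu m =>
        component (pullback L h₀ φ).1 e t i p.2) (ξ₀, e x) :=
      SmoothNear.comp (g := Prod.snd) (y := (ξ₀, e x))
        (smoothNear_component _ he t i hy.1 hy.2) (smoothNear_of_contDiff contDiff_snd)
    have h3 : SmoothNear (Function.uncurry fun ξ y =>
        component (pullback L (a ξ) φ - pullback L h₀ φ).1 e t i y) (ξ₀, e x) := by
      filter_upwards [h1, h2] with p hp1 hp2 using hp1.sub hp2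
    have h4 := (h3.family_partialDeriv w).contDiffAt.continuousAt.norm
    refine (h4.eventually_lt continuousAt_const ?_).mono fun p hp => hp.le
    have h5 : component (pullback L (a ξ₀) φ - pullback L h₀ φ).1 e t i = fun _ => 0 := by
      rw [haξ, sub_self]
      rfl
    change ‖partialDeriv w (component (pullback L (a ξ₀) φ - pullback L h₀ φ).1 e t i) (e x)‖ < δ
    rw [h5, partialDeriv_zero_fun, norm_zero]
    exact hδ
  filter_upwards [eventually_of_chart (n := n) h₀ key, hOK] with h hξ hhO
  obtain ⟨ξ, hh, rfl⟩ := hξ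
  have h1 := hσ (pullback L (a ξ) φ - pullback L h₀ φ) (fun x hx => ?_) δ hδ.le fun y hy q hq w i =>
    hh y hy q (by simpa [Nat.lt_succ_iff] using hq) w i
  · rw [map_sub] at h1
    rw [dist_eq_norm]
    calc _ ≤ C * δ := h1
      _ < (C + 1) * δ := by gcongr; linarith
      _ = ε := by simp only [δ]; field_simp
  · have e1 := pullback_eq_zero_of_patch L hφ hKO hhO x hx
    have e2 := pullback_eq_zero_of_patch L hφ hKO hOK.self_of_nhds x hx
    change (pullback L (a ξ) φ).1 x - (pullback L h₀ φ).1 x = 0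
    rw [e1, e2, sub_self]

variable [SigmaCompactSpace M]

theorem continuous_translate (φ : testMeasures E m r) :
    Continuous fun h => translate L h σ φ := by
  refine continuous_iff_continuousAt.2 fun h₀ => ?_
  obtain ⟨K, hK, hφ⟩ := φ.2.2.2
  choose O hO hxO hc using fun x₀ => exists_local_continuousAt L σ h₀ x₀
  obtain ⟨s, χ, hs, hχ, hsum⟩ := exists_sum_mulTest (m := m) (E := E) (r := r) hK (P := O)
    fun x _ => ⟨hO x, hxO x⟩
  have h1 : (fun h => translate L h σ φ) = fun h => ∑ x ∈ s, translate L h σ (mulTest (χ x) φ) := by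
    funext h
    rw [← map_sum, ← hsum φ hφ]
  rw [h1]
  exact tendsto_finsetSum _ fun x _ => hc x _ _ (inter_subset_right.trans (hχ x))
    (mulTest_eq_zero hφ)

/-- Continuity of the translates, locally uniformly in the group element. -/
theorem exists_eventually_bound (h₀ : H) {e : OpenPartialHomeomorph M (Eu m)}
    (he : e ∈ IsManifold.maximalAtlas (𝓡 m) ∞ M)
    (t : Trivialization (Fin r → ℂ) (π (Fin r → ℂ) E)) [MemTrivializationAtlas t]
    {K : Set M} (hK : IsCompact K) (hKe : K ⊆ e.source ∩ t.baseSet) :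
    ∃ (C : ℝ) (N : ℕ), 0 ≤ C ∧ ∀ᶠ h in 𝓝 h₀, ∀ φ : testMeasures E m r, (∀ x ∉ K, φ.1 x = 0) →
      ∀ B : ℝ, 0 ≤ B → (∀ q ≤ N, ∀ (i : Fin r), ∀ y ∈ e '' K,
        ‖iteratedFDeriv ℝ q (component φ.1 e t i) y‖ ≤ B) → ‖translate L h σ φ‖ ≤ C * B := by
  -- The condition x₀ ∈ `K` is placed inside the existential so that the neighbourhoods can be
  -- chosen as a function on all of `M`.
  have hloc : ∀ x₀ : M, ∃ O : Set M, x₀ ∈ K → IsOpen O ∧ x₀ ∈ O ∧ ∃ (C : ℝ) (N : ℕ), 0 ≤ C ∧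
      ∀ᶠ h in 𝓝 h₀,
      ∀ (φ : testMeasures E m r) (K : Set M), IsCompact K → K ⊆ O → (∀ x ∉ K, φ.1 x = 0) →
      ∀ B : ℝ, 0 ≤ B → (∀ q ≤ N, ∀ (v : Fin q → Fin m) (j : Fin r), ∀ y ∈ e '' K,
        ‖partialDeriv v (component φ.1 e t j) y‖ ≤ B) → ‖translate L h σ φ‖ ≤ C * B := fun x₀ => by
    by_cases hx : x₀ ∈ K
    · obtain ⟨O, h⟩ := exists_local_bound L σ h₀ he t (hKe hx)
      exact ⟨O, fun _ => h⟩
    · exact ⟨∅, fun h => absurd h hx⟩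
  choose O hO using hloc
  obtain ⟨s, χ, hs, hχ, hsum⟩ := exists_sum_mulTest (m := m) (E := E) (r := r) hK (P := O)
    fun x hx => ⟨(hO x hx).1, (hO x hx).2.1⟩
  -- the derivatives of a product with a cut-off function
  have hmul : ∀ x N, ∃ C : ℝ, 0 ≤ C ∧ ∀ (φ : testMeasures E m r) (B : ℝ), 0 ≤ B →
      (∀ q ≤ N, ∀ (i : Fin r), ∀ y ∈ e '' K,
        ‖iteratedFDeriv ℝ q (component φ.1 e t i) y‖ ≤ B) →
      ∀ q ≤ N, ∀ (v : Fin q → Fin m) (j : Fin r), ∀ y ∈ e '' K,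
        ‖partialDeriv v (component (mulTest (χ x) φ).1 e t j) y‖ ≤ C * B := by
    intro x N
    have hKec : IsCompact (e '' K) :=
      hK.image_of_continuousOn (e.continuousOn.mono fun x hx => (hKe hx).1)
    have hX : ContDiffOn ℝ ∞ (fun y => (χ x (e.symm y) : ℂ)) e.target :=
      Complex.ofRealCLM.contDiff.comp_contDiffOn (contMDiffOn_iff_contDiffOn.1
        ((χ x).contMDiff.comp_contMDiffOn (contMDiffOn_symm_of_mem_maximalAtlas he)))
    have hXc : ∀ q : ℕ, ∃ A : ℝ, ∀ y ∈ e '' K,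
        ‖iteratedFDeriv ℝ q (fun y => (χ x (e.symm y) : ℂ)) y‖ ≤ A := fun q => by
      refine hKec.exists_bound_of_continuousOn ?_
      rintro _ ⟨z, hz, rfl⟩
      refine ContinuousAt.continuousWithinAt ?_
      exact ((hX.contDiffAt (e.open_target.mem_nhds (e.map_source (hKe hz).1))).iteratedFDeriv_right
        (m := 0) (i := q) (by exact_mod_cast le_top)).continuousAt
    choose A hA using hXc
    refine ⟨∑ q ∈ Finset.range (N + 1), ∑ l ∈ Finset.range (q + 1), (q.choose l : ℝ) * |A l|,
      by positivity, fun φ B hB hb q hq v j y hy => ?_⟩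
    obtain ⟨z, hz, hzy⟩ := id hy
    have hye : y ∈ e.target := hzy ▸ e.map_source (hKe hz).1
    have hyt : e.symm y ∈ t.baseSet := by rw [← hzy, e.left_inv (hKe hz).1]; exact (hKe hz).2
    refine (norm_partialDeriv_le v _ y).trans ?_
    rw [component_mulTest]
    have hW := e.isOpen_inter_preimage_symm t.open_baseSet
    have h1 := norm_iteratedFDerivWithin_mul_le (𝕜 := ℝ) (hX.mono inter_subset_left)
      (φ.2.2.1 e he t j) hW.uniqueDiffOn (x := y) ⟨hye, hyt⟩ (n := q) (by exact_mod_cast le_top)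
    simp only [iteratedFDerivWithin_of_isOpen _ hW (show y ∈ _ from ⟨hye, hyt⟩)] at h1
    refine h1.trans ?_
    calc _ ≤ ∑ l ∈ Finset.range (q + 1), (q.choose l : ℝ) * |A l| * B := by
          refine Finset.sum_le_sum fun l _ => ?_
          gcongr
          · exact (hA l y hy).trans (le_abs_self _)
          · exact hb _ ((Nat.sub_le _ _).trans hq) j y hy
      _ = (∑ l ∈ Finset.range (q + 1), (q.choose l : ℝ) * |A l|) * B := by rw [Finset.sum_mul]
      _ ≤ _ := by
          gcongr
          exact Finset.single_le_sum
            (f := fun q => ∑ l ∈ Finset.range (q + 1), (q.choose l : ℝ) * |A l|)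
            (fun q _ => by positivity) (by simpa [Nat.lt_succ_iff] using hq)
  have hN : ∀ x, ∃ (C : ℝ) (N : ℕ), 0 ≤ C ∧ (x ∈ s → ∀ᶠ h in 𝓝 h₀,
      ∀ (φ : testMeasures E m r) (K : Set M), IsCompact K → K ⊆ O x → (∀ x ∉ K, φ.1 x = 0) →
      ∀ B : ℝ, 0 ≤ B → (∀ q ≤ N, ∀ (v : Fin q → Fin m) (j : Fin r), ∀ y ∈ e '' K,
        ‖partialDeriv v (component φ.1 e t j) y‖ ≤ B) → ‖translate L h σ φ‖ ≤ C * B) := by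
    intro x
    by_cases hx : x ∈ s
    · obtain ⟨C, N, hC, h⟩ := (hO x (hs x hx)).2.2
      exact ⟨C, N, hC, fun _ => h⟩
    · exact ⟨0, 0, le_rfl, fun h => absurd h hx⟩
  choose C N hC hb using hN
  choose A hA0 hA using fun x => hmul x (N x)
  refine ⟨∑ x ∈ s, C x * A x, s.sup N,
    Finset.sum_nonneg fun x _ => mul_nonneg (hC x) (hA0 x), ?_⟩
  filter_upwards [(Finset.eventually_all s).2 hb] with h hh φ hφ B hB hbd
  rw [hsum φ hφ, map_sum, Finset.sum_mul]
  refine (norm_sum_le _ _).trans (Finset.sum_le_sum fun x hx => ?_)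
  rw [mul_assoc]
  refine hh x hx _ (K ∩ tsupport (χ x)) (hK.inter_right (isClosed_tsupport _))
    (inter_subset_right.trans (hχ x)) (mulTest_eq_zero hφ) _ (mul_nonneg (hA0 x) hB) ?_
  intro q hq v j y hy
  exact hA x φ B hB (fun q hq i y hy => hbd q (hq.trans (Finset.le_sup hx)) i y hy) q hq v j y
    (image_mono inter_subset_left hy)

theorem exists_uniform_bound {Ω : Set H} (hΩ : IsCompact Ω) {e : OpenPartialHomeomorph M (Eu m)}
    (he : e ∈ IsManifold.maximalAtlas (𝓡 m) ∞ M)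
    (t : Trivialization (Fin r → ℂ) (π (Fin r → ℂ) E)) [MemTrivializationAtlas t]
    {K : Set M} (hK : IsCompact K) (hKe : K ⊆ e.source ∩ t.baseSet) :
    ∃ (C : ℝ) (N : ℕ), 0 ≤ C ∧ ∀ h ∈ Ω, ∀ φ : testMeasures E m r, (∀ x ∉ K, φ.1 x = 0) →
      ∀ B : ℝ, 0 ≤ B → (∀ q ≤ N, ∀ (i : Fin r), ∀ y ∈ e '' K,
        ‖iteratedFDeriv ℝ q (component φ.1 e t i) y‖ ≤ B) → ‖translate L h σ φ‖ ≤ C * B := by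
  refine hΩ.induction_on (p := fun s => ∃ (C : ℝ) (N : ℕ), 0 ≤ C ∧ ∀ h ∈ s,
    ∀ φ : testMeasures E m r, (∀ x ∉ K, φ.1 x = 0) →
      ∀ B : ℝ, 0 ≤ B → (∀ q ≤ N, ∀ (i : Fin r), ∀ y ∈ e '' K,
        ‖iteratedFDeriv ℝ q (component φ.1 e t i) y‖ ≤ B) → ‖translate L h σ φ‖ ≤ C * B)
    ⟨0, 0, le_rfl, by simp⟩ ?_ ?_ ?_
  · rintro s t hst ⟨C, N, hC, h⟩
    exact ⟨C, N, hC, fun x hx => h x (hst hx)⟩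
  · rintro s t ⟨C, N, hC, h⟩ ⟨C', N', hC', h'⟩
    refine ⟨C + C', max N N', add_nonneg hC hC', fun x hx φ hφ B hB hb => ?_⟩
    rcases hx with hx | hx
    · refine (h x hx φ hφ B hB fun q hq => hb q (hq.trans (le_max_left _ _))).trans ?_
      gcongr
      linarith
    · refine (h' x hx φ hφ B hB fun q hq => hb q (hq.trans (le_max_right _ _))).trans ?_
      gcongr
      linarith
  · intro h₀ _
    obtain ⟨C, N, hC, h⟩ := exists_eventually_bound L σ h₀ he t hK hKe
    exact ⟨_, mem_nhdsWithin_of_mem_nhds h, C, N, hC, fun x hx => hx⟩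

variable [T2Space H] [SigmaCompactSpace H] [MeasurableSpace H] [BorelSpace H]

theorem integrableOn_translate (μ : Measure H) [IsFiniteMeasureOnCompacts μ] {ρ : H → ℂ}
    (hρ : Continuous ρ) {Ω : Set H} (hΩ : IsCompact Ω) (φ : testMeasures E m r) :
    IntegrableOn (fun h => ρ h * translate L h σ φ) Ω μ :=
  (hρ.mul (continuous_translate L σ φ)).continuousOn.integrableOn_compact hΩ

/-- The distribution `∫_Ω ℓ_h σ ρ(h) dμ(h)`. -/
def integrated (μ : Measure H) [IsFiniteMeasureOnCompacts μ] {ρ : H → ℂ}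
    (hρ : Continuous ρ) {Ω : Set H} (hΩ : IsCompact Ω) : Distribution E m r where
  pairing :=
    { toFun := fun φ => ∫ h in Ω, ρ h * translate L h σ φ ∂μ
      map_add' := fun φ ψ => by
        rw [← integral_add (integrableOn_translate L σ μ hρ hΩ φ)
          (integrableOn_translate L σ μ hρ hΩ ψ)]
        simp only [map_add, mul_add]
      map_smul' := fun c φ => by
        rw [RingHom.id_apply, smul_eq_mul, ← integral_const_mul]
        simp only [map_smul, smul_eq_mul, mul_left_comm] }
  continuous := fun e he t _ K hK hKe => by
    obtain ⟨C, N, hC, h⟩ := exists_uniform_bound L σ hΩ he t hK hKe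
    -- Continuity is demanded for every real `B`. A point and an index force `B` to be nonnegative;
    -- without them the hypothesis is vacuous, and the uniform bound with `B` = 0 shows that the
    -- translates vanish on φ.
    by_cases hne : (e '' K).Nonempty ∧ Nonempty (Fin r)
    · obtain ⟨⟨y₀, hy₀⟩, ⟨i₀⟩⟩ := hne
      refine ⟨(∫ h in Ω, ‖ρ h‖ ∂μ) * C, N, fun φ hφ B hb => ?_⟩
      have hB : 0 ≤ B := (norm_nonneg _).trans (hb 0 (Nat.zero_le _) i₀ y₀ hy₀)
      have hint : IntegrableOn (fun h => ‖ρ h‖ * (C * B)) Ω μ :=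
        (hρ.norm.mul continuous_const).continuousOn.integrableOn_compact hΩ
      rw [mul_assoc, ← integral_mul_const]
      refine norm_integral_le_of_norm_le hint ?_
      filter_upwards [ae_restrict_mem hΩ.measurableSet] with x hx
      rw [norm_mul]
      gcongr
      exact h x hx φ hφ B hB hb
    · refine ⟨0, 0, fun φ hφ B _ => ?_⟩
      have h0 : ∀ h ∈ Ω, translate L h σ φ = 0 := fun h' hh => by
        have := h h' hh φ hφ 0 le_rfl fun q _ i y hy => absurd ⟨⟨y, hy⟩, ⟨i⟩⟩ hne
        simpa using this
      have : ∫ h in Ω, ρ h * translate L h σ φ ∂μ = 0 := by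
        rw [setIntegral_congr_fun (g := fun _ => (0 : ℂ)) hΩ.measurableSet fun x hx => by
          simp [h0 x hx]]
        simp
      change ‖∫ h in Ω, ρ h * translate L h σ φ ∂μ‖ ≤ _
      rw [this]
      simp

end Integration

/-! ### Weighted estimates for distributions vanishing along a submanifold -/

section EuclideanEstimate

variable {m : ℕ} {κ : OpenPartialHomeomorph (Eu m) (Eu m)}

theorem setLIntegral_jac_mul_comp (hκ : ContDiffOn ℝ ∞ κ κ.source) {A : Set (Eu m)}
    (hA : MeasurableSet A) (hAκ : A ⊆ κ.source) (g : Eu m → ENNReal) :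
    ∫⁻ y in A, ENNReal.ofReal (jac κ y) * g (κ y) = ∫⁻ x in κ '' A, g x :=
  (lintegral_image_eq_lintegral_abs_det_fderiv_mul volume hA (f' := fderiv ℝ κ) (fun y hy =>
    ((hκ.contDiffAt (κ.open_source.mem_nhds (hAκ hy))).differentiableAt
      (by simp)).hasFDerivAt.hasFDerivWithinAt) (κ.injOn.mono hAκ) g).symm

/-- The smooth inverse carries null sets to null sets. -/
theorem ae_restrict_comp
    (hκ' : ContDiffOn ℝ ∞ κ.symm κ.target) {p : Eu m → Prop} (hp : ∀ᵐ x : Eu m, p x) :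
    ∀ᵐ y : Eu m, y ∈ κ.source → p (κ y) := by
  have h1 : volume (κ.symm '' (κ.target ∩ {x | ¬ p x})) = 0 := by
    refine addHaar_image_eq_zero_of_differentiableOn_of_addHaar_eq_zero volume
      ((hκ'.differentiableOn (by simp)).mono inter_subset_left) ?_
    exact measure_mono_null inter_subset_right (ae_iff.1 hp)
  filter_upwards [measure_eq_zero_iff_ae_notMem.1 h1] with y hy hys
  by_contra h
  exact hy ⟨κ y, ⟨κ.map_source hys, h⟩, κ.left_inv hys⟩

/-- Almost everywhere the transpose equals the Jacobian times the transpose of the transported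
operator, which is bounded by the weighted derivatives; the Jacobian is then absorbed by the change
of variables. -/
theorem setLIntegral_transpose_le {c k : ℕ} (hcm : c ≤ m) (hκ : ContDiffOn ℝ ∞ κ κ.source)
    (hκ' : ContDiffOn ℝ ∞ κ.symm κ.target) {D : DiffOp m} {Z' : Set (Eu m)} {f : Eu m → ℂ}
    (hZ' : ∀ y ∈ κ.source, y ∈ Z' ↔ nrm c (κ y) = 0) (hDs : D.SmoothOn κ.source)
    (hD : D.TangentialOn Z' κ.source) (hf : MemIdealPow Z' k κ.source f)
    {A : Set (Eu m)} (hA : MeasurableSet A) (hAκ : A ⊆ κ.source) {C b : ℝ} (hb : 0 ≤ b)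
    (hC : ∀ x ∈ κ '' A, ∀ g : Eu m → ℂ, SmoothNear g x → (nrm c x = 0 → c = 0) →
      ∀ B : ℝ, (∀ q' ≤ D.order, ∀ v : Fin q' → Fin m,
        nrm c x ^ (k + wordDeg c v) * ‖partialDeriv v g x‖ ≤ B) →
      ‖(D.conj κ f).transpose g x‖ ≤ C * B)
    {h : Eu m → ℂ} (hh : ∀ y ∈ A, ‖h y‖ ≤ b) {g F : Eu m → ℂ} (hg : ContDiffOn ℝ ∞ g κ.target)
    (hF : ∀ y ∈ κ.source, F y = (jac κ y : ℂ) * g (κ y)) {W : Eu m → ℝ}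
    (hW : ∀ x, ∀ q' ≤ D.order, ∀ v : Fin q' → Fin m,
      nrm c x ^ (k + wordDeg c v) * ‖partialDeriv v g x‖ ≤ W x) :
    ∫⁻ y in A, ‖h y * D.transpose (fun z => f z * F z) y‖ₑ ≤
      ENNReal.ofReal (b * C) * ∫⁻ x in κ '' A, ENNReal.ofReal (W x) := by
  have hP : (D.conj κ f).SmoothOn κ.target := fun q w =>
    (DiffOp.conj_coeff_mem hκ hκ' hZ' hD hf q w).1
  rw [← setLIntegral_jac_mul_comp hκ hA hAκ, ← lintegral_const_mul' _ _ ENNReal.ofReal_ne_top]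
  refine lintegral_mono_ae ?_
  filter_upwards [ae_restrict_mem hA, ae_restrict_of_ae (DiffOp.transpose_conj hκ hκ' hDs hf.1 hP hg),
    ae_restrict_of_ae (ae_restrict_comp hκ' (ae_nrm_eq_zero_imp hcm))] with y hyA hy hy0
  have hyκ := hAκ hyA
  have e1 : D.transpose (fun z => f z * F z) y =
      D.transpose (fun z => f z * ((jac κ z : ℂ) * g (κ z))) y := by
    refine D.transpose_congr ?_
    filter_upwards [κ.open_source.mem_nhds hyκ] with z hz
    rw [hF z hz]
  have hj : 0 ≤ jac κ y := abs_nonneg _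
  have e2 : ‖h y * D.transpose (fun z => f z * F z) y‖ ≤ b * C * (jac κ y * W (κ y)) := by
    rw [e1, hy hyκ, norm_mul, norm_mul, Complex.norm_real, Real.norm_of_nonneg hj]
    have h1 := hC (κ y) ⟨y, hyA, rfl⟩ g (smoothNear_of_contDiffOn hg κ.open_target
      (κ.map_source hyκ)) (hy0 hyκ) (W (κ y)) (hW (κ y))
    calc _ ≤ b * (jac κ y * (C * W (κ y))) := by
          gcongr
          exact hh y hyA
      _ = _ := by ring
  rw [← ofReal_norm, ← ENNReal.ofReal_mul hj]
  -- The sign of `C` is left open. If the product is negative the pointwise bound forces the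
  -- integrand to vanish, since W is nonnegative, as the empty word shows.
  by_cases hC0 : 0 ≤ b * C
  · rw [← ENNReal.ofReal_mul hC0]
    exact ENNReal.ofReal_le_ofReal e2
  · have : ‖h y * D.transpose (fun z => f z * F z) y‖ ≤ 0 := by
      have hW0 : 0 ≤ W (κ y) := (mul_nonneg (pow_nonneg (nrm_nonneg c _) _) (norm_nonneg _)).trans
        (hW (κ y) 0 (Nat.zero_le _) Fin.elim0)
      exact e2.trans (mul_nonpos_of_nonpos_of_nonneg (not_le.1 hC0).le (mul_nonneg hj hW0))
    rw [ENNReal.ofReal_of_nonpos this]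
    exact zero_le

end EuclideanEstimate

/-! ### The weighted estimate for a distribution vanishing along a submanifold -/

section Weights

variable {m r : ℕ} {M : Type*} [TopologicalSpace M] [ChartedSpace (EuclideanSpace ℝ (Fin m)) M]
  {E : M → Type*} [∀ x, AddCommGroup (E x)] [∀ x, Module ℂ (E x)]
  [∀ x, TopologicalSpace (E x)] [TopologicalSpace (TotalSpace (Fin r → ℂ) E)]

/-- The sum of the weighted absolute values of the derivatives of the components of a density. -/
def weight (k c d : ℕ) (e : OpenPartialHomeomorph M (Eu m))
    (t : Trivialization (Fin r → ℂ) (π (Fin r → ℂ) E)) (φ : DualField E m) (x : Eu m) : ℝ :=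
  ∑ i : Fin r, ∑ q ∈ Finset.range (d + 1), ∑ w : Fin q → Fin m,
    nrm c x ^ (k + wordDeg c w) * ‖partialDeriv w (component φ e t i) x‖

variable {k c d : ℕ} {e : OpenPartialHomeomorph M (Eu m)}
  {t : Trivialization (Fin r → ℂ) (π (Fin r → ℂ) E)} {φ : DualField E m} {x : Eu m}

theorem weight_term_nonneg {q : ℕ} (w : Fin q → Fin m) (i : Fin r) :
    0 ≤ nrm c x ^ (k + wordDeg c w) * ‖partialDeriv w (component φ e t i) x‖ :=
  mul_nonneg (pow_nonneg (nrm_nonneg c x) _) (norm_nonneg _)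

theorem weight_nonneg : 0 ≤ weight k c d e t φ x :=
  Finset.sum_nonneg fun i _ => Finset.sum_nonneg fun q _ => Finset.sum_nonneg fun w _ =>
    weight_term_nonneg w i

theorem le_weight {q : ℕ} (hq : q ≤ d) (w : Fin q → Fin m) (i : Fin r) :
    nrm c x ^ (k + wordDeg c w) * ‖partialDeriv w (component φ e t i) x‖ ≤
      weight k c d e t φ x := by
  have h1 : ∀ i (q : ℕ), 0 ≤ ∑ w : Fin q → Fin m,
      nrm c x ^ (k + wordDeg c w) * ‖partialDeriv w (component φ e t i) x‖ := fun i q =>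
    Finset.sum_nonneg fun w _ => weight_term_nonneg w i
  calc _ ≤ ∑ w : Fin q → Fin m,
        nrm c x ^ (k + wordDeg c w) * ‖partialDeriv w (component φ e t i) x‖ :=
        Finset.single_le_sum (f := fun w : Fin q → Fin m =>
          nrm c x ^ (k + wordDeg c w) * ‖partialDeriv w (component φ e t i) x‖)
          (fun w _ => weight_term_nonneg w i) (Finset.mem_univ w)
    _ ≤ ∑ q ∈ Finset.range (d + 1), ∑ w : Fin q → Fin m,
        nrm c x ^ (k + wordDeg c w) * ‖partialDeriv w (component φ e t i) x‖ :=
        Finset.single_le_sum (f := fun q => ∑ w : Fin q → Fin m,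
          nrm c x ^ (k + wordDeg c w) * ‖partialDeriv w (component φ e t i) x‖)
          (fun q _ => h1 i q) (by simpa [Nat.lt_succ_iff] using hq)
    _ ≤ _ := Finset.single_le_sum (f := fun i => ∑ q ∈ Finset.range (d + 1), ∑ w : Fin q → Fin m,
          nrm c x ^ (k + wordDeg c w) * ‖partialDeriv w (component φ e t i) x‖)
          (fun i _ => Finset.sum_nonneg fun q _ => h1 i q) (Finset.mem_univ i)

theorem weight_mono {d' : ℕ} (h : d ≤ d') : weight k c d e t φ x ≤ weight k c d' e t φ x :=
  Finset.sum_le_sum fun i _ => Finset.sum_le_sum_of_subset_of_nonneg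
    (Finset.range_mono (by omega)) fun q _ _ => Finset.sum_nonneg fun w _ => weight_term_nonneg w i

variable [IsManifold (𝓡 m) ∞ M] [FiberBundle (Fin r → ℂ) E]

theorem weight_eq_zero [T2Space M] {K : Set M} (hK : IsCompact K) (hφ : ∀ x ∉ K, φ x = 0)
    (hx : x ∈ e.target) (hxK : e.symm x ∉ K) : weight k c d e t φ x = 0 := by
  refine Finset.sum_eq_zero fun i _ => Finset.sum_eq_zero fun q _ => Finset.sum_eq_zero fun w _ => ?_
  rw [partialDeriv_congr w (component_eventuallyEq_zero φ hK hφ t i hx hxK), partialDeriv_zero_fun,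
    norm_zero, mul_zero]

/-- A coordinate system in which `S` is the zero set of the first `c` coordinates. -/
def Straightens (e : OpenPartialHomeomorph M (Eu m)) (c : ℕ) (S : Set M) : Prop :=
  ∀ x ∈ e.source, x ∈ S ↔ nrm c (e x) = 0

variable [T2Space M]

/-- In straightening coordinates, a distribution which vanishes to order `k` along `S` satisfies a
weighted estimate. -/
theorem Distribution.VanishesToOrder.exists_weight_bound {σ : Distribution E m r} {S : Set M}
    (hσ : σ.VanishesToOrder k S) {p : M} (hp : p ∈ S) {e : OpenPartialHomeomorph M (Eu m)}
    (he : e ∈ IsManifold.maximalAtlas (𝓡 m) ∞ M) (hpe : p ∈ e.source) (hcm : c ≤ m)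
    (heS : Straightens e c S) :
    ∃ t : Trivialization (Fin r → ℂ) (π (Fin r → ℂ) E), MemTrivializationAtlas t ∧
      ∃ U ⊆ e.source ∩ t.baseSet, IsOpen U ∧ p ∈ U ∧ ∃ (C : ENNReal) (d : ℕ), C ≠ ⊤ ∧
        ∀ φ : testMeasures E m r, (∃ K ⊆ U, IsCompact K ∧ ∀ x ∉ K, φ.1 x = 0) →
          ‖σ.pairing φ‖ₑ ≤
            C * ∫⁻ x in e.target, ENNReal.ofReal (weight k c d e t φ.1 x) := by
  have : LocallyCompactSpace M := ChartedSpace.locallyCompactSpace (Eu m) M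
  obtain ⟨e', he', t, ht, U', hU', hU'o, hpU', N, f, D, h, hfDh, hrep⟩ := hσ p hp
  have hU'e : U' ⊆ e'.source := fun x hx => (hU' hx).1
  set s : Set (Eu m) := e' '' (U' ∩ e.source)
  have hs : IsOpen s := e'.isOpen_image_of_subset_source (hU'o.inter e.open_source)
    fun x hx => hU'e hx.1
  set κ₀ := e'.symm.trans e
  -- The coordinates in which the representation is given need not be straightening. The transition
  -- map to `e` is restricted to the part of `U'` lying in the source of `e`.
  set κ := κ₀.restrOpen s hs
  have hκs : κ.source = κ₀.source ∩ s := rfl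
  have hκa : ∀ y, κ y = κ₀ y := fun y => rfl
  have hκt : κ.target ⊆ κ₀.target := fun x hx => hx.1
  have hκ : ContDiffOn ℝ ∞ κ κ.source := (contDiffOn_transition he' he).mono fun y hy => hy.1
  have hκ' : ContDiffOn ℝ ∞ κ.symm κ.target := (contDiffOn_transition_symm he' he).mono hκt
  have hmem : ∀ x ∈ U' ∩ e.source, e' x ∈ κ.source := fun x hx => by
    refine ⟨?_, x, hx, rfl⟩
    simp only [κ₀, mfld_simps, e'.left_inv (hU'e hx.1)]
    exact ⟨e'.map_source (hU'e hx.1), hx.2⟩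
  have hval : ∀ x ∈ U', κ (e' x) = e x := fun x hx => by
    change e (e'.symm (e' x)) = e x
    rw [e'.left_inv (hU'e hx)]
  have hsub : κ.source ⊆ e' '' U' := by
    rintro _ ⟨_, x, hx, rfl⟩
    exact ⟨x, hx.1, rfl⟩
  have hZ' : ∀ y ∈ κ.source, y ∈ e' '' (S ∩ U') ↔ nrm c (κ y) = 0 := by
    rintro _ ⟨_, x, hx, rfl⟩
    rw [hval x hx.1, ← heS x hx.2]
    constructor
    · rintro ⟨z, hz, hzx⟩
      rw [← e'.injOn (hU'e hz.2) (hU'e hx.1) hzx]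
      exact hz.1
    · exact fun hxS => ⟨x, ⟨hxS, hx.1⟩, rfl⟩
  have hD : ∀ i j, (D i j).TangentialOn (e' '' (S ∩ U')) κ.source := fun i j l W hW hWs g hg =>
    (hfDh i j).2.2.1 l W hW (hWs.trans hsub) g hg
  have hf : ∀ i j, MemIdealPow (e' '' (S ∩ U')) k κ.source (f i j) := fun i j =>
    (hfDh i j).1.mono hsub κ.open_source
  have hDs : ∀ i j, (D i j).SmoothOn κ.source := fun i j q w => ((hfDh i j).2.1 q w).mono hsub
  have hpκ : e p ∈ κ.target := by
    rw [← hval p hpU']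
    exact κ.map_source (hmem p ⟨hpU', hpe⟩)
  have hbound := fun i j => DiffOp.transpose_bound
    (DiffOp.conj_coeff_mem hκ hκ' hZ' (hD i j) (hf i j)) hpκ
  choose C hC hCb using hbound
  obtain ⟨Kc, hKc, hpK, hKU⟩ := exists_compact_subset (hU'o.inter e.open_source) ⟨hpU', hpe⟩
  have hKce : IsCompact (e' '' Kc) :=
    hKc.image_of_continuousOn (e'.continuousOn.mono fun x hx => hU'e (hKU hx).1)
  have hb := fun i j => (hfDh i j).2.2.2.2 (e' '' Kc)
    (image_mono fun x hx => (hKU hx).1) hKce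
  choose b hb using hb
  have hev := eventually_all.2 fun i => eventually_all.2 fun j => hCb i j
  obtain ⟨V, hV, hVo, hpV⟩ := eventually_nhds_iff.1 ((e.continuousAt hpe).eventually hev)
  -- Over the compact set `Kc` the functions h are bounded; over `V` the pointwise bounds for all
  -- the finitely many transposes hold.
  let U := interior Kc ∩ V
  have hUo : IsOpen U := isOpen_interior.inter hVo
  have hUK : U ⊆ Kc := fun x hx => interior_subset hx.1
  have hUU : U ⊆ U' ∩ e.source := hUK.trans hKU
  let d := ∑ i, ∑ j, (D i j).order
  refine ⟨t, ht, U, fun x hx => ⟨(hUU hx).2, (hU' (hUU hx).1).2⟩, hUo, ⟨hpK, hpV⟩,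
    ∑ i, ∑ j, ENNReal.ofReal (|b i j| * C i j), d, ?_, ?_⟩
  · exact ENNReal.sum_ne_top.2 fun i _ => ENNReal.sum_ne_top.2 fun j _ => ENNReal.ofReal_ne_top
  rintro φ ⟨K, hKU', hK, hφ⟩
  have hA : IsOpen (e' '' U) := e'.isOpen_image_of_subset_source hUo fun x hx => hU'e (hUU hx).1
  have hAκ : e' '' U ⊆ κ.source := by
    rintro _ ⟨x, hx, rfl⟩
    exact hmem x (hUU hx)
  have hκA : κ '' (e' '' U) = e '' U := by
    rw [image_image]
    exact image_congr fun x hx => hval x (hUU hx).1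
  rw [hrep φ ⟨K, hKU'.trans fun x hx => (hUU hx).1, hK, hφ⟩, Finset.sum_mul]
  refine (enorm_sum_le _ _).trans (Finset.sum_le_sum fun i _ => ?_)
  rw [Finset.sum_mul]
  refine (enorm_sum_le _ _).trans (Finset.sum_le_sum fun j _ => ?_)
  refine (enorm_integral_le_lintegral_enorm _).trans ?_
  -- The representation integrates over all of `U'`, but the estimates are available only over `U`,
  -- which contains the support of φ.
  have hzero : ∀ y ∈ e' '' U', y ∉ e' '' U →
      ‖h i j y * (D i j).transpose (fun z => f i j z * component φ.1 e' t i z) y‖ₑ = 0 := by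
    rintro _ ⟨x, hx, rfl⟩ hxU
    have h1 : (fun z => f i j z * component φ.1 e' t i z) =ᶠ[𝓝 (e' x)] fun _ => 0 := by
      filter_upwards [component_eventuallyEq_zero φ.1 hK hφ t i (e'.map_source (hU'e hx)) (by
        rw [e'.left_inv (hU'e hx)]
        exact fun hxK => hxU ⟨x, hKU' hxK, rfl⟩)] with z hz
      rw [hz, mul_zero]
    rw [(D i j).transpose_congr h1]
    simp [DiffOp.transpose, partialDeriv_zero_fun]
  have e1 : ∫⁻ y in e' '' U', ‖h i j y *
      (D i j).transpose (fun z => f i j z * component φ.1 e' t i z) y‖ₑ =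
      ∫⁻ y in e' '' U, ‖h i j y *
      (D i j).transpose (fun z => f i j z * component φ.1 e' t i z) y‖ₑ := by
    have hm := (e'.isOpen_image_of_subset_source hU'o hU'e).measurableSet
    rw [← lintegral_indicator hm, ← lintegral_indicator hA.measurableSet]
    congr 1
    funext y
    by_cases h1 : y ∈ e' '' U
    · rw [indicator_of_mem h1, indicator_of_mem (hsub (hAκ h1))]
    · rw [indicator_of_notMem h1]
      by_cases h2 : y ∈ e' '' U'
      · rw [indicator_of_mem h2, hzero y h2 h1]
      · rw [indicator_of_notMem h2]
  rw [e1]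
  have hg : ContDiffOn ℝ ∞ (component φ.1 e t i) κ.target := by
    intro x hx
    obtain ⟨y, hy, rfl⟩ : ∃ y ∈ κ.source, κ y = x := ⟨κ.symm x, κ.map_target hx, κ.right_inv hx⟩
    obtain ⟨_, z, hz, rfl⟩ := hy
    rw [hval z hz.1]
    refine (smoothNear_component φ he t i (e.map_source hz.2) ?_).contDiffAt.contDiffWithinAt
    rw [e.left_inv hz.2]
    exact (hU' hz.1).2
  refine (setLIntegral_transpose_le hcm hκ hκ' hZ' (hDs i j) (hD i j) (hf i j) hA.measurableSet hAκ
    (b := |b i j|) (C := C i j) (abs_nonneg _) ?_ ?_ hg ?_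
    (W := weight k c d e t φ.1) ?_).trans ?_
  · rw [hκA]
    rintro _ ⟨x, hx, rfl⟩
    exact hV x hx.2 i j
  · rintro _ ⟨x, hx, rfl⟩
    exact (hb i j _ ⟨x, hUK hx, rfl⟩).trans (le_abs_self _)
  · intro y hy
    have h1 : jac κ y = jac κ₀ y := rfl
    rw [h1]
    exact component_transition φ.2.1 t i he' he hy.1
  · intro x q hq v
    refine le_weight (hq.trans ?_) v i
    calc (D i j).order ≤ ∑ j, (D i j).order :=
          Finset.single_le_sum (f := fun j => (D i j).order) (fun _ _ => Nat.zero_le _)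
            (Finset.mem_univ j)
      _ ≤ d := Finset.single_le_sum (f := fun i => ∑ j, (D i j).order) (fun _ _ => Nat.zero_le _)
            (Finset.mem_univ i)
  · rw [hκA]
    gcongr
    rintro _ ⟨x, hx, rfl⟩
    exact e.map_source (hUU hx).2

end Weights

/-! ### Weighted estimates for the translates -/

section PreservingFamilies

variable {m : ℕ} {P : Type*} [NormedAddCommGroup P] [NormedSpace ℝ P] {F : P → Eu m → Eu m}
  {p₀ : P × Eu m} {c : ℕ}

/-- Preservation of the subspace means that the normal coordinates of the map vanish on it; this is
the only hypothesis on the map in the weighted chain rule. -/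
theorem sym_coord_of_preserves (hF : SmoothNear (Function.uncurry F) p₀)
    (h0 : ∀ᶠ p in 𝓝 p₀, nrm c p.2 = 0 → nrm c (F p.1 p.2) = 0) (j : Fin m) :
    Sym c (𝓝 p₀) 0 (letterDeg c j) (fun ξ y => ((F ξ y j : ℝ) : ℂ)) := by
  by_cases hj : j.1 < c
  · rw [letterDeg, if_pos hj]
    refine SmoothNear.sym_one (F := fun ξ y => ((F ξ y j : ℝ) : ℂ)) (hF.coord j) ?_
    filter_upwards [h0] with p hp hn
    simp [nrm_eq_zero_iff.1 (hp hn) j hj]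
  · rw [letterDeg, if_neg hj]
    exact SmoothNear.sym (F := fun ξ y => ((F ξ y j : ℝ) : ℂ)) (hF.coord j)

/-- Each normal coordinate of the map vanishes on the subspace and so is O(`nrm`). -/
theorem eventually_nrm_le_of_preserves (hF : SmoothNear (Function.uncurry F) p₀)
    (h0 : ∀ᶠ p in 𝓝 p₀, nrm c p.2 = 0 → nrm c (F p.1 p.2) = 0) :
    ∃ C : ℝ, 0 ≤ C ∧ ∀ᶠ p in 𝓝 p₀, nrm c (F p.1 p.2) ≤ C * nrm c p.2 := by
  have h1 : ∀ j : Fin m, ∃ C : ℝ, 0 ≤ C ∧ (j.1 < c → ∀ᶠ p in 𝓝 p₀,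
      |F p.1 p.2 j| ≤ C * nrm c p.2) := fun j => by
    by_cases hj : j.1 < c
    · obtain ⟨C, hC, h⟩ := eventually_norm_le_nrm (F := fun ξ y => ((F ξ y j : ℝ) : ℂ))
        (hF.coord j) (c := c) (by
          filter_upwards [h0] with p hp hn
          simp [nrm_eq_zero_iff.1 (hp hn) j hj])
      exact ⟨C, hC, fun _ => by simpa using h⟩
    · exact ⟨0, le_rfl, fun h => absurd h hj⟩
  choose C hC h using h1
  refine ⟨∑ j, C j, Finset.sum_nonneg fun j _ => hC j, ?_⟩
  have h2 : ∀ᶠ p in 𝓝 p₀, ∀ j : Fin m, j.1 < c → |F p.1 p.2 j| ≤ C j * nrm c p.2 :=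
    eventually_all.2 fun j => by
      by_cases hj : j.1 < c
      · exact (h j hj).mono fun p hp _ => hp
      · exact Eventually.of_forall fun p hp => absurd hp hj
  filter_upwards [h2] with p hp
  have hn := nrm_nonneg c p.2
  refine nrm_le_of_coord (mul_nonneg (Finset.sum_nonneg fun j _ => hC j) hn) fun j hj =>
    (hp j hj).trans ?_
  gcongr
  exact Finset.single_le_sum (f := C) (fun j _ => hC j) (Finset.mem_univ j)

theorem wordDeg_le (c : ℕ) {q : ℕ} (w : Fin q → Fin m) : wordDeg c w ≤ q := by
  refine (Finset.sum_le_card_nsmul _ _ 1 fun l _ => ?_).trans (by simp)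
  rw [letterDeg]
  split_ifs <;> simp

end PreservingFamilies

/-! ### Elementary properties of the weights -/

section WeightLemmas

variable {m r : ℕ} {M : Type*} [TopologicalSpace M] [ChartedSpace (EuclideanSpace ℝ (Fin m)) M]
  {E : M → Type*} [∀ x, AddCommGroup (E x)] [∀ x, Module ℂ (E x)]
  [∀ x, TopologicalSpace (E x)] [TopologicalSpace (TotalSpace (Fin r → ℂ) E)]
  {k c d : ℕ} {e : OpenPartialHomeomorph M (Eu m)}
  {t : Trivialization (Fin r → ℂ) (π (Fin r → ℂ) E)} {φ : DualField E m} {x : Eu m}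

theorem nrm_pow_mul_weight :
    nrm c x ^ k * weight 0 c d e t φ x = weight k c d e t φ x := by
  simp only [weight, Finset.mul_sum, zero_add, pow_add, mul_assoc]

theorem weight_le_of_forall {B : ℝ} (h : ∀ q ≤ d, ∀ (w : Fin q → Fin m) (i : Fin r),
      nrm c x ^ (k + wordDeg c w) * ‖partialDeriv w (component φ e t i) x‖ ≤ B) :
    weight k c d e t φ x ≤
      (∑ _i : Fin r, ∑ q ∈ Finset.range (d + 1), ∑ _w : Fin q → Fin m, (1 : ℝ)) * B := by
  simp only [Finset.sum_mul, one_mul]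
  exact Finset.sum_le_sum fun i _ => Finset.sum_le_sum fun q hq => Finset.sum_le_sum fun w _ =>
    h q (by simpa [Nat.lt_succ_iff] using hq) w i

theorem setLIntegral_weight_eq [IsManifold (𝓡 m) ∞ M] [FiberBundle (Fin r → ℂ) E] [T2Space M]
    {K O : Set M} (hK : IsCompact K) (hφ : ∀ x ∉ K, φ x = 0) (hKO : K ⊆ O) (hO : IsOpen O)
    (hOe : O ⊆ e.source) :
    ∫⁻ x in e.target, ENNReal.ofReal (weight k c d e t φ x) =
      ∫⁻ x in e '' O, ENNReal.ofReal (weight k c d e t φ x) := by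
  have hm := (e.isOpen_image_of_subset_source hO hOe).measurableSet
  rw [← lintegral_indicator e.open_target.measurableSet, ← lintegral_indicator hm]
  congr 1
  funext y
  by_cases h1 : y ∈ e '' O
  · obtain ⟨x, hx, rfl⟩ := id h1
    rw [indicator_of_mem h1, indicator_of_mem (e.map_source (hOe hx))]
  · rw [indicator_of_notMem h1]
    by_cases h2 : y ∈ e.target
    · rw [indicator_of_mem h2, weight_eq_zero hK hφ h2 fun h => h1 ⟨_, hKO h, e.right_inv h2⟩,
        ENNReal.ofReal_zero]
    · rw [indicator_of_notMem h2]

end WeightLemmas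

/-! ### Stability of the weighted estimate under translations preserving the submanifold -/

section TranslateEstimate

variable {n m r : ℕ} {H : Type*} [Group H] [TopologicalSpace H]
  [ChartedSpace (EuclideanSpace ℝ (Fin n)) H] [LieGroup (𝓡 n) ∞ H]
  {M : Type*} [TopologicalSpace M] [ChartedSpace (EuclideanSpace ℝ (Fin m)) M]
  [IsManifold (𝓡 m) ∞ M] [T2Space M] [MulAction H M] [ContMDiffSMul (𝓡 n) (𝓡 m) ∞ H M]
  {S : Set M} {c : ℕ}

theorem smul_mem_iff (hHS : ∀ h : H, ∀ x ∈ S, h • x ∈ S) (h : H) (x : M) : h • x ∈ S ↔ x ∈ S :=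
  ⟨fun hx => by simpa using hHS h⁻¹ _ hx, hHS h x⟩

theorem straightens_translateChart (hHS : ∀ h : H, ∀ x ∈ S, h • x ∈ S)
    {e : OpenPartialHomeomorph M (Eu m)} (heS : Straightens e c S) (h : H) :
    Straightens (translateChart n h e) c S := fun x hx => by
  rw [translateChart_apply, ← heS (h • x) hx, smul_mem_iff hHS]

theorem eventually_actionMap_preserves (hHS : ∀ h : H, ∀ x ∈ S, h • x ∈ S)
    {e e' : OpenPartialHomeomorph M (Eu m)} (heS : Straightens e c S) (heS' : Straightens e' c S)
    {a : Eu n → H} {ξ₀ : Eu n} {y₀ : Eu m}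
    (ha : ∀ᶠ ξ in 𝓝 ξ₀, ContMDiffAt (𝓡 n) (𝓡 n) ∞ a ξ)
    (hy₀ : y₀ ∈ e.target) (h0 : a ξ₀ • e.symm y₀ ∈ e'.source) :
    ∀ᶠ p in 𝓝 (ξ₀, y₀), nrm c p.2 = 0 → nrm c (actionMap e e' (a p.1) p.2) = 0 := by
  filter_upwards [eventually_family_mem ha hy₀ e'.open_source h0] with p hp hn
  rw [actionMap, ← heS' _ hp.2.2, smul_mem_iff hHS, heS _ (e.map_target hp.2.1),
    e.right_inv hp.2.1, hn]

variable {E : M → Type*} [∀ x, AddCommGroup (E x)] [∀ x, Module ℂ (E x)]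
  [∀ x, TopologicalSpace (E x)] [TopologicalSpace (TotalSpace (Fin r → ℂ) E)]
  [FiberBundle (Fin r → ℂ) E] [VectorBundle ℂ (Fin r → ℂ) E]
  [ContMDiffVectorBundle ∞ (Fin r → ℂ) E (𝓡 m)] (L : EquivariantLift n m r H E)

/-- The weighted chain rule bounds derivatives of the pullback at y by derivatives of φ at the image
z, but weighted with `nrm` at y; the inverse translation also preserves `S` and converts these
weights to z. The Jacobian, bounded below near the base point, is inserted to prepare the change of
variables. -/
theorem weight_pullback_le (hHS : ∀ h : H, ∀ x ∈ S, h • x ∈ S)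
    {e e' : OpenPartialHomeomorph M (Eu m)}
    (he : e ∈ IsManifold.maximalAtlas (𝓡 m) ∞ M) (he' : e' ∈ IsManifold.maximalAtlas (𝓡 m) ∞ M)
    (heS : Straightens e c S) (heS' : Straightens e' c S)
    (t t' : Trivialization (Fin r → ℂ) (π (Fin r → ℂ) E)) [MemTrivializationAtlas t]
    [MemTrivializationAtlas t'] {a : Eu n → H} {ξ₀ : Eu n} {y₀ : Eu m}
    (ha : ∀ᶠ ξ in 𝓝 ξ₀, ContMDiffAt (𝓡 n) (𝓡 n) ∞ a ξ)
    (hy₀ : y₀ ∈ e.target ∩ e.symm ⁻¹' t.baseSet)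
    (h0 : a ξ₀ • e.symm y₀ ∈ e'.source ∩ t'.baseSet) (k d : ℕ) :
    ∃ C : ℝ, 0 ≤ C ∧ ∀ᶠ p in 𝓝 (ξ₀, y₀), ∀ φ : testMeasures E m r,
      weight k c d e t (pullback L (a p.1) φ).1 p.2 ≤ C *
        (jac (actionMap e e' (a p.1)) p.2 *
          weight k c d e' t' φ.1 (actionMap e e' (a p.1) p.2)) := by
  have hΘs := smoothNear_actionMap he he' ha hy₀.1 h0.1
  obtain ⟨C₁, hC₁, hb₁⟩ := pullback_bound he he' t t' ha hy₀ h0 L (c := c)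
    (sym_coord_of_preserves (F := fun ξ y => actionMap e e' (a ξ) y) hΘs
      (eventually_actionMap_preserves hHS heS heS' ha hy₀.1 h0.1)) d
  -- the inverse family
  have ha' : ∀ᶠ ξ in 𝓝 ξ₀, ContMDiffAt (𝓡 n) (𝓡 n) ∞ (fun ξ => (a ξ)⁻¹) ξ :=
    ha.mono fun ξ hξ => hξ.inv
  have hz₀ : actionMap e e' (a ξ₀) y₀ ∈ e'.target := e'.map_source h0.1
  have hz₀s : (a ξ₀)⁻¹ • e'.symm (actionMap e e' (a ξ₀) y₀) ∈ e.source := by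
    rw [actionMap, e'.left_inv h0.1, inv_smul_smul]
    exact e.map_target hy₀.1
  have hG : SmoothNear (Function.uncurry fun (ξ : Eu n) z => actionMap e' e (a ξ)⁻¹ z)
      (ξ₀, actionMap e e' (a ξ₀) y₀) :=
    smoothNear_actionMap (a := fun ξ => (a ξ)⁻¹) he' he ha' hz₀ hz₀s
  have hGp : ∀ᶠ p in 𝓝 (ξ₀, actionMap e e' (a ξ₀) y₀), nrm c p.2 = 0 →
      nrm c (actionMap e' e (a p.1)⁻¹ p.2) = 0 :=
    eventually_actionMap_preserves (a := fun ξ => (a ξ)⁻¹) hHS heS' heS ha' hz₀ hz₀s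
  obtain ⟨C₂, hC₂, hb₂⟩ := eventually_nrm_le_of_preserves hG hGp
  have hT : Tendsto (fun p : Eu n × Eu m => (p.1, actionMap e e' (a p.1) p.2)) (𝓝 (ξ₀, y₀))
      (𝓝 (ξ₀, actionMap e e' (a ξ₀) y₀)) :=
    continuousAt_fst.prodMk hΘs.contDiffAt.continuousAt
  -- the Jacobian
  have hJ := (smoothNear_jac_actionMap he he' ha hy₀.1 h0.1).contDiffAt.continuousAt.norm
  have hJ0 : 0 < jac (actionMap e e' (a ξ₀)) y₀ := abs_pos.2 (det_fderiv_actionMap_ne_zero he he'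
    (mem_trans_translateChart (n := n) |>.2 ⟨hy₀.1, h0.1⟩))
  set δ := jac (actionMap e e' (a ξ₀)) y₀ / 2
  have hδ : 0 < δ := half_pos hJ0
  have hJ1 : ∀ᶠ p in 𝓝 (ξ₀, y₀), δ < jac (actionMap e e' (a p.1)) p.2 := by
    have h1 := hJ.eventually_const_lt (u := δ) (by
      change δ < ‖((jac (actionMap e e' (a ξ₀)) y₀ : ℝ) : ℂ)‖
      rw [Complex.norm_real, Real.norm_of_nonneg hJ0.le]
      exact half_lt_self hJ0)
    filter_upwards [h1] with p hp
    rwa [Complex.norm_real, Real.norm_of_nonneg (r := jac _ _) (abs_nonneg _)] at hp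
  -- A constant at least 1, so that its powers with exponents up to `d` are bounded by the `d`-th.
  set C₃ := C₂ + 1
  have hC₃ : 1 ≤ C₃ := by simp only [C₃]; linarith
  set n₀ : ℝ := ∑ _i : Fin r, ∑ q ∈ Finset.range (d + 1), ∑ _w : Fin q → Fin m, (1 : ℝ)
  have hn₀ : 0 ≤ n₀ := Finset.sum_nonneg fun _ _ => Finset.sum_nonneg fun _ _ =>
    Finset.sum_nonneg fun _ _ => zero_le_one
  have hK : 0 ≤ n₀ * (C₃ ^ k * (C₁ * C₃ ^ d)) := mul_nonneg hn₀ (by positivity)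
  refine ⟨n₀ * (C₃ ^ k * (C₁ * C₃ ^ d)) / δ, div_nonneg hK hδ.le, ?_⟩
  filter_upwards [hb₁, hT.eventually hb₂, hJ1,
    eventually_family_mem ha hy₀.1 e'.open_source h0.1] with p hp1 hp2 hp3 hp4 φ
  set z := actionMap e e' (a p.1) p.2
  have hinv : actionMap e' e (a p.1)⁻¹ z = p.2 := by
    simp only [z, actionMap]
    rw [e'.left_inv hp4.2.2, inv_smul_smul, e.right_inv hp4.2.1]
  have hnz := nrm_nonneg c z
  have hny := nrm_nonneg c p.2
  have hle : nrm c p.2 ≤ C₃ * nrm c z := by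
    have h1 : nrm c (actionMap e' e (a p.1)⁻¹ z) ≤ C₂ * nrm c z := hp2
    rw [hinv] at h1
    refine h1.trans ?_
    simp only [C₃]
    gcongr
    linarith
  have hW : 0 ≤ weight 0 c d e' t' φ.1 z := weight_nonneg
  -- The derivatives are first compared with k = 0; the factor `nrm`^k is compared separately, as
  -- the weight for `k` is `nrm`^k times the weight for 0.
  have h1 := hp1 φ (C₃ ^ d * weight 0 c d e' t' φ.1 z) (by positivity) fun q hq v j => by
    calc nrm c p.2 ^ wordDeg c v * ‖partialDeriv v (component φ.1 e' t' j) z‖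
        ≤ (C₃ * nrm c z) ^ wordDeg c v * ‖partialDeriv v (component φ.1 e' t' j) z‖ := by gcongr
      _ = C₃ ^ wordDeg c v * (nrm c z ^ (0 + wordDeg c v) *
          ‖partialDeriv v (component φ.1 e' t' j) z‖) := by rw [mul_pow, zero_add, mul_assoc]
      _ ≤ C₃ ^ d * weight 0 c d e' t' φ.1 z := by
          gcongr
          · exact (wordDeg_le c v).trans hq
          · exact le_weight hq v j
  have h2 : weight k c d e t (pullback L (a p.1) φ).1 p.2 ≤
      n₀ * (C₃ ^ k * (C₁ * C₃ ^ d) * weight k c d e' t' φ.1 z) := by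
    refine weight_le_of_forall fun q hq w i => ?_
    calc _ = nrm c p.2 ^ k * (nrm c p.2 ^ wordDeg c w *
          ‖partialDeriv w (component (pullback L (a p.1) φ).1 e t i) p.2‖) := by
          rw [pow_add, mul_assoc]
      _ ≤ (C₃ * nrm c z) ^ k * (C₁ * (C₃ ^ d * weight 0 c d e' t' φ.1 z)) := by
          refine mul_le_mul (pow_le_pow_left₀ hny hle k) (h1 q hq w i) ?_ (by positivity)
          exact mul_nonneg (pow_nonneg hny _) (norm_nonneg _)
      _ = _ := by
          rw [← nrm_pow_mul_weight (k := k), mul_pow]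
          ring
  refine h2.trans ?_
  have hWk : 0 ≤ weight k c d e' t' φ.1 z := weight_nonneg
  generalize weight k c d e' t' φ.1 z = X at hWk ⊢
  generalize jac (actionMap e e' (a p.1)) p.2 = J at hp3 ⊢
  have h3 : X ≤ J * X / δ := by
    rw [le_div_iff₀ hδ, mul_comm]
    exact mul_le_mul_of_nonneg_right hp3.le hWk
  calc _ = n₀ * (C₃ ^ k * (C₁ * C₃ ^ d)) * X := by ring
    _ ≤ n₀ * (C₃ ^ k * (C₁ * C₃ ^ d)) * (J * X / δ) := mul_le_mul_of_nonneg_left h3 hK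
    _ = _ := by ring

variable {σ : Distribution E m r} {k : ℕ}

/-- By invariance of `S` the chart x ↦ e(h₀ x) is straightening at h₀⁻¹ p with the same c. The
estimate for σ there, applied to pullbacks, becomes the estimate at p after the change of variables
given by h in coordinates. -/
theorem exists_translate_weight_bound (hHS : ∀ h : H, ∀ x ∈ S, h • x ∈ S)
    (hσ : σ.VanishesToOrder k S) (h₀ : H) {p : M} (hp : p ∈ S)
    {e : OpenPartialHomeomorph M (Eu m)} (he : e ∈ IsManifold.maximalAtlas (𝓡 m) ∞ M)
    (hpe : p ∈ e.source) (hcm : c ≤ m) (heS : Straightens e c S)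
    (t : Trivialization (Fin r → ℂ) (π (Fin r → ℂ) E)) [MemTrivializationAtlas t]
    (hpt : p ∈ t.baseSet) :
    ∃ O : Set M, IsOpen O ∧ p ∈ O ∧ ∃ (C : ENNReal) (d : ℕ), C ≠ ⊤ ∧
      ∀ᶠ h in 𝓝 h₀, ∀ φ : testMeasures E m r,
        (∃ K ⊆ O, IsCompact K ∧ ∀ x ∉ K, φ.1 x = 0) → ‖translate L h σ φ‖ₑ ≤
          C * ∫⁻ x in e.target, ENNReal.ofReal (weight k c d e t φ.1 x) := by
  set p' := h₀⁻¹ • p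
  set es := translateChart n h₀ e
  have hes := translateChart_mem (n := n) h₀ he
  have hesS := straightens_translateChart (n := n) hHS heS h₀
  have hp's : p' ∈ es.source := by
    rw [translateChart_source, smul_inv_smul]
    exact hpe
  obtain ⟨t₁, ht₁, U, hU, hUo, hpU, C, d, hC, hσb⟩ :=
    hσ.exists_weight_bound (hHS _ _ hp) hes hp's hcm hesS
  set a := (chartAt (Eu n) h₀).symm
  set ξ₀ := chartAt (Eu n) h₀ h₀
  have haξ : a ξ₀ = h₀ := (chartAt (Eu n) h₀).left_inv (mem_chart_source _ h₀)
  have ha := eventually_contMDiffAt_chart_symm (n := n) h₀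
  have hy₀ : es p' ∈ es.target ∩ es.symm ⁻¹' t₁.baseSet := by
    refine ⟨es.map_source hp's, ?_⟩
    rw [mem_preimage, es.left_inv hp's]
    exact (hU hpU).2
  have h0 : a ξ₀ • es.symm (es p') ∈ e.source ∩ t.baseSet := by
    rw [haξ, es.left_inv hp's, smul_inv_smul]
    exact ⟨hpe, hpt⟩
  obtain ⟨A, hA, hw⟩ := weight_pullback_le L hHS hes he hesS heS t₁ t ha hy₀ h0 k d
  have hcs := continuous_inv_smul n m H M
  have hes_c : ContinuousAt (fun q : H × M => es (q.1⁻¹ • q.2)) (h₀, p) :=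
    ContinuousAt.comp (f := fun q : H × M => q.1⁻¹ • q.2) (x := (h₀, p)) (es.continuousAt hp's)
      hcs.continuousAt
  -- The comparison of weights is local in the parameter and the source point. It is restated for h
  -- and the image point x, so that one neighbourhood `O` of p works for all h near `h₀`.
  have hT : Tendsto (fun q : H × M => (chartAt (Eu n) h₀ q.1, es (q.1⁻¹ • q.2))) (𝓝 (h₀, p))
      (𝓝 (ξ₀, es p')) :=
    (ContinuousAt.comp (f := Prod.fst) (x := (h₀, p))
      ((chartAt (Eu n) h₀).continuousAt (mem_chart_source _ h₀)) continuousAt_fst).prodMk hes_c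
  have hev := ((hT.eventually hw).and (hcs.continuousAt.eventually (hUo.mem_nhds hpU))).and
    ((continuousAt_fst.eventually ((chartAt (Eu n) h₀).open_source.mem_nhds
      (mem_chart_source _ h₀))).and (continuousAt_snd.eventually (e.open_source.mem_nhds hpe)))
  rw [nhds_prod_eq] at hev
  obtain ⟨pa, hpa, pb, hpb, hab⟩ := Filter.eventually_prod_iff.1 hev
  obtain ⟨O, hO, hOo, hpO⟩ := eventually_nhds_iff.1 hpb
  refine ⟨O, hOo, hpO, C * ENNReal.ofReal A, d, ENNReal.mul_ne_top hC ENNReal.ofReal_ne_top, ?_⟩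
  filter_upwards [hpa] with h hh
  rintro φ ⟨K, hKO, hK, hφ⟩
  have hQ : ∀ x ∈ O, _ := fun x hx => hab hh (hO x hx)
  have hah : ∀ x ∈ O, (chartAt (Eu n) h₀).symm (chartAt (Eu n) h₀ h) = h := fun x hx =>
    (chartAt (Eu n) h₀).left_inv (hQ x hx).2.1
  set O' : Set M := (fun x => h • x) ⁻¹' O
  have hO'o : IsOpen O' := hOo.preimage (translateDiffeo n m M h).continuous
  have hO'U : O' ⊆ U := fun x hx => by
    have h1 : h⁻¹ • h • x ∈ U := (hQ _ hx).1.2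
    rwa [inv_smul_smul] at h1
  have hO's : O' ⊆ es.source := fun x hx => (hU (hO'U hx)).1
  set K' : Set M := (fun x => h⁻¹ • x) '' K
  have hK' : IsCompact K' := hK.image (translateDiffeo n m M h⁻¹).continuous
  have hKO' : K' ⊆ O' := by
    rintro _ ⟨x, hx, rfl⟩
    simpa [O'] using hKO hx
  have hφ' : ∀ x ∉ K', (pullback L h φ).1 x = 0 := fun x hx =>
    pullback_apply_eq_zero L (hφ _ fun hK => hx ⟨_, hK, inv_smul_smul h x⟩)
  refine (hσb _ ⟨K', hKO'.trans hO'U, hK', hφ'⟩).trans ?_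
  rw [mul_assoc]
  gcongr
  rw [setLIntegral_weight_eq hK' hφ' hKO' hO'o hO's]
  set κ := es.symm.trans (translateChart n h e)
  have hκ : ContDiffOn ℝ ∞ κ κ.source := contDiffOn_transition hes (translateChart_mem h he)
  have hV : IsOpen (es '' O') := es.isOpen_image_of_subset_source hO'o hO's
  have hVκ : es '' O' ⊆ κ.source := by
    rintro _ ⟨x, hx, rfl⟩
    refine mem_trans_translateChart.2 ⟨es.map_source (hO's hx), ?_⟩
    rw [es.left_inv (hO's hx)]
    exact (hQ _ hx).2.2
  calc ∫⁻ y in es '' O', ENNReal.ofReal (weight k c d es t₁ (pullback L h φ).1 y)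
      ≤ ∫⁻ y in es '' O', ENNReal.ofReal A * (ENNReal.ofReal (jac κ y) *
          ENNReal.ofReal (weight k c d e t φ.1 (κ y))) := by
        refine setLIntegral_mono' hV.measurableSet ?_
        rintro _ ⟨x, hx, rfl⟩
        have h1 := (hQ _ hx).1.1 φ
        simp only [inv_smul_smul] at h1
        rw [hah _ hx] at h1
        rw [← ENNReal.ofReal_mul (p := jac κ (es x)) (abs_nonneg _), ← ENNReal.ofReal_mul hA]
        exact ENNReal.ofReal_le_ofReal h1
    _ = ENNReal.ofReal A * ∫⁻ y in κ '' (es '' O'), ENNReal.ofReal (weight k c d e t φ.1 y) := by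
        rw [lintegral_const_mul' _ _ ENNReal.ofReal_ne_top,
          setLIntegral_jac_mul_comp hκ hV.measurableSet hVκ
            fun y => ENNReal.ofReal (weight k c d e t φ.1 y)]
    _ ≤ _ := by
        gcongr
        rintro _ ⟨y, hy, rfl⟩
        exact e.map_source (mem_trans_translateChart.1 (hVκ hy)).2

/-- Finitely many of the local estimates cover the compact set; neighbourhoods are intersected,
constants added, and orders replaced by their maximum. -/
theorem exists_uniform_weight_bound (hHS : ∀ h : H, ∀ x ∈ S, h • x ∈ S)
    (hσ : σ.VanishesToOrder k S) {Ω : Set H} (hΩ : IsCompact Ω) {p : M} (hp : p ∈ S)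
    {e : OpenPartialHomeomorph M (Eu m)} (he : e ∈ IsManifold.maximalAtlas (𝓡 m) ∞ M)
    (hpe : p ∈ e.source) (hcm : c ≤ m) (heS : Straightens e c S)
    (t : Trivialization (Fin r → ℂ) (π (Fin r → ℂ) E)) [MemTrivializationAtlas t]
    (hpt : p ∈ t.baseSet) :
    ∃ O : Set M, IsOpen O ∧ p ∈ O ∧ ∃ (C : ENNReal) (d : ℕ), C ≠ ⊤ ∧
      ∀ h ∈ Ω, ∀ φ : testMeasures E m r,
        (∃ K ⊆ O, IsCompact K ∧ ∀ x ∉ K, φ.1 x = 0) → ‖translate L h σ φ‖ₑ ≤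
          C * ∫⁻ x in e.target, ENNReal.ofReal (weight k c d e t φ.1 x) := by
  refine hΩ.induction_on (p := fun s => ∃ O : Set M, IsOpen O ∧ p ∈ O ∧ ∃ (C : ENNReal) (d : ℕ),
    C ≠ ⊤ ∧ ∀ h ∈ s, ∀ φ : testMeasures E m r,
        (∃ K ⊆ O, IsCompact K ∧ ∀ x ∉ K, φ.1 x = 0) → ‖translate L h σ φ‖ₑ ≤
          C * ∫⁻ x in e.target, ENNReal.ofReal (weight k c d e t φ.1 x))
    ⟨univ, isOpen_univ, mem_univ p, 0, 0, by simp, by simp⟩ ?_ ?_ ?_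
  · rintro s s' hss ⟨O, hO, hpO, C, d, hC, h⟩
    exact ⟨O, hO, hpO, C, d, hC, fun x hx => h x (hss hx)⟩
  · rintro s s' ⟨O, hO, hpO, C, d, hC, h⟩ ⟨O', hO', hpO', C', d', hC', h'⟩
    refine ⟨O ∩ O', hO.inter hO', ⟨hpO, hpO'⟩, C + C', max d d', ENNReal.add_ne_top.2 ⟨hC, hC'⟩, ?_⟩
    rintro x hx φ ⟨K, hKO, hK, hφ⟩
    rcases hx with hx | hx
    · refine (h x hx φ ⟨K, hKO.trans inter_subset_left, hK, hφ⟩).trans ?_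
      gcongr with y
      · exact le_self_add
      · exact weight_mono (le_max_left _ _)
    · refine (h' x hx φ ⟨K, hKO.trans inter_subset_right, hK, hφ⟩).trans ?_
      gcongr with y
      · exact le_add_self
      · exact weight_mono (le_max_right _ _)
  · intro h₀ _
    obtain ⟨O, hO, hpO, C, d, hC, h⟩ :=
      exists_translate_weight_bound L hHS hσ h₀ hp he hpe hcm heS t hpt
    exact ⟨_, mem_nhdsWithin_of_mem_nhds h, O, hO, hpO, C, d, hC, fun x hx => hx⟩

end TranslateEstimate

/-! ### From weighted estimates to vanishing along a submanifold -/

section NormalWeights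

variable {m : ℕ}

/-- The index set of the operators `x_a ^ deg w ∂_w` of order at most `d`. -/
abbrev NormalIndex (m d : ℕ) : Type :=
  Option (Fin m) × (Σ q : Fin (d + 1), (Fin q.1 → Fin m))

/-- The derivative `∂_w (x_a ^ (k + deg w) g)`. -/
def normalDeriv (k c : ℕ) {d : ℕ} (b : NormalIndex m d) (g : Eu m → ℂ) (y : Eu m) : ℂ :=
  partialDeriv b.2.2 (fun z => normalForm c b.1 z ^ (k + wordDeg c b.2.2) * g z) y

theorem smoothNear_normalForm_pow (c : ℕ) (a : Option (Fin m)) (s : ℕ) (y : Eu m) :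
    SmoothNear (fun z => normalForm c a z ^ s) y :=
  smoothNear_of_contDiff ((normalForm c a).contDiff.pow s)

theorem norm_partialDeriv_le_sum_normalDeriv (k c : ℕ) {d q : ℕ} (hq : q ≤ d) (a : Option (Fin m))
    (w : Fin q → Fin m) (g : Eu m → ℂ) (y : Eu m) :
    ‖partialDeriv w (fun z => normalForm c a z ^ (k + wordDeg c w) * g z) y‖ ≤
      ∑ b : NormalIndex m d, ‖normalDeriv k c b g y‖ := by
  have h := Finset.single_le_sum (f := fun b : NormalIndex m d => ‖normalDeriv k c b g y‖)
    (fun _ _ => norm_nonneg _) (Finset.mem_univ (a, ⟨⟨q, Nat.lt_succ_iff.2 hq⟩, w⟩))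
  exact h

/-- A power of `nrm` is at most the sum of the same powers of the normal forms, and these can be
commuted past the derivative at the price of shorter words. -/
theorem exists_nrm_pow_mul_partialDeriv_le_word (k c d : ℕ) {q : ℕ} (hq : q ≤ d)
    (w : Fin q → Fin m) :
    ∃ A : ℝ, 0 ≤ A ∧ ∀ (g : Eu m → ℂ) (y : Eu m), SmoothNear g y →
      nrm c y ^ (k + wordDeg c w) * ‖partialDeriv w g y‖ ≤
        A * ∑ b : NormalIndex m d, ‖normalDeriv k c b g y‖ := by
  choose ι hι W C hW hid using fun a : Option (Fin m) =>
    exists_normalForm_pow_mul_partialDeriv c a w k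
  refine ⟨∑ a, ∑ l, ‖C a l‖, Finset.sum_nonneg fun a _ => Finset.sum_nonneg fun l _ =>
    norm_nonneg _, fun g y hg => ?_⟩
  calc nrm c y ^ (k + wordDeg c w) * ‖partialDeriv w g y‖
      ≤ (∑ a : Option (Fin m), ‖normalForm c a y ^ (k + wordDeg c w)‖) * ‖partialDeriv w g y‖ :=
        mul_le_mul_of_nonneg_right (nrm_pow_le_sum c _ y) (norm_nonneg _)
    _ = ∑ a : Option (Fin m), ‖normalForm c a y ^ (k + wordDeg c w) * partialDeriv w g y‖ := by
        simp only [Finset.sum_mul, norm_mul]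
    _ ≤ ∑ a : Option (Fin m), ∑ l, ‖C a l‖ * ∑ b : NormalIndex m d, ‖normalDeriv k c b g y‖ := by
        refine Finset.sum_le_sum fun a _ => ?_
        rw [hid a g y hg]
        refine (norm_sum_le _ _).trans (Finset.sum_le_sum fun l _ => ?_)
        rw [norm_mul]
        exact mul_le_mul_of_nonneg_left
          (norm_partialDeriv_le_sum_normalDeriv k c ((hW a l).trans hq) a _ g y) (norm_nonneg _)
    _ = _ := by
        rw [Finset.sum_mul]
        exact Finset.sum_congr rfl fun a _ => (Finset.sum_mul _ _ _).symm

theorem exists_nrm_pow_mul_partialDeriv_le (k c d : ℕ) :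
    ∃ A : ℝ, 0 ≤ A ∧ ∀ (g : Eu m → ℂ) (y : Eu m), SmoothNear g y →
      ∀ q ≤ d, ∀ w : Fin q → Fin m, nrm c y ^ (k + wordDeg c w) * ‖partialDeriv w g y‖ ≤
        A * ∑ b : NormalIndex m d, ‖normalDeriv k c b g y‖ := by
  choose A hA hb using fun (b : Σ q : Fin (d + 1), Fin q.1 → Fin m) =>
    exists_nrm_pow_mul_partialDeriv_le_word k c d (Nat.lt_succ_iff.1 b.1.2) b.2
  refine ⟨∑ b, A b, Finset.sum_nonneg fun b _ => hA b, fun g y hg q hq w => ?_⟩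
  refine (hb ⟨⟨q, Nat.lt_succ_iff.2 hq⟩, w⟩ g y hg).trans ?_
  exact mul_le_mul_of_nonneg_right
    (Finset.single_le_sum (f := A) (fun b _ => hA b) (Finset.mem_univ _))
    (Finset.sum_nonneg fun b _ => norm_nonneg _)

end NormalWeights

/-! ### From the weighted estimate back to a representation -/

section Converse

variable {m r : ℕ} {M : Type*} [TopologicalSpace M] [ChartedSpace (EuclideanSpace ℝ (Fin m)) M]
  [IsManifold (𝓡 m) ∞ M] [T2Space M]
  {E : M → Type*} [∀ x, AddCommGroup (E x)] [∀ x, Module ℂ (E x)]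
  [∀ x, TopologicalSpace (E x)] [TopologicalSpace (TotalSpace (Fin r → ℂ) E)]
  [FiberBundle (Fin r → ℂ) E]

variable (E m r) in
/-- The test measures with compact support in `U`. -/
def testMeasuresIn (U : Set M) : Submodule ℂ (testMeasures E m r) where
  carrier := {φ | ∃ K ⊆ U, IsCompact K ∧ ∀ x ∉ K, φ.1 x = 0}
  zero_mem' := ⟨∅, empty_subset _, isCompact_empty, fun x _ => rfl⟩
  add_mem' := by
    rintro φ ψ ⟨K, hKU, hK, hφ⟩ ⟨L, hLU, hL, hψ⟩
    refine ⟨K ∪ L, union_subset hKU hLU, hK.union hL, fun x hx => ?_⟩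
    simp only [mem_union, not_or] at hx
    change φ.1 x + ψ.1 x = 0
    rw [hφ x hx.1, hψ x hx.2, add_zero]
  smul_mem' := by
    rintro c φ ⟨K, hKU, hK, hφ⟩
    refine ⟨K, hKU, hK, fun x hx => ?_⟩
    change c • φ.1 x = 0
    rw [hφ x hx, smul_zero]

variable {e : OpenPartialHomeomorph M (Eu m)} (he : e ∈ IsManifold.maximalAtlas (𝓡 m) ∞ M)
  (t : Trivialization (Fin r → ℂ) (π (Fin r → ℂ) E)) [MemTrivializationAtlas t]
  {U : Set M} (hU : U ⊆ e.source ∩ t.baseSet) (hUo : IsOpen U)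

include he hU in
theorem smoothNear_component_of_mem_image (φ : testMeasures E m r) (i : Fin r) {y : Eu m}
    (hy : y ∈ e '' U) : SmoothNear (component φ.1 e t i) y := by
  obtain ⟨x, hx, rfl⟩ := hy
  refine smoothNear_component φ he t i (e.map_source (hU hx).1) ?_
  rw [e.left_inv (hU hx).1]
  exact (hU hx).2

include he hU hUo in
theorem integrableOn_normalDeriv (k c : ℕ) {d : ℕ} (b : NormalIndex m d) (i : Fin r)
    (φ : testMeasuresIn m r E U) :
    IntegrableOn (normalDeriv k c b (component φ.1.1 e t i)) (e '' U) := by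
  obtain ⟨K, hKU, hK, hφ⟩ := φ.2
  have hKe : IsCompact (e '' K) :=
    hK.image_of_continuousOn (e.continuousOn.mono fun x hx => (hU (hKU hx)).1)
  have hm := (e.isOpen_image_of_subset_source hUo fun x hx => (hU hx).1).measurableSet
  refine IntegrableOn.of_forall_sdiff_eq_zero (s := e '' K) ?_ hm ?_
  · refine ContinuousOn.integrableOn_compact hKe fun y hy => ContinuousAt.continuousWithinAt ?_
    exact (((smoothNear_normalForm_pow c b.1 _ y).mul (smoothNear_component_of_mem_image he t hU φ.1 i
      (image_mono hKU hy))).partialDeriv b.2.2).contDiffAt.continuousAt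
  · rintro _ ⟨⟨x, hx, rfl⟩, hxK⟩
    have h1 : (fun z => normalForm c b.1 z ^ (k + wordDeg c b.2.2) * component φ.1.1 e t i z)
        =ᶠ[𝓝 (e x)] fun _ => 0 := by
      filter_upwards [component_eventuallyEq_zero φ.1.1 hK hφ t i (e.map_source (hU hx).1) (by
        rw [e.left_inv (hU hx).1]
        exact fun h => hxK ⟨x, h, rfl⟩)] with z hz
      rw [hz, mul_zero]
    rw [normalDeriv, partialDeriv_congr _ h1, partialDeriv_zero_fun]

include he hU hUo in
/-- A weighted estimate gives a representation by densities. -/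
theorem exists_densities_of_weight_bound {k c d : ℕ} (hfin : volume (e '' U) ≠ ⊤)
    (τ : Distribution E m r) {C : ENNReal} (hC : C ≠ ⊤)
    (hτ : ∀ φ : testMeasures E m r, (∃ K ⊆ U, IsCompact K ∧ ∀ x ∉ K, φ.1 x = 0) →
      ‖τ.pairing φ‖ₑ ≤ C * ∫⁻ x in e.target, ENNReal.ofReal (weight k c d e t φ.1 x)) :
    ∃ (h : Fin r → NormalIndex m d → Eu m → ℂ) (A : ℝ), (∀ i b, Measurable (h i b)) ∧
      (∀ i b y, ‖h i b y‖ ≤ A) ∧ ∀ φ : testMeasures E m r,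
        (∃ K ⊆ U, IsCompact K ∧ ∀ x ∉ K, φ.1 x = 0) → τ.pairing φ =
          ∑ i, ∑ b, ∫ y in e '' U, h i b y * normalDeriv k c b (component φ.1 e t i) y := by
  have hUe : U ⊆ e.source := fun x hx => (hU hx).1
  have hm := (e.isOpen_image_of_subset_source hUo hUe).measurableSet
  have : IsFiniteMeasure (volume.restrict (e '' U)) := ⟨by
    rw [Measure.restrict_apply_univ]
    exact hfin.lt_top⟩
  obtain ⟨A, hA, hle⟩ := exists_nrm_pow_mul_partialDeriv_le (m := m) k c d
  set n₀ : ℝ := ∑ _i : Fin r, ∑ q ∈ Finset.range (d + 1), ∑ _w : Fin q → Fin m, (1 : ℝ)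
  have hn₀ : 0 ≤ n₀ := Finset.sum_nonneg fun _ _ => Finset.sum_nonneg fun _ _ =>
    Finset.sum_nonneg fun _ _ => zero_le_one
  -- These expressions are linear in φ over `U`, where components are smooth; outside `U` nothing is
  -- known, hence the almost everywhere identities for the restricted measure.
  let T : Fin r × NormalIndex m d → testMeasuresIn m r E U → Eu m → ℂ := fun b φ =>
    normalDeriv k c b.2 (component φ.1.1 e t b.1)
  have hT : ∀ b φ, IntegrableOn (T b φ) (e '' U) := fun b φ =>
    integrableOn_normalDeriv he t hU hUo k c b.2 b.1 φ
  have hsm : ∀ (φ : testMeasures E m r) (b : Fin r × NormalIndex m d), ∀ y ∈ e '' U,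
      SmoothNear (fun z => normalForm c b.2.1 z ^ (k + wordDeg c b.2.2.2) *
        component φ.1 e t b.1 z) y := fun φ b y hy =>
    (smoothNear_normalForm_pow c b.2.1 _ y).mul (smoothNear_component_of_mem_image he t hU φ b.1 hy)
  obtain ⟨H, K, hH, hK, hrep⟩ := exists_densities_of_bound (ν := volume.restrict (e '' U)) T hT
    (fun b φ ψ => by
      filter_upwards [ae_restrict_mem hm] with y hy
      rw [Pi.add_apply]
      refine Eq.trans ?_ (partialDeriv_add b.2.2.2 (hsm φ.1 b y hy) (hsm ψ.1 b y hy))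
      refine partialDeriv_congr _ (Eventually.of_forall fun z => ?_)
      exact mul_add _ (component φ.1.1 e t b.1 z) (component ψ.1.1 e t b.1 z))
    (fun b a φ => by
      filter_upwards [ae_restrict_mem hm] with y hy
      rw [Pi.smul_apply, smul_eq_mul]
      refine Eq.trans ?_ (partialDeriv_const_mul b.2.2.2 a (hsm φ.1 b y hy))
      refine partialDeriv_congr _ (Eventually.of_forall fun z => ?_)
      exact mul_left_comm _ a (component φ.1.1 e t b.1 z))
    (τ.pairing ∘ₗ (testMeasuresIn m r E U).subtype) (C.toReal * (n₀ * A)) (fun φ => by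
      obtain ⟨L, hLU, hL, hφ⟩ := φ.2
      have hint : Integrable (fun y => ∑ b, ‖T b φ y‖) (volume.restrict (e '' U)) :=
        integrable_finsetSum _ fun b _ => (hT b φ).norm
      have hsum : ∀ y, 0 ≤ ∑ b, ‖T b φ y‖ := fun y => Finset.sum_nonneg fun b _ => norm_nonneg _
      have h1 : ‖τ.pairing φ.1‖ₑ ≤
          ENNReal.ofReal (C.toReal * (n₀ * A) * ∑ b, ∫ y in e '' U, ‖T b φ y‖) := by
        calc ‖τ.pairing φ.1‖ₑ
            ≤ C * ∫⁻ x in e.target, ENNReal.ofReal (weight k c d e t φ.1.1 x) := hτ φ.1 φ.2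
          _ = C * ∫⁻ x in e '' U, ENNReal.ofReal (weight k c d e t φ.1.1 x) := by
              rw [setLIntegral_weight_eq hL hφ hLU hUo hUe]
          _ ≤ C * ∫⁻ x in e '' U, ENNReal.ofReal (n₀ * A * ∑ b, ‖T b φ x‖) := by
              refine mul_le_mul_right ?_ C
              refine setLIntegral_mono' hm fun y hy => ENNReal.ofReal_le_ofReal ?_
              rw [mul_assoc]
              refine weight_le_of_forall fun q hq w i => ?_
              refine (hle _ y (smoothNear_component_of_mem_image he t hU φ.1 i hy) q hq w).trans ?_
              refine mul_le_mul_of_nonneg_left ?_ hA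
              rw [Fintype.sum_prod_type (f := fun b => ‖T b φ y‖)]
              exact Finset.single_le_sum (f := fun i => ∑ b : NormalIndex m d, ‖T (i, b) φ y‖)
                (fun i _ => Finset.sum_nonneg fun b _ => norm_nonneg _) (Finset.mem_univ i)
          _ = C * ENNReal.ofReal (∫ x in e '' U, n₀ * A * ∑ b, ‖T b φ x‖) := by
              rw [ofReal_integral_eq_lintegral_ofReal (hint.const_mul _)
                (Eventually.of_forall fun y => mul_nonneg (mul_nonneg hn₀ hA) (hsum y))]
          _ = _ := by
              rw [integral_const_mul, integral_finsetSum _ fun b _ => (hT b φ).norm,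
                mul_assoc C.toReal, ENNReal.ofReal_mul ENNReal.toReal_nonneg, ENNReal.ofReal_toReal hC]
      rw [← ofReal_norm] at h1
      refine (ENNReal.ofReal_le_ofReal_iff ?_).1 h1
      exact mul_nonneg (mul_nonneg ENNReal.toReal_nonneg (mul_nonneg hn₀ hA))
        (Finset.sum_nonneg fun b _ => integral_nonneg fun y => norm_nonneg _))
  refine ⟨fun i b => H (i, b), K, fun i b => hH _, fun i b y => hK _ y, fun φ hφ => ?_⟩
  have h1 := hrep ⟨φ, hφ⟩
  rw [Fintype.sum_prod_type] at h1
  exact h1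

/-- A distribution which satisfies weighted estimates near the points of a submanifold vanishes
along it. -/
theorem vanishesToOrder_of_weight_bound {k : ℕ} {S : Set M} (τ : Distribution E m r)
    (h : ∀ p ∈ S, ∃ e ∈ IsManifold.maximalAtlas (𝓡 m) ∞ M,
      ∃ t : Trivialization (Fin r → ℂ) (π (Fin r → ℂ) E), MemTrivializationAtlas t ∧
      ∃ c : ℕ, Straightens e c S ∧ ∃ O : Set M, IsOpen O ∧ p ∈ O ∧ p ∈ e.source ∩ t.baseSet ∧
      ∃ (C : ENNReal) (d : ℕ), C ≠ ⊤ ∧ ∀ φ : testMeasures E m r,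
        (∃ K ⊆ O, IsCompact K ∧ ∀ x ∉ K, φ.1 x = 0) →
        ‖τ.pairing φ‖ₑ ≤ C * ∫⁻ x in e.target, ENNReal.ofReal (weight k c d e t φ.1 x)) :
    τ.VanishesToOrder k S := by
  intro p hp
  obtain ⟨e, he, t, ht, c, heS, O, hO, hpO, hpe, C, d, hC, hτ⟩ := h p hp
  -- The unit ball in coordinates makes the measure on the image of `U` finite, as the L¹ duality
  -- requires.
  let U : Set M := (e.source ∩ e ⁻¹' Metric.ball (e p) 1) ∩ (O ∩ t.baseSet)
  have hUo : IsOpen U :=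
    (e.isOpen_inter_preimage Metric.isOpen_ball).inter (hO.inter t.open_baseSet)
  have hU : U ⊆ e.source ∩ t.baseSet := fun x hx => ⟨hx.1.1, hx.2.2⟩
  have heU : IsOpen (e '' U) := e.isOpen_image_of_subset_source hUo fun x hx => (hU hx).1
  have hfin : volume (e '' U) ≠ ⊤ := by
    refine ne_top_of_le_ne_top (measure_ball_lt_top (μ := volume) (x := e p) (r := 1)).ne
      (measure_mono ?_)
    rintro _ ⟨x, hx, rfl⟩
    exact hx.1.2
  obtain ⟨H, A, hH, hA, hrep⟩ := exists_densities_of_weight_bound (k := k) (c := c) (d := d) he t hU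
    hUo hfin τ hC fun φ ⟨K, hKU, hK⟩ => hτ φ ⟨K, fun x hx => (hKU hx).2.1, hK⟩
  have hZ : ∀ y ∈ e '' U, y ∈ e '' (S ∩ U) ↔ nrm c y = 0 := by
    rintro _ ⟨x, hx, rfl⟩
    rw [← heS x hx.1.1]
    constructor
    · rintro ⟨z, hz, hzx⟩
      rw [← e.injOn (hU hz.2).1 (hU hx).1 hzx]
      exact hz.1
    · exact fun hxS => ⟨x, ⟨hxS, hx⟩, rfl⟩
  let ε := Fintype.equivFin (NormalIndex m d)
  -- The expression ∂_w (x_a^(k + deg w) φ_i) is split as f = x_a^k, vanishing to order `k`, and the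
  -- tangential operator x_a^(deg w) ∂_w. The sign in the densities cancels the one from the
  -- transpose.
  refine ⟨e, he, t, ht, U, hU, hUo, ⟨⟨hpe.1, Metric.mem_ball_self one_pos⟩, hpO, hpe.2⟩,
    Fintype.card (NormalIndex m d), fun _ j y => normalForm c (ε.symm j).1 y ^ k,
    fun _ j => monomialOp (ε.symm j).2.2
      fun y => normalForm c (ε.symm j).1 y ^ wordDeg c (ε.symm j).2.2,
    fun i j y => (-1) ^ (ε.symm j).2.1.1 * H i (ε.symm j) y, fun i j => ⟨?_, ?_, ?_, ?_, ?_⟩, ?_⟩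
  · exact memIdealPow_normalForm_pow heU (fun y hy => (hZ y hy).1) _ k
  · exact monomialOp_smoothOn _ ((normalForm c _).contDiff.pow _).contDiffOn
  · exact monomialOp_tangentialOn hZ _ _
  · exact (hH i _).const_mul _
  · refine fun _ _ _ => ⟨A, fun y _ => ?_⟩
    rw [norm_mul, norm_pow, norm_neg, norm_one, one_pow, one_mul]
    exact hA i _ y
  · intro φ hφ
    rw [hrep φ hφ]
    refine Finset.sum_congr rfl fun i _ => ?_
    rw [← ε.symm.sum_comp]
    refine Finset.sum_congr rfl fun j _ => integral_congr_ae (Eventually.of_forall fun y => ?_)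
    simp only [normalDeriv, monomialOp_transpose]
    have h1 : ((-1 : ℂ) ^ (ε.symm j).2.1.1) * (-1) ^ (ε.symm j).2.1.1 = 1 := by
      rw [← mul_pow]
      simp
    have h2 : (fun z => normalForm c (ε.symm j).1 z ^ wordDeg c (ε.symm j).2.2 *
        (normalForm c (ε.symm j).1 z ^ k * component φ.1 e t i z)) = fun z =>
        normalForm c (ε.symm j).1 z ^ (k + wordDeg c (ε.symm j).2.2) * component φ.1 e t i z := by
      funext z
      rw [pow_add]
      ring
    rw [h2]
    linear_combination (-(H i (ε.symm j) y) * partialDeriv (ε.symm j).2.2 (fun z =>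
        normalForm c (ε.symm j).1 z ^ (k + wordDeg c (ε.symm j).2.2) * component φ.1 e t i z) y) * h1

end Converse

end DistVanish

end

/-! ### The integrated distribution vanishes to order `k` -/

theorem mainTheorem11 (n m r : ℕ)
    -- the Lie group `H`
    {H : Type*} [Group H] [TopologicalSpace H] [ChartedSpace (EuclideanSpace ℝ (Fin n)) H]
    [LieGroup (𝓡 n) ∞ H] [T2Space H] [SigmaCompactSpace H] [MeasurableSpace H] [BorelSpace H]
    -- the manifold `M`
    {M : Type*} [TopologicalSpace M] [ChartedSpace (EuclideanSpace ℝ (Fin m)) M]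
    [IsManifold (𝓡 m) ∞ M] [T2Space M] [SigmaCompactSpace M]
    -- the smooth action of `H` on `M`
    [MulAction H M] [ContMDiffSMul (𝓡 n) (𝓡 m) ∞ H M]
    -- the smooth complex vector bundle `E` of rank `r`, with a lift of the action
    (E : M → Type*) [∀ x, AddCommGroup (E x)] [∀ x, Module ℂ (E x)] [∀ x, TopologicalSpace (E x)]
    [TopologicalSpace (TotalSpace (Fin r → ℂ) E)] [FiberBundle (Fin r → ℂ) E]
    [VectorBundle ℂ (Fin r → ℂ) E] [ContMDiffVectorBundle ∞ (Fin r → ℂ) E (𝓡 m)]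
    (L : DistVanish.EquivariantLift n m r H E)
    -- the closed submanifold `S`, preserved by the action
    (S : Set M) (hS : DistVanish.IsClosedSubmanifold m S)
    (hHS : ∀ h : H, ∀ x ∈ S, h • x ∈ S)
    -- the smooth measure `dh = ρ μ` on `H`: a smooth multiple of Haar measure
    (μ : Measure H) [μ.IsHaarMeasure] (ρ : H → ℂ) (hρ : ContMDiff (𝓡 n) 𝓘(ℝ, ℂ) ∞ ρ)
    (Ω : Set H) (hΩ : IsCompact Ω) (hΩm : MeasurableSet Ω)
    (σ : DistVanish.Distribution E m r) (k : ℕ) (hσ : σ.VanishesToOrder k S) :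
    ∃ τ : DistVanish.Distribution E m r,
      (∀ φ : DistVanish.testMeasures E m r,
        IntegrableOn (fun h => ρ h * DistVanish.translate L h σ φ) Ω μ ∧
        τ.pairing φ = ∫ h in Ω, ρ h * DistVanish.translate L h σ φ ∂μ) ∧
      τ.VanishesToOrder k S := by
  have hρc : Continuous ρ := hρ.continuous
  refine ⟨DistVanish.integrated L σ μ hρc hΩ, fun φ =>
    ⟨DistVanish.integrableOn_translate L σ μ hρc hΩ φ, rfl⟩, ?_⟩
  refine DistVanish.vanishesToOrder_of_weight_bound _ fun p hp => ?_
  obtain ⟨e, he, hpe, c, hcm, heS⟩ := hS.2 p hp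
  have heS' : DistVanish.Straightens e c S := fun x hx =>
    (heS x hx).trans DistVanish.nrm_eq_zero_iff.symm
  have hpt : p ∈ (trivializationAt (Fin r → ℂ) E p).baseSet :=
    FiberBundle.mem_baseSet_trivializationAt' p
  obtain ⟨O, hO, hpO, C, d, hC, hb⟩ := DistVanish.exists_uniform_weight_bound L hHS hσ hΩ hp he hpe
    hcm heS' (trivializationAt (Fin r → ℂ) E p) hpt
  have hfin : ∫⁻ h in Ω, ‖ρ h‖ₑ ∂μ ≠ ⊤ :=
    (hρc.continuousOn.integrableOn_compact hΩ (μ := μ)).2.ne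
  refine ⟨e, he, _, inferInstance, c, heS', O, hO, hpO, ⟨hpe, hpt⟩, (∫⁻ h in Ω, ‖ρ h‖ₑ ∂μ) * C, d,
    ENNReal.mul_ne_top hfin hC, fun φ hφ => ?_⟩
  -- The coordinates, the neighbourhood `O`, the order `d` and the constant `C` do not depend on h ∈
  -- `Ω`, so the estimate integrates with the constant multiplied by the total mass of |ρ| over `Ω`.
  refine (enorm_integral_le_lintegral_enorm _).trans ?_
  rw [mul_assoc, ← lintegral_mul_const'' _ hρc.enorm.aemeasurable]
  refine setLIntegral_mono' hΩm fun h hh => ?_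
  rw [enorm_mul]
  gcongr
  exact hb h hh φ hφ
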